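/- Let $k$ be a field, let $R$ be a commutative ring, and let $n \ge 2$. Let $G_n(k)$ be one of the following five groups, acting on the indicated vector space $V$ over $k$: - $\mathrm{GL}_n(k)$ or $\mathrm{SL}_n(k)$, acting on $V = k^n$; in these two cases every subspace of $V$ is called isotropic; - $\mathrm{Sp}_{2n}(k)$, the subgroup of $\mathrm{GL}_{2n}(k)$ preserving the standard symplectic form $\omega$ on $V = k^{2n}$; a subspace is isotropic if $\omega$ vanishes identically on it; - $\mathrm{SO}_{n,n}(k)$, the stabilizer in $\mathrm{SL}_{2n}(k)$ of the quadratic form $q(c,d) = \sum_{j=1}^n c_j d_j$ on $V = k^{2n}$ (with $c, d \in k^n$); a subspace is isotropic if $q$ vanishes identically on it; - $\mathrm{SO}_{n,n+1}(k)$, the stabilizer in $\mathrm{SL}_{2n+1}(k)$ of the quadratic form $q(c,d,\lambda) = \lambda^2 + \sum_{j=1}^n c_j d_j$ on $V = k^{2n+1}$ (with $c, d \in k^n$, $\lambda \in k$); a subspace is isotropic if $q$ vanishes identically on it. The parabolic subgroups of $G_n(k)$ are the stabilizers of flags of isotropic subspaces of $V$. The Tits building $\mathcal{T}$ of $G_n(k)$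 is the simplicial complex whose $i$-simplices are the increasing sequences $P_0 \subsetneq \cdots \subsetneq P_i \subsetneq G_n(k)$ of proper parabolic subgroups, with $G_n(k)$ acting by conjugation. Let $r$ be the semisimple $k$-rank of $G_n$, that is, $r = n-1$ for $\mathrm{GL}_n$ and $\mathrm{SL}_n$, and $r = n$ for $\mathrm{Sp}_{2n}$, $\mathrm{SO}_{n,n}$ and $\mathrm{SO}_{n,n+1}$. The Steinberg representation of $G_n(k)$ over $R$ is the reduced homology $\mathrm{St}_{G_n}(k;R) = \widetilde{H}_{r-1}(\mathcal{T};R)$, with the induced action of $G_n(k)$. Then, in each of the five cases, the coinvariants vanish: $$\bigl(\mathrm{St}_{G_n}(k;R)\bigr)_{G_n(k)} = 0,$$ where $M_G$ denotes the largest quotient of the $G$-module $M$ on which $G$ acts trivially. -/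

import Mathlib

/-! ### Reduced homology of the order complex of a poset -/

namespace OrderComplex

/-- Strictly increasing sequences `x₀ < ⋯ < x_{m-1}` of `m` elements of the poset `α`, that is,
the simplices with `m` vertices of its order complex (for `m = 0`, the empty simplex). -/
abbrev Simplex (α : Type*) [PartialOrder α] (m : ℕ) : Type _ := Fin m ↪o α

/-- Deletion of the vertex with index `i`. -/
def face {α : Type*} [PartialOrder α] {m : ℕ} (s : Simplex α (m + 1)) (i : Fin (m + 1)) :
    Simplex α m :=
  (Fin.succAboveOrderEmb i).trans s

/-- The `R`-module of simplicial chains of dimension `m - 1`: the free module on the simplices with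
`m` vertices.  Chains of dimension `-1` are included, so the complex is the augmented one. -/
def Chains (R α : Type*) [CommRing R] [PartialOrder α] (m : ℕ) : Type _ := Simplex α m →₀ R

variable (R α : Type*) [CommRing R] [PartialOrder α]

noncomputable instance (m : ℕ) : AddCommGroup (Chains R α m) :=
  inferInstanceAs (AddCommGroup (Simplex α m →₀ R))

noncomputable instance (m : ℕ) : Module R (Chains R α m) :=
  inferInstanceAs (Module R (Simplex α m →₀ R))

/-- Chains are the finitely supported functions on the simplices. -/
noncomputable def toFinsupp (m : ℕ) : Chains R α m ≃ₗ[R] (Simplex α m →₀ R) :=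
  LinearEquiv.refl R (Simplex α m →₀ R)

variable {R α} in
/-- The chain `r • s`, for a simplex `s`. -/
noncomputable def single {m : ℕ} (s : Simplex α m) (r : R) : Chains R α m :=
  (toFinsupp R α m).symm (Finsupp.single s r)

variable {R α} in
theorem hom_ext {M : Type*} [AddCommGroup M] [Module R M] {m : ℕ} {f g : Chains R α m →ₗ[R] M}
    (h : ∀ s : Simplex α m, f (single s 1) = g (single s 1)) : f = g := by
  have h' : f ∘ₗ (toFinsupp R α m).symm.toLinearMap = g ∘ₗ (toFinsupp R α m).symm.toLinearMap :=
    Finsupp.lhom_ext' fun s => LinearMap.ext_ring (h s)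
  exact LinearMap.ext fun c => LinearMap.congr_fun h' (toFinsupp R α m c)

variable {R α} in
/-- The linear map on chains with prescribed values on the simplices. -/
noncomputable def lift {M : Type*} [AddCommGroup M] [Module R M] {m : ℕ} (f : Simplex α m → M) :
    Chains R α m →ₗ[R] M :=
  Finsupp.linearCombination R f ∘ₗ (toFinsupp R α m).toLinearMap

variable {R α} in
@[simp]
theorem lift_single {M : Type*} [AddCommGroup M] [Module R M] {m : ℕ} (f : Simplex α m → M)
    (s : Simplex α m) (r : R) : lift f (single s r) = r • f s := by
  simp [lift, single]

/-- The simplicial boundary map, from dimension `m` to dimension `m - 1`. -/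
noncomputable def boundary (m : ℕ) : Chains R α (m + 1) →ₗ[R] Chains R α m :=
  lift fun s : Simplex α (m + 1) => ∑ i : Fin (m + 1), single (face s i) ((-1 : R) ^ (i : ℕ))

theorem face_face {α : Type*} [PartialOrder α] {m : ℕ} (s : Simplex α (m + 2)) (i : Fin (m + 2))
    (j : Fin (m + 1)) : face (face s (i.succAbove j)) (j.predAbove i) = face (face s i) j :=
  RelEmbedding.ext fun l => congrArg s (Fin.succAbove_succAbove_succAbove_predAbove i j l)

theorem boundary_boundary (m : ℕ) (c : Chains R α (m + 2)) :
    boundary R α m (boundary R α (m + 1) c) = 0 := by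
  suffices h : boundary R α m ∘ₗ boundary R α (m + 1) = 0 from LinearMap.congr_fun h c
  refine hom_ext fun s => ?_
  simp only [LinearMap.comp_apply, boundary, lift_single, one_smul, map_sum, Finset.smul_sum,
    LinearMap.zero_apply]
  rw [← Finset.sum_product']
  refine Finset.sum_involution (fun p _ => (p.1.succAbove p.2, p.2.predAbove p.1)) ?_ ?_ ?_ ?_
  · rintro ⟨i, j⟩ _
    simp only [face_face, single, ← map_smul, Finsupp.smul_single, smul_eq_mul, ← pow_add,
      Fin.neg_one_pow_succAbove_add_predAbove, ← map_add, ← Finsupp.single_add]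
    simp
  · rintro ⟨i, j⟩ _ _ h
    exact Fin.succAbove_ne i j (congrArg Prod.fst h)
  · intros
    simp
  · rintro ⟨i, j⟩ _
    simp [Fin.succAbove_succAbove_predAbove, Fin.predAbove_predAbove_succAbove]

/-- The reduced simplicial cycles of dimension `m - 1`. -/
noncomputable def cycles : (m : ℕ) → Submodule R (Chains R α m)
  | 0 => ⊤
  | m + 1 => LinearMap.ker (boundary R α m)

/-- The boundaries of dimension `m - 1`, as a submodule of the cycles of that dimension. -/
noncomputable def boundaries (m : ℕ) : Submodule R (cycles R α m) :=
  (LinearMap.range (boundary R α m)).submoduleOf (cycles R α m)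

/-- The reduced homology of the order complex of `α` in degree `m - 1`, with coefficients in `R`.
For `m = 0` and `α` empty it is `R`. -/
abbrev ReducedHomology (m : ℕ) : Type _ := cycles R α m ⧸ boundaries R α m

variable {α} {G : Type*} [Group G] (a : G →* (α ≃o α))

/-- The action on chains of a group that acts on `α` by order automorphisms. -/
noncomputable def chainRep (m : ℕ) : Representation R G (Chains R α m) where
  toFun g := lift fun s : Simplex α m => single (s.trans (a g).toOrderEmbedding) 1
  map_one' := by
    refine hom_ext fun s => ?_
    rw [lift_single, one_smul, map_one]
    rfl
  map_mul' g h := by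
    refine hom_ext fun s => ?_
    rw [Module.End.mul_apply]
    simp only [lift_single, one_smul, map_mul]
    rfl

theorem chainRep_single (m : ℕ) (g : G) (s : Simplex α m) (r : R) :
    chainRep R a m g (single s r) = single (s.trans (a g).toOrderEmbedding) r := by
  change lift _ (single s r) = _
  rw [lift_single, single, single, ← map_smul, Finsupp.smul_single, smul_eq_mul, mul_one]

theorem boundary_chainRep (m : ℕ) (g : G) (c : Chains R α (m + 1)) :
    boundary R α m (chainRep R a (m + 1) g c) = chainRep R a m g (boundary R α m c) := by
  suffices h : boundary R α m ∘ₗ chainRep R a (m + 1) g = chainRep R a m g ∘ₗ boundary R α m from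
    LinearMap.congr_fun h c
  refine hom_ext fun s => ?_
  simp only [LinearMap.comp_apply, chainRep_single, boundary, lift_single, one_smul, map_sum]
  rfl

theorem cycles_le_comap (m : ℕ) (g : G) :
    cycles R α m ≤ (cycles R α m).comap (chainRep R a m g) := by
  intro c hc
  cases m with
  | zero => exact Submodule.mem_top
  | succ m =>
    have hc' : boundary R α m c = 0 := hc
    change boundary R α m (chainRep R a (m + 1) g c) = 0
    rw [boundary_chainRep, hc', map_zero]

/-- The action on cycles. -/
noncomputable def cyclesRep (m : ℕ) : Representation R G (cycles R α m) :=
  (chainRep R a m).subrepresentation (cycles R α m) (cycles_le_comap R a m)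

theorem boundaries_le_comap (m : ℕ) (g : G) :
    boundaries R α m ≤ (boundaries R α m).comap (cyclesRep R a m g) := by
  rintro ⟨c, hc⟩ ⟨d, hd⟩
  exact ⟨chainRep R a (m + 1) g d, by
    rw [boundary_chainRep, hd]
    rfl⟩

/-- The action on reduced homology in degree `m - 1`. -/
noncomputable def homologyRep (m : ℕ) : Representation R G (ReducedHomology R α m) :=
  (cyclesRep R a m).quotient (boundaries R α m) (boundaries_le_comap R a m)

end OrderComplex

/-! ### Parabolic subgroups, Tits buildings, Steinberg representations -/

/-- A linear representation `ρ` of a group `G` on a `k`-vector space `V`, with a `G`-stable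
class of subspaces of `V`, called isotropic. -/
structure IsotropicGeometry (k G V : Type*) [Field k] [Group G] [AddCommGroup V] [Module k V] where
  ρ : Representation k G V
  isotropic : Submodule k V → Prop
  isotropic_map : ∀ (g : G) (W : Submodule k V), isotropic W → isotropic (W.map (ρ g))

namespace IsotropicGeometry

variable {k G V : Type*} [Field k] [Group G] [AddCommGroup V] [Module k V]
  (X : IsotropicGeometry k G V)

/-- The parabolic subgroups of `G`: the stabilizers of flags of isotropic subspaces of `V`. A flag
is a set of subspaces that is totally ordered by inclusion. The empty flag is allowed, so `G`
is a parabolic subgroup. -/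
def IsParabolic (P : Subgroup G) : Prop :=
  ∃ F : Set (Submodule k V), IsChain (· ≤ ·) F ∧ (∀ W ∈ F, X.isotropic W) ∧
    ∀ g : G, g ∈ P ↔ ∀ W ∈ F, W.map (X.ρ g) = W

/-- The poset of proper parabolic subgroups of `G`, ordered by inclusion. The Tits building is its
order complex: the simplices are the increasing sequences of proper parabolic subgroups. -/
abbrev ProperParabolic : Type _ := {P : Subgroup G // X.IsParabolic P ∧ P ≠ ⊤}

theorem isParabolic_conj (g : G) {P : Subgroup G} (hP : X.IsParabolic P) :
    X.IsParabolic (P.map (MulAut.conj g).toMonoidHom) := by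
  obtain ⟨F, hF, hiso, hst⟩ := hP
  refine ⟨(fun W => W.map (X.ρ g)) '' F, ?_, ?_, ?_⟩
  · rintro _ ⟨W, hW, rfl⟩ _ ⟨W', hW', rfl⟩ hne
    have hne' : W ≠ W' := fun h => hne (by rw [h])
    exact (hF hW hW' hne').imp (fun h => Submodule.map_mono h) (fun h => Submodule.map_mono h)
  · rintro _ ⟨W, hW, rfl⟩
    exact X.isotropic_map g W (hiso W hW)
  · intro x
    have hmap : ∀ (s t : G) (W : Submodule k V),
        (W.map (X.ρ t)).map (X.ρ s) = W.map (X.ρ (s * t)) := fun s t W => by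
      rw [map_mul]
      exact (Submodule.map_comp (X.ρ t) (X.ρ s) W).symm
    have hone : ∀ W : Submodule k V, W.map (X.ρ 1) = W := fun W => by
      rw [map_one]
      exact Submodule.map_id W
    have hx : x ∈ P.map (MulAut.conj g).toMonoidHom ↔ g⁻¹ * x * g ∈ P := by
      constructor
      · rintro ⟨y, hy, rfl⟩
        simpa [mul_assoc] using hy
      · intro h
        exact ⟨g⁻¹ * x * g, h, by simp [mul_assoc]⟩
    rw [hx, hst, Set.forall_mem_image]
    refine forall₂_congr fun W _ => ?_
    rw [hmap]
    constructor
    · intro h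
      have h2 := congrArg (fun U => U.map (X.ρ g)) h
      simp only [hmap] at h2
      rwa [show g * (g⁻¹ * x * g) = x * g by group] at h2
    · intro h
      have h2 := congrArg (fun U => U.map (X.ρ g⁻¹)) h
      simp only [hmap] at h2
      rwa [inv_mul_cancel, hone, ← mul_assoc] at h2

/-- The conjugate of a proper parabolic subgroup. -/
def conj (g : G) (P : X.ProperParabolic) : X.ProperParabolic :=
  ⟨P.1.map (MulAut.conj g).toMonoidHom, X.isParabolic_conj g P.2.1, fun h => P.2.2 (by
    rw [eq_top_iff]
    intro x _
    have hx : g * x * g⁻¹ ∈ P.1.map (MulAut.conj g).toMonoidHom := by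
      rw [h]
      exact Subgroup.mem_top _
    obtain ⟨y, hy, hyx⟩ := hx
    have hyx' : g * y * g⁻¹ = g * x * g⁻¹ := hyx
    rwa [← mul_left_cancel (mul_right_cancel hyx')])⟩

protected theorem conj_one (P : X.ProperParabolic) : X.conj 1 P = P := by
  refine Subtype.ext (Subgroup.ext fun x => ?_)
  simp [conj, Subgroup.mem_map]

protected theorem conj_mul (g h : G) (P : X.ProperParabolic) : X.conj (g * h) P = X.conj g (X.conj h P) := by
  refine Subtype.ext ?_
  change P.1.map _ = (P.1.map _).map _
  rw [Subgroup.map_map]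
  congr 1
  ext x
  simp [mul_assoc]

/-- The conjugation action of `G` on its poset of proper parabolic subgroups. -/
def conjAction : G →* (X.ProperParabolic ≃o X.ProperParabolic) where
  toFun g :=
    { toFun := X.conj g
      invFun := X.conj g⁻¹
      left_inv := fun P => by rw [← X.conj_mul, inv_mul_cancel, X.conj_one]
      right_inv := fun P => by rw [← X.conj_mul, mul_inv_cancel, X.conj_one]
      map_rel_iff' := fun {P Q} =>
        Subgroup.map_le_map_iff_of_injective (MulAut.conj g).injective }
  map_one' := RelIso.ext fun P => X.conj_one P
  map_mul' g h := RelIso.ext fun P => X.conj_mul g h P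

/-- The Steinberg representation of `G` over `R`, if `r` is the semisimple rank of `G`: the reduced
homology in degree `r - 1` of the Tits building, with the action of `G` induced by conjugation. -/
noncomputable def steinberg (R : Type*) [CommRing R] (r : ℕ) :
    Representation R G (OrderComplex.ReducedHomology R X.ProperParabolic r) :=
  OrderComplex.homologyRep R X.conjAction r

end IsotropicGeometry

/-! ### The five families of classical groups -/

namespace Classical5

variable (k : Type*) [Field k] (n : ℕ)

/-- Matrices acting on column vectors. -/
noncomputable def matrixRep (ι : Type*) [Fintype ι] [DecidableEq ι] :
    Matrix ι ι k →* Module.End k (ι → k) :=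
  (Matrix.toLinAlgEquiv' : Matrix ι ι k ≃ₐ[k] _).toAlgHom.toRingHom.toMonoidHom

/-- `GL_n(k)` acting on `k^n`; every subspace counts as isotropic. -/
noncomputable def geometryGL : IsotropicGeometry k (Matrix.GeneralLinearGroup (Fin n) k) (Fin n → k) where
  ρ := (matrixRep k (Fin n)).comp (Units.coeHom _)
  isotropic _ := True
  isotropic_map _ _ _ := trivial

/-- `SL_n(k)` acting on `k^n`; every subspace counts as isotropic. -/
noncomputable def geometrySL : IsotropicGeometry k (Matrix.SpecialLinearGroup (Fin n) k) (Fin n → k) where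
  ρ := (matrixRep k (Fin n)).comp Matrix.SpecialLinearGroup.coeMonoidHom
  isotropic _ := True
  isotropic_map _ _ _ := trivial

variable {n} in
/-- The standard symplectic form on `k^{2n}`, with symplectic basis
`a_j = inl j`, `b_j = inr j`. -/
def symplecticForm (x y : Fin n ⊕ Fin n → k) : k :=
  ∑ j, (x (Sum.inl j) * y (Sum.inr j) - x (Sum.inr j) * y (Sum.inl j))

/-- `Sp_{2n}(k)`: the invertible matrices that preserve the standard symplectic form. -/
def Sp : Subgroup (Matrix.GeneralLinearGroup (Fin n ⊕ Fin n) k) where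
  carrier := {A | ∀ x y, symplecticForm k (A.1.mulVec x) (A.1.mulVec y) = symplecticForm k x y}
  one_mem' x y := by simp
  mul_mem' {A B} hA hB x y := by
    rw [Units.val_mul, ← Matrix.mulVec_mulVec, ← Matrix.mulVec_mulVec, hA, hB]
  inv_mem' {A} hA x y := by
    rw [← hA, Matrix.mulVec_mulVec, Matrix.mulVec_mulVec, ← Units.val_mul, mul_inv_cancel,
      Units.val_one, Matrix.one_mulVec, Matrix.one_mulVec]

/-- `Sp_{2n}(k)` acting on `k^{2n}`; a subspace is isotropic if the symplectic form vanishes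
identically on it. -/
noncomputable def geometrySp : IsotropicGeometry k (Sp k n) (Fin n ⊕ Fin n → k) where
  ρ := (matrixRep k (Fin n ⊕ Fin n)).comp ((Units.coeHom _).comp (Sp k n).subtype)
  isotropic W := ∀ x ∈ W, ∀ y ∈ W, symplecticForm k x y = 0
  isotropic_map := by
    rintro g W hW _ ⟨x, hx, rfl⟩ _ ⟨y, hy, rfl⟩
    exact (g.2 x y).trans (hW x hx y hy)

variable {k} in
/-- The stabilizer in `SL(k^ι)` of a function `q` on `k^ι`. -/
def SO {ι : Type*} [Fintype ι] [DecidableEq ι] (q : (ι → k) → k) :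
    Subgroup (Matrix.SpecialLinearGroup ι k) where
  carrier := {A | ∀ x, q (A.1.mulVec x) = q x}
  one_mem' x := by simp
  mul_mem' {A B} hA hB x := by
    rw [Matrix.SpecialLinearGroup.coe_mul, ← Matrix.mulVec_mulVec, hA, hB]
  inv_mem' {A} hA x := by
    rw [← hA, Matrix.mulVec_mulVec, ← Matrix.SpecialLinearGroup.coe_mul, mul_inv_cancel,
      Matrix.SpecialLinearGroup.coe_one, Matrix.one_mulVec]

variable {k} in
/-- `SO(q)` acting on `k^ι`; a subspace is isotropic if `q` vanishes identically on it. -/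
noncomputable def geometrySO {ι : Type*} [Fintype ι] [DecidableEq ι] (q : (ι → k) → k) :
    IsotropicGeometry k (SO q) (ι → k) where
  ρ := (matrixRep k ι).comp (Matrix.SpecialLinearGroup.coeMonoidHom.comp (SO q).subtype)
  isotropic W := ∀ x ∈ W, q x = 0
  isotropic_map := by
    rintro g W hW _ ⟨x, hx, rfl⟩
    exact (g.2 x).trans (hW x hx)

/-- The quadratic form `∑ c_j d_j` on `k^{2n}`, where `c_j`, `d_j` are the coordinates with index
`inl j`, `inr j`. Its stabilizer in `SL_{2n}(k)` is `SO_{n,n}(k)`. -/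
def qEven (x : Fin n ⊕ Fin n → k) : k := ∑ j, x (Sum.inl j) * x (Sum.inr j)

/-- The quadratic form `λ ^ 2 + ∑ c_j d_j` on `k^{2n+1}`, where `c_j`, `d_j`, `λ` are the coordinates
with index `inl (inl j)`, `inl (inr j)`, `inr ()`. Its stabilizer in `SL_{2n+1}(k)` is
`SO_{n,n+1}(k)`. -/
def qOdd (x : (Fin n ⊕ Fin n) ⊕ Unit → k) : k :=
  x (Sum.inr ()) ^ 2 + ∑ j, x (Sum.inl (Sum.inl j)) * x (Sum.inl (Sum.inr j))

variable (R : Type*) [CommRing R]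

/-- `St_{GL_n}(k; R)`; the semisimple rank of `GL_n` is `n - 1`. -/
noncomputable abbrev steinbergGL := (geometryGL k n).steinberg R (n - 1)

/-- `St_{SL_n}(k; R)`; the semisimple rank of `SL_n` is `n - 1`. -/
noncomputable abbrev steinbergSL := (geometrySL k n).steinberg R (n - 1)

/-- `St_{Sp_{2n}}(k; R)`; the semisimple rank of `Sp_{2n}` is `n`. -/
noncomputable abbrev steinbergSp := (geometrySp k n).steinberg R n

/-- `St_{SO_{n,n}}(k; R)`; the semisimple rank of `SO_{n,n}` is `n`, except that it is `0` for the
torus `SO_{1,1}`. -/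
noncomputable abbrev steinbergSOEven :=
  (geometrySO (qEven k n)).steinberg R (if n = 1 then 0 else n)

/-- `St_{SO_{n,n+1}}(k; R)`; the semisimple rank of `SO_{n,n+1}` is `n`. -/
noncomputable abbrev steinbergSOOdd := (geometrySO (qOdd k n)).steinberg R n

end Classical5

/-!
The group acts on the order complex of its proper parabolic subgroups; this complex is replaced by
the order complex of the poset of isotropic subspaces of `V`, and there the coinvariants are killed
by a Solomon-Tits argument.

*From parabolic subgroups to subspaces.* Sending a flag to its stabilizer gives the barycentric
subdivision map from chains of isotropic subspaces to chains of parabolic subgroups, and it is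
equivariant. Sending a parabolic subgroup `P` to the least nonzero isotropic subspace that it fixes
is monotone, and the composite of the two is homotopic to the identity, because all vertices involved
lie above `P` (acyclic carriers). So every class in the Steinberg representation is a subdivision,
`IsotropicGeometry.exists_boundary_eq_sub_subdivision`. The argument does not ask that distinct flags
have distinct stabilizers, which fails for `SO_{n,n}` in characteristic different from `2`. It
does need that a subspace fixed by the stabilizer of a flag contains the smallest term of the flag,
which follows by moving vectors with transvections (`IsLinear.leastTermFixed`) or Siegel
transvections (`IsPolar.least_le`).

*Generation.* Fix a hyperplane `c` (for the linear groups) or `c = p^⊥` with `p` singular (for the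
others). The isotropic subspaces that meet `c` form a contractible poset, by Quillen's criterion; the
others are lines `o`, whose links are the posets of a smaller geometry `So o`, via `W ↦ W ∩ c` and
`W ↦ W + o`. So a cycle is a sum of suspensions of cycles of the geometries `So o`, up to boundaries
(`OrderComplex.IsOppositeSystem.cyclesOn_le`). Suspension is equivariant for the group elements that
fix `o` and `c`, so the vanishing of coinvariants passes from `So o` to the whole geometry, by
induction on the rank. It is enough to use transvections of the smaller geometry.

*Base of the induction.* For the projective line, `[b] - [a] = g w - w`, where `w = [a] - [c]` with
a third point `c`, and `g` is a transvection that fixes `c` and maps `a` to `b`. For polar spaces one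
stops at Witt index `2`, where cycles are generated by the apartments of hyperbolic
bases `a, b, c, d`, and such an apartment is `w - g w`, where `w` is the apartment
of `a - b, b, c, c + d` and `g` is a Siegel transvection (`IsPolar.quadrangle_mem_coinvariantsKer`).
-/

/-! ### Cones, acyclic carriers and homotopies on order complexes -/

namespace OrderComplex

section Cones

variable {R α β : Type*} [CommRing R] [PartialOrder α] [PartialOrder β]

theorem boundary_single {m : ℕ} (s : Simplex α (m + 1)) :
    boundary R α m (single s 1) = ∑ i : Fin (m + 1), (-1 : R) ^ (i : ℕ) • single (face s i) 1 := by
  simp only [boundary, lift_single, one_smul]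
  refine Finset.sum_congr rfl fun i _ => ?_
  simp only [single, ← map_smul, Finsupp.smul_single, smul_eq_mul, mul_one]

open Classical in
/-- The simplex with the vertices `x 0, x 1, …`, as a chain; it is `0` unless the sequence is
strictly increasing. -/
noncomputable def ofSeq (R : Type*) [CommRing R] {m : ℕ} (x : Fin m → β) : Chains R β m :=
  if h : StrictMono x then single (OrderEmbedding.ofStrictMono x h) 1 else 0

theorem ofSeq_of_strictMono {m : ℕ} {x : Fin m → β} (h : StrictMono x) :
    ofSeq R x = single (OrderEmbedding.ofStrictMono x h) 1 := dif_pos h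

theorem ofSeq_of_not_strictMono {m : ℕ} {x : Fin m → β} (h : ¬ StrictMono x) :
    ofSeq R x = 0 := dif_neg h

theorem ofSeq_coe {m : ℕ} (s : Simplex β m) : ofSeq R s = single s 1 :=
  ofSeq_of_strictMono s.strictMono

/-- Prepending the vertex `b`. A simplex goes to `0` if `b` is not strictly below all of its
vertices. -/
noncomputable def cone (b : β) (m : ℕ) : Chains R β m →ₗ[R] Chains R β (m + 1) :=
  lift fun s => ofSeq R (Fin.cons b s : Fin (m + 1) → β)

theorem cone_single (b : β) {m : ℕ} (s : Simplex β m) :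
    cone b m (single s (1 : R)) = ofSeq R (Fin.cons b s : Fin (m + 1) → β) := by
  simp [cone]

theorem strictMono_cons {b : β} {m : ℕ} {x : Fin m → β} :
    StrictMono (Fin.cons b x : Fin (m + 1) → β) ↔ (∀ i, b < x i) ∧ StrictMono x := by
  constructor
  · intro h
    exact ⟨fun i => by simpa using h (Fin.succ_pos i),
      fun i j hij => by simpa using h (Fin.succ_lt_succ_iff.2 hij)⟩
  · rintro ⟨h1, h2⟩ i j hij
    obtain ⟨j, rfl⟩ := Fin.exists_succ_eq.2 (Fin.ne_zero_of_lt hij)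
    induction i using Fin.cases with
    | zero => simpa using h1 j
    | succ i => simpa using h2 (Fin.succ_lt_succ_iff.1 hij)

theorem boundary_zero_cone (b : β) (c : Chains R β 0) :
    boundary R β 0 (cone b 0 c) = c := by
  suffices h : boundary R β 0 ∘ₗ cone b 0 = LinearMap.id from LinearMap.congr_fun h c
  refine hom_ext fun s => ?_
  have hs : StrictMono (Fin.cons b s : Fin 1 → β) :=
    strictMono_cons.2 ⟨fun i => i.elim0, s.strictMono⟩
  rw [LinearMap.comp_apply, cone_single, ofSeq_of_strictMono hs, boundary_single,
    Fin.sum_univ_one, Fin.val_zero, pow_zero, one_smul, LinearMap.id_apply]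
  congr 1

/-- The chains supported on `S`: the span of the simplices all of whose vertices lie in `S`. -/
noncomputable def supported (R : Type*) [CommRing R] (S : Set α) (m : ℕ) : Submodule R (Chains R α m) :=
  Submodule.span R {c | ∃ s : Simplex α m, (∀ i, s i ∈ S) ∧ single s 1 = c}

theorem single_mem_supported {S : Set α} {m : ℕ} {s : Simplex α m} (h : ∀ i, s i ∈ S) :
    single s (1 : R) ∈ supported R S m := Submodule.subset_span ⟨s, h, rfl⟩

theorem supported_mono {S T : Set α} (h : S ⊆ T) (m : ℕ) : supported R S m ≤ supported R T m :=
  Submodule.span_mono fun _ ⟨s, hs, e⟩ => ⟨s, fun i => h (hs i), e⟩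

theorem supported_le {S : Set α} {m : ℕ} {N : Submodule R (Chains R α m)}
    (h : ∀ s : Simplex α m, (∀ i, s i ∈ S) → single s 1 ∈ N) : supported R S m ≤ N :=
  Submodule.span_le.2 fun _ ⟨s, hs, e⟩ => e ▸ h s hs

theorem map_mem_of_supported {M : Type*} [AddCommGroup M] [Module R M] {S : Set α} {m : ℕ}
    {N : Submodule R M} (f : Chains R α m →ₗ[R] M)
    (h : ∀ s : Simplex α m, (∀ i, s i ∈ S) → f (single s 1) ∈ N) {c : Chains R α m}
    (hc : c ∈ supported R S m) : f c ∈ N :=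
  supported_le (N := N.comap f) h hc

theorem eq_of_supported {M : Type*} [AddCommGroup M] [Module R M] {S : Set α} {m : ℕ}
    {f g : Chains R α m →ₗ[R] M}
    (h : ∀ s : Simplex α m, (∀ i, s i ∈ S) → f (single s 1) = g (single s 1)) {c : Chains R α m}
    (hc : c ∈ supported R S m) : f c = g c := by
  have := map_mem_of_supported (N := ⊥) (f - g) (fun s hs => by simp [h s hs]) hc
  simpa [sub_eq_zero] using this

theorem mem_supported_univ {m : ℕ} (c : Chains R α m) : c ∈ supported R Set.univ m := by
  have : (⊤ : Submodule R (Chains R α m)) ≤ supported R Set.univ m := by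
    have h : (supported R (Set.univ : Set α) m).mkQ = 0 := hom_ext fun s => by
      simpa using single_mem_supported (fun i => Set.mem_univ _)
    intro c _
    simpa using LinearMap.congr_fun h c
  exact this trivial

/-- A chain has only finitely many vertices. -/
theorem exists_finset_supported {S : Set α} {m : ℕ} {c : Chains R α m}
    (hc : c ∈ supported R S m) :
    ∃ F : Finset α, (F : Set α) ⊆ S ∧ c ∈ supported R (F : Set α) m := by
  classical
  induction hc using Submodule.span_induction with
  | mem c h =>
    obtain ⟨s, hs, rfl⟩ := h
    refine ⟨Finset.univ.image s, ?_, single_mem_supported fun i => by simp⟩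
    simp only [Finset.coe_image, Finset.coe_univ, Set.image_univ]
    rintro _ ⟨i, rfl⟩
    exact hs i
  | zero => exact ⟨∅, by simp, Submodule.zero_mem _⟩
  | add x y _ _ hx hy =>
    obtain ⟨F, hF, hx⟩ := hx
    obtain ⟨F', hF', hy⟩ := hy
    refine ⟨F ∪ F', by simp [hF, hF'], Submodule.add_mem _ ?_ ?_⟩
    · exact supported_mono (by simp) m hx
    · exact supported_mono (by simp) m hy
  | smul a x _ hx =>
    obtain ⟨F, hF, hx⟩ := hx
    exact ⟨F, hF, Submodule.smul_mem _ _ hx⟩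

theorem boundary_mem_supported {S : Set α} {m : ℕ} {c : Chains R α (m + 1)}
    (hc : c ∈ supported R S (m + 1)) : boundary R α m c ∈ supported R S m := by
  refine map_mem_of_supported _ (fun s hs => ?_) hc
  rw [boundary_single]
  exact Submodule.sum_mem _ fun i _ => Submodule.smul_mem _ _ (single_mem_supported fun j => hs _)

theorem ofSeq_mem_supported {S : Set α} {m : ℕ} {x : Fin m → α} (h : ∀ i, x i ∈ S) :
    ofSeq R x ∈ supported R S m := by
  by_cases hx : StrictMono x
  · rw [ofSeq_of_strictMono hx]
    exact single_mem_supported h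
  · rw [ofSeq_of_not_strictMono hx]
    exact Submodule.zero_mem _

theorem cone_mem_supported {S : Set β} {b : β} (hb : b ∈ S) {m : ℕ} {c : Chains R β m}
    (hc : c ∈ supported R S m) : cone b m c ∈ supported R S (m + 1) := by
  refine map_mem_of_supported _ (fun s hs => ?_) hc
  rw [cone_single]
  refine ofSeq_mem_supported fun i => ?_
  induction i using Fin.cases with
  | zero => simpa using hb
  | succ i => simpa using hs i

theorem face_apply_zero {m : ℕ} (s : Simplex β (m + 2)) (i : Fin (m + 1)) :
    face s i.succ 0 = s 0 := rfl

theorem cone_eq_zero {b : β} {m : ℕ} {s : Simplex β (m + 1)} (h : s 0 = b) :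
    cone b (m + 1) (single s (1 : R)) = 0 := by
  rw [cone_single, ofSeq_of_not_strictMono]
  intro hs
  exact (h ▸ (strictMono_cons.1 hs).1 0).false

theorem cone_face_zero {m : ℕ} (s : Simplex β (m + 1)) :
    cone (s 0) m (single (face s 0) (1 : R)) = single s 1 := by
  rw [cone_single]
  have : (Fin.cons (s 0) (face s 0) : Fin (m + 1) → β) = s := by
    funext i
    induction i using Fin.cases with
    | zero => rfl
    | succ i => simp [face, Fin.succAboveOrderEmb]
  rw [this, ofSeq_coe]

/-- A simplex is the cone, from its smallest vertex, on its boundary. -/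
theorem cone_boundary_single {m : ℕ} (s : Simplex β (m + 1)) :
    cone (s 0) m (boundary R β m (single s 1)) = single s 1 := by
  rw [boundary_single, map_sum, Fin.sum_univ_succ]
  simp only [Fin.val_zero, pow_zero, one_smul, cone_face_zero]
  rw [add_eq_left]
  refine Finset.sum_eq_zero fun i _ => ?_
  rw [map_smul]
  obtain _ | m := m
  · exact i.elim0
  · rw [cone_eq_zero (face_apply_zero s i), smul_zero]

theorem boundary_cone {b : β} {m : ℕ} {c : Chains R β (m + 1)}
    (hc : c ∈ supported R (Set.Ici b) (m + 1)) :
    boundary R β (m + 1) (cone b (m + 1) c) = c - cone b m (boundary R β m c) := by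
  refine eq_of_supported (f := boundary R β (m + 1) ∘ₗ cone b (m + 1))
    (g := LinearMap.id - cone b m ∘ₗ boundary R β m) (fun s hs => ?_) hc
  simp only [LinearMap.comp_apply, LinearMap.sub_apply, LinearMap.id_apply]
  obtain h0 | h0 := (show b ≤ s 0 from hs 0).eq_or_lt
  · subst h0
    rw [cone_boundary_single, cone_eq_zero rfl, map_zero, sub_self]
  · have hlt : ∀ i, b < s i := fun i => h0.trans_le (s.monotone (Fin.zero_le i))
    have hst : StrictMono (Fin.cons b s : Fin (m + 2) → β) := strictMono_cons.2 ⟨hlt, s.strictMono⟩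
    rw [cone_single, ofSeq_of_strictMono hst, boundary_single, Fin.sum_univ_succ, boundary_single,
      map_sum, sub_eq_add_neg, ← Finset.sum_neg_distrib]
    refine congrArg₂ (· + ·) ?_ (Finset.sum_congr rfl fun i _ => ?_)
    · simp only [Fin.val_zero, pow_zero, one_smul]
      congr 1
    · rw [map_smul, cone_single, Fin.val_succ, pow_succ, mul_neg_one, neg_smul]
      have hst' : StrictMono (Fin.cons b (face s i) : Fin (m + 1) → β) :=
        strictMono_cons.2 ⟨fun j => hlt _, (face s i).strictMono⟩
      rw [ofSeq_of_strictMono hst']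
      congr 3
      refine RelEmbedding.ext fun j => ?_
      induction j using Fin.cases with
      | zero => simp [face, Fin.succAboveOrderEmb]
      | succ j => simp [face, Fin.succAboveOrderEmb]

/-! ### Chain maps and homotopies given by carriers -/

/-- The chain map that sends a simplex `s` to the cone, with apex `b s`, on the image of its
boundary. -/
noncomputable def carry (R : Type*) [CommRing R] (b : ∀ m, Simplex α (m + 1) → β) :
    ∀ m, Chains R α m →ₗ[R] Chains R β m
  | 0 => lift fun _ => ofSeq R fun i => i.elim0
  | m + 1 => lift fun s => cone (b m s) m (carry R b m (boundary R α m (single s 1)))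

theorem carry_zero_single (b : ∀ m, Simplex α (m + 1) → β) (s : Simplex α 0) (t : Simplex β 0) :
    carry R b 0 (single s 1) = single t 1 := by
  simp only [carry, lift_single, one_smul]
  rw [← ofSeq_coe]
  congr 1
  exact funext fun i => i.elim0

theorem carry_succ_single (b : ∀ m, Simplex α (m + 1) → β) (m : ℕ) (s : Simplex α (m + 1)) :
    carry R b (m + 1) (single s 1) =
      cone (b m s) m (carry R b m (boundary R α m (single s 1))) := by
  simp [carry]

/-- The apexes `b s` of simplices on `S` increase when vertices are deleted. -/
def IsCarrier (S : Set α) (b : ∀ m, Simplex α (m + 1) → β) : Prop :=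
  ∀ m (s : Simplex α (m + 2)), (∀ i, s i ∈ S) → ∀ i, b (m + 1) s ≤ b m (face s i)

theorem face_mem {S : Set α} {m : ℕ} {s : Simplex α (m + 1)} (hs : ∀ i, s i ∈ S) (i : Fin (m + 1))
    (j : Fin m) : face s i j ∈ S := hs _

theorem map_boundary_single_mem {M : Type*} [AddCommGroup M] [Module R M] {N : Submodule R M}
    {m : ℕ} (f : Chains R α m →ₗ[R] M) {s : Simplex α (m + 1)}
    (h : ∀ i, f (single (face s i) 1) ∈ N) : f (boundary R α m (single s 1)) ∈ N := by
  rw [boundary_single, map_sum]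
  refine Submodule.sum_mem _ fun i _ => ?_
  rw [map_smul]
  exact Submodule.smul_mem _ _ (h i)

theorem carry_single_mem {S : Set α} {T : Set β} {b : ∀ m, Simplex α (m + 1) → β}
    (hb : IsCarrier S b) (hT : ∀ m (s : Simplex α (m + 1)), (∀ i, s i ∈ S) → b m s ∈ T) (m : ℕ)
    (s : Simplex α (m + 1)) (hs : ∀ i, s i ∈ S) :
    carry R b (m + 1) (single s 1) ∈ supported R (T ∩ Set.Ici (b m s)) (m + 1) := by
  induction m with
  | zero =>
    rw [carry_succ_single]
    refine cone_mem_supported (S := T ∩ Set.Ici (b _ s)) ⟨hT _ s hs, le_rfl⟩ ?_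
    refine map_boundary_single_mem _ fun i => ?_
    rw [carry_zero_single _ _ (OrderEmbedding.ofStrictMono
      (fun i => i.elim0) (fun i => i.elim0))]
    exact single_mem_supported fun i => i.elim0
  | succ m ih =>
    rw [carry_succ_single]
    refine cone_mem_supported (S := T ∩ Set.Ici (b _ s)) ⟨hT _ s hs, le_rfl⟩ ?_
    refine map_boundary_single_mem _ fun i => ?_
    refine supported_mono ?_ _ (ih (face s i) (face_mem hs i))
    exact Set.inter_subset_inter_right _ (Set.Ici_subset_Ici.2 (hb m s hs i))

theorem carry_mem_supported {S : Set α} {T : Set β} {b : ∀ m, Simplex α (m + 1) → β}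
    (hb : IsCarrier S b) (hT : ∀ m (s : Simplex α (m + 1)), (∀ i, s i ∈ S) → b m s ∈ T) {m : ℕ}
    {c : Chains R α (m + 1)} (hc : c ∈ supported R S (m + 1)) :
    carry R b (m + 1) c ∈ supported R T (m + 1) :=
  map_mem_of_supported _ (fun s hs => supported_mono Set.inter_subset_left _
    (carry_single_mem hb hT m s hs)) hc

theorem boundary_carry {S : Set α} {b : ∀ m, Simplex α (m + 1) → β} (hb : IsCarrier S b) {m : ℕ}
    {c : Chains R α (m + 1)} (hc : c ∈ supported R S (m + 1)) :
    boundary R β m (carry R b (m + 1) c) = carry R b m (boundary R α m c) := by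
  induction m with
  | zero =>
    refine eq_of_supported (f := boundary R β 0 ∘ₗ carry R b 1)
      (g := carry R b 0 ∘ₗ boundary R α 0) (fun s _ => ?_) hc
    rw [LinearMap.comp_apply, carry_succ_single, boundary_zero_cone, LinearMap.comp_apply]
  | succ m ih =>
    refine eq_of_supported (f := boundary R β (m + 1) ∘ₗ carry R b (m + 2))
      (g := carry R b (m + 1) ∘ₗ boundary R α (m + 1)) (fun s hs => ?_) hc
    have h1 := single_mem_supported (R := R) hs
    rw [LinearMap.comp_apply, carry_succ_single, boundary_cone, ih (boundary_mem_supported h1),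
      boundary_boundary, map_zero, map_zero, sub_zero, LinearMap.comp_apply]
    refine map_boundary_single_mem _ fun i => ?_
    refine supported_mono ?_ _
      (carry_single_mem (T := Set.univ) hb (fun _ _ _ => trivial) m (face s i) (face_mem hs i))
    exact fun x hx => (hb m s hs i).trans hx.2

/-- The homotopy from `ψ` to `φ` that is built from cones with apex `b s`. -/
noncomputable def htpy (b : ∀ m, Simplex α (m + 1) → β)
    (φ ψ : ∀ m, Chains R α m →ₗ[R] Chains R β m) :
    ∀ m, Chains R α m →ₗ[R] Chains R β (m + 1)
  | 0 => 0
  | m + 1 => lift fun s => cone (b m s) (m + 1)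
      (φ (m + 1) (single s 1) - ψ (m + 1) (single s 1) -
        htpy b φ ψ m (boundary R α m (single s 1)))

theorem htpy_succ_single (b : ∀ m, Simplex α (m + 1) → β)
    (φ ψ : ∀ m, Chains R α m →ₗ[R] Chains R β m) (m : ℕ) (s : Simplex α (m + 1)) :
    htpy b φ ψ (m + 1) (single s 1) = cone (b m s) (m + 1)
      (φ (m + 1) (single s 1) - ψ (m + 1) (single s 1) -
        htpy b φ ψ m (boundary R α m (single s 1))) := by
  simp [htpy]

/-- The maps `φ` send each simplex `s` on `S` to a chain supported on `T` whose vertices are all at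
least `b s`. -/
def CarriedBy (S : Set α) (T : Set β) (b : ∀ m, Simplex α (m + 1) → β)
    (φ : ∀ m, Chains R α m →ₗ[R] Chains R β m) : Prop :=
  ∀ m (s : Simplex α (m + 1)), (∀ i, s i ∈ S) →
    φ (m + 1) (single s 1) ∈ supported R (T ∩ Set.Ici (b m s)) (m + 1)

section Htpy

variable {S : Set α} {T : Set β} {b : ∀ m, Simplex α (m + 1) → β}
  {φ ψ : ∀ m, Chains R α m →ₗ[R] Chains R β m}

theorem htpy_arg_mem (hb : IsCarrier S b)
    (hT : ∀ m (s : Simplex α (m + 1)), (∀ i, s i ∈ S) → b m s ∈ T)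
    (hφ : CarriedBy S T b φ) (hψ : CarriedBy S T b ψ) (m : ℕ)
    (s : Simplex α (m + 1)) (hs : ∀ i, s i ∈ S) :
    φ (m + 1) (single s 1) - ψ (m + 1) (single s 1) - htpy b φ ψ m (boundary R α m (single s 1))
      ∈ supported R (T ∩ Set.Ici (b m s)) (m + 1) := by
  induction m with
  | zero =>
    simpa [htpy] using Submodule.sub_mem _ (hφ 0 s hs) (hψ 0 s hs)
  | succ m ih =>
    refine Submodule.sub_mem _ (Submodule.sub_mem _ (hφ _ s hs) (hψ _ s hs)) ?_
    refine map_boundary_single_mem _ fun i => ?_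
    rw [htpy_succ_single]
    refine supported_mono (Set.inter_subset_inter_right T (Set.Ici_subset_Ici.2 (hb m s hs i))) _ ?_
    exact cone_mem_supported (S := T ∩ Set.Ici (b m (face s i))) ⟨hT _ _ (face_mem hs i), le_rfl⟩ (ih _ (face_mem hs i))

theorem htpy_mem_supported (hb : IsCarrier S b)
    (hT : ∀ m (s : Simplex α (m + 1)), (∀ i, s i ∈ S) → b m s ∈ T)
    (hφ : CarriedBy S T b φ) (hψ : CarriedBy S T b ψ) {m : ℕ} {c : Chains R α (m + 1)}
    (hc : c ∈ supported R S (m + 1)) : htpy b φ ψ (m + 1) c ∈ supported R T (m + 2) := by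
  refine map_mem_of_supported _ (fun s hs => ?_) hc
  rw [htpy_succ_single]
  exact cone_mem_supported (hT m s hs) (supported_mono Set.inter_subset_left _
    (htpy_arg_mem hb hT hφ hψ m s hs))

theorem boundary_htpy (hb : IsCarrier S b)
    (hφ : CarriedBy S Set.univ b φ) (hψ : CarriedBy S Set.univ b ψ) (h0 : φ 0 = ψ 0)
    (hφ' : ∀ m (c : Chains R α (m + 1)), c ∈ supported R S (m + 1) →
      boundary R β m (φ (m + 1) c) = φ m (boundary R α m c))
    (hψ' : ∀ m (c : Chains R α (m + 1)), c ∈ supported R S (m + 1) →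
      boundary R β m (ψ (m + 1) c) = ψ m (boundary R α m c))
    {m : ℕ} {c : Chains R α (m + 1)} (hc : c ∈ supported R S (m + 1)) :
    boundary R β (m + 1) (htpy b φ ψ (m + 1) c) =
      φ (m + 1) c - ψ (m + 1) c - htpy b φ ψ m (boundary R α m c) := by
  have key : ∀ m (s : Simplex α (m + 1)), (∀ i, s i ∈ S) →
      boundary R β m (φ (m + 1) (single s 1) - ψ (m + 1) (single s 1) -
        htpy b φ ψ m (boundary R α m (single s 1))) = 0 → boundary R β (m + 1)
        (htpy b φ ψ (m + 1) (single s 1)) = φ (m + 1) (single s 1) - ψ (m + 1) (single s 1) -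
        htpy b φ ψ m (boundary R α m (single s 1)) := by
    intro m s hs h
    have h2 := htpy_arg_mem hb (T := Set.univ) (fun _ _ _ => trivial) hφ hψ m s hs
    rw [htpy_succ_single, boundary_cone (supported_mono Set.inter_subset_right _ h2), h, map_zero,
      sub_zero]
  induction m with
  | zero =>
    refine eq_of_supported (f := boundary R β 1 ∘ₗ htpy b φ ψ 1)
      (g := φ 1 - ψ 1 - htpy b φ ψ 0 ∘ₗ boundary R α 0) (fun s hs => key 0 s hs ?_) hc
    have h1 := single_mem_supported (R := R) hs
    simp [map_sub, hφ' 0 _ h1, hψ' 0 _ h1, h0, htpy]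
  | succ m ih =>
    refine eq_of_supported (f := boundary R β (m + 2) ∘ₗ htpy b φ ψ (m + 2))
      (g := φ (m + 2) - ψ (m + 2) - htpy b φ ψ (m + 1) ∘ₗ boundary R α (m + 1))
      (fun s hs => key _ s hs ?_) hc
    have h1 := single_mem_supported (R := R) hs
    rw [map_sub, map_sub, hφ' _ _ h1, hψ' _ _ h1, ih (boundary_mem_supported h1),
      boundary_boundary, map_zero, sub_zero, sub_self]

end Htpy

/-! ### The chain map of a monotone map -/

/-- The chain map induced by a map of posets, with degenerate simplices going to `0`. -/
noncomputable def push (R : Type*) [CommRing R] (f : α → β) (m : ℕ) :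
    Chains R α m →ₗ[R] Chains R β m :=
  carry R (fun _ s => f (s 0)) m

theorem isCarrier_of_monotoneOn {f : α → β} {S : Set α} (hf : MonotoneOn f S) :
    IsCarrier S fun m (s : Simplex α (m + 1)) => f (s 0) := fun _ s hs _ =>
  hf (hs _) (hs _) (s.monotone (Fin.zero_le _))

theorem push_mem_supported {f : α → β} {S : Set α} {T : Set β} (hf : MonotoneOn f S)
    (hT : Set.MapsTo f S T) {m : ℕ} {c : Chains R α (m + 1)} (hc : c ∈ supported R S (m + 1)) :
    push R f (m + 1) c ∈ supported R T (m + 1) :=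
  carry_mem_supported (isCarrier_of_monotoneOn hf) (fun _ _ hs => hT (hs 0)) hc

theorem boundary_push {f : α → β} {S : Set α} (hf : MonotoneOn f S) {m : ℕ}
    {c : Chains R α (m + 1)} (hc : c ∈ supported R S (m + 1)) :
    boundary R β m (push R f (m + 1) c) = push R f m (boundary R α m c) :=
  boundary_carry (isCarrier_of_monotoneOn hf) hc

theorem push_single_mem {f : α → β} {m : ℕ} {s : Simplex α (m + 1)} {T : Set β}
    (hf : MonotoneOn f (Set.range s)) (hT : ∀ i, f (s i) ∈ T) :
    push R f (m + 1) (single s 1) ∈ supported R T (m + 1) :=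
  push_mem_supported hf (by rintro _ ⟨i, rfl⟩; exact hT i)
    (single_mem_supported fun i => ⟨i, rfl⟩)

theorem push_id (m : ℕ) (c : Chains R α m) : push R (id : α → α) m c = c := by
  induction m with
  | zero =>
    exact LinearMap.congr_fun (f := push R (id : α → α) 0) (g := LinearMap.id)
      (hom_ext fun s => carry_zero_single _ _ _) c
  | succ m ih =>
    refine LinearMap.congr_fun (f := push R (id : α → α) (m + 1)) (g := LinearMap.id)
      (hom_ext fun s => (carry_succ_single _ _ _).trans ?_) c
    change cone (s 0) m (push R id m _) = _
    rw [ih, cone_boundary_single, LinearMap.id_apply]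

theorem push_single_of_strictMono {f : α → β} {m : ℕ} {s : Simplex α m}
    (h : StrictMono fun i => f (s i)) :
    push R f m (single s 1) = single (OrderEmbedding.ofStrictMono _ h) 1 := by
  induction m with
  | zero => exact carry_zero_single _ _ _
  | succ m ih =>
    refine (carry_succ_single _ _ _).trans ?_
    change cone (f (s 0)) m (push R f m _) = _
    rw [← cone_boundary_single (OrderEmbedding.ofStrictMono _ h), boundary_single, boundary_single,
      map_sum, map_sum, map_sum]
    refine Finset.sum_congr rfl fun i _ => ?_
    have hi : StrictMono fun j => f (face s i j) := h.comp (Fin.succAboveOrderEmb i).strictMono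
    rw [map_smul, map_smul, map_smul, ih hi]
    rfl

/-- A constant map kills cycles: here the cycle condition in the lowest degree says that the
coefficients have sum zero. -/
theorem push_const_of_cycle (b : β) {m : ℕ} {c : Chains R α (m + 1)}
    (hc : boundary R α m c = 0) : push R (fun _ => b) (m + 1) c = 0 := by
  have h : push R (fun _ : α => b) (m + 1) = cone b m ∘ₗ push R (fun _ => b) m ∘ₗ boundary R α m :=
    hom_ext fun s => carry_succ_single _ _ _
  rw [h, LinearMap.comp_apply, LinearMap.comp_apply, hc, map_zero, map_zero]

/-- The prism on a chain, for two monotone maps `f ≤ g`. -/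
noncomputable def prism (R : Type*) [CommRing R] (f g : α → β) (m : ℕ) :
    Chains R α m →ₗ[R] Chains R β (m + 1) :=
  htpy (fun _ s => f (s 0)) (push R g) (push R f) m

theorem push_zero_eq (f g : α → β) : push R f 0 = push R g 0 := rfl

section Prism

variable {f g : α → β} {S : Set α} {T : Set β}

theorem carriedBy_push (hf : MonotoneOn f S) (hg : MonotoneOn g S) (hfg : ∀ x ∈ S, f x ≤ g x)
    (hT : Set.MapsTo g S T) :
    CarriedBy S T (fun _ s => f (s 0)) (push R g) := fun m s hs =>
  push_single_mem (hg.mono (by rintro _ ⟨i, rfl⟩; exact hs i)) fun i =>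
    ⟨hT (hs i), (hf (hs 0) (hs i) (s.monotone (Fin.zero_le _))).trans (hfg _ (hs i))⟩

theorem boundary_prism (hf : MonotoneOn f S) (hg : MonotoneOn g S) (hfg : ∀ x ∈ S, f x ≤ g x)
    {m : ℕ} {c : Chains R α (m + 1)} (hc : c ∈ supported R S (m + 1)) :
    boundary R β (m + 1) (prism R f g (m + 1) c) =
      push R g (m + 1) c - push R f (m + 1) c - prism R f g m (boundary R α m c) :=
  boundary_htpy (isCarrier_of_monotoneOn hf) (carriedBy_push hf hg hfg (Set.mapsTo_univ _ _))
    (carriedBy_push hf hf (fun _ _ => le_rfl) (Set.mapsTo_univ _ _)) (push_zero_eq _ _)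
    (fun _ _ => boundary_push hg) (fun _ _ => boundary_push hf) hc

theorem prism_mem_supported (hf : MonotoneOn f S) (hg : MonotoneOn g S) (hfg : ∀ x ∈ S, f x ≤ g x)
    (hfT : Set.MapsTo f S T) (hgT : Set.MapsTo g S T) {m : ℕ} {c : Chains R α (m + 1)}
    (hc : c ∈ supported R S (m + 1)) : prism R f g (m + 1) c ∈ supported R T (m + 2) :=
  htpy_mem_supported (isCarrier_of_monotoneOn hf) (fun _ _ hs => hfT (hs 0))
    (carriedBy_push hf hg hfg hgT) (carriedBy_push hf hf (fun _ _ => le_rfl) hfT) hc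

end Prism

/-- Every cycle supported on `Y` bounds a chain supported on `Y`. -/
def Acyclic (R : Type*) [CommRing R] (Y : Set α) : Prop :=
  ∀ (m : ℕ) (c : Chains R α (m + 1)), c ∈ supported R Y (m + 1) → boundary R α m c = 0 →
    ∃ d ∈ supported R Y (m + 2), boundary R α (m + 1) d = c

/-- Comparable monotone self-maps of `Y` agree on cycles up to boundaries. -/
theorem exists_boundary_eq_push_sub_push {f g : α → α} {Y : Set α} (hf : Monotone f)
    (hg : Monotone g) (hfg : ∀ x ∈ Y, f x ≤ g x) (hfY : Set.MapsTo f Y Y)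
    (hgY : Set.MapsTo g Y Y) {m : ℕ} {c : Chains R α (m + 1)} (hc : c ∈ supported R Y (m + 1))
    (hc' : boundary R α m c = 0) :
    ∃ d ∈ supported R Y (m + 2),
      boundary R α (m + 1) d = push R g (m + 1) c - push R f (m + 1) c :=
  ⟨prism R f g (m + 1) c,
    prism_mem_supported (hf.monotoneOn Y) (hg.monotoneOn Y) hfg hfY hgY hc, by
    rw [boundary_prism (hf.monotoneOn Y) (hg.monotoneOn Y) hfg hc, hc', map_zero, sub_zero]⟩

/-- Conical contractibility, after Quillen: `x ≥ f x ≤ g x ≥ y₀`. -/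
theorem acyclic_of_zigzag {f g : α → α} {Y : Set α} {y₀ : α} (hf : Monotone f) (hg : Monotone g)
    (hfY : Set.MapsTo f Y Y) (hgY : Set.MapsTo g Y Y) (hy₀ : y₀ ∈ Y) (h1 : ∀ x ∈ Y, f x ≤ x)
    (h2 : ∀ x ∈ Y, f x ≤ g x) (h3 : ∀ x ∈ Y, y₀ ≤ g x) : Acyclic R Y := by
  intro m c hc hc'
  obtain ⟨d₁, hd₁, e₁⟩ := exists_boundary_eq_push_sub_push hf monotone_id h1 hfY
    (Set.mapsTo_id Y) hc hc'
  obtain ⟨d₂, hd₂, e₂⟩ := exists_boundary_eq_push_sub_push hf hg h2 hfY hgY hc hc'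
  obtain ⟨d₃, hd₃, e₃⟩ := exists_boundary_eq_push_sub_push (f := fun _ => y₀) monotone_const hg h3
    (fun _ _ => hy₀) hgY hc hc'
  refine ⟨d₁ - d₂ + d₃, Submodule.add_mem _ (Submodule.sub_mem _ hd₁ hd₂) hd₃, ?_⟩
  rw [map_add, map_sub, e₁, e₂, e₃, push_id, push_const_of_cycle y₀ hc']
  abel

end Cones

/-! ### Equivariance -/

section Equivariance

variable {R α β G : Type*} [CommRing R] [PartialOrder α] [PartialOrder β] [Group G]
  (a : G →* (α ≃o α)) (a' : G →* (β ≃o β))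

theorem chainRep_mem_supported {S T : Set α} {g : G} (h : ∀ x ∈ S, a g x ∈ T) {m : ℕ}
    {c : Chains R α m} (hc : c ∈ supported R S m) : chainRep R a m g c ∈ supported R T m := by
  refine map_mem_of_supported _ (fun s hs => ?_) hc
  rw [chainRep_single]
  exact single_mem_supported fun i => h _ (hs i)

theorem chainRep_ofSeq (g : G) {m : ℕ} (x : Fin m → α) :
    chainRep R a m g (ofSeq R x) = ofSeq R fun i => a g (x i) := by
  by_cases h : StrictMono x
  · have h' : StrictMono fun i => a g (x i) := (a g).strictMono.comp h
    rw [ofSeq_of_strictMono h, ofSeq_of_strictMono h', chainRep_single]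
    rfl
  · have h' : ¬ StrictMono fun i => a g (x i) := fun h' => h fun i j hij =>
      (a g).lt_iff_lt.1 (h' hij)
    rw [ofSeq_of_not_strictMono h, ofSeq_of_not_strictMono h', map_zero]

theorem chainRep_cone (g : G) (b : α) {m : ℕ} (c : Chains R α m) :
    chainRep R a (m + 1) g (cone b m c) = cone (a g b) m (chainRep R a m g c) := by
  suffices h : chainRep R a (m + 1) g ∘ₗ cone b m = cone (a g b) m ∘ₗ chainRep R a m g from
    LinearMap.congr_fun h c
  refine hom_ext fun s => ?_
  rw [LinearMap.comp_apply, LinearMap.comp_apply, cone_single, chainRep_ofSeq, chainRep_single,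
    cone_single]
  congr 1
  funext i
  induction i using Fin.cases with
  | zero => rfl
  | succ i => rfl

theorem chainRep_carry {S : Set α} {b : ∀ m, Simplex α (m + 1) → β} {g : G}
    (hb : ∀ m (s : Simplex α (m + 1)), (∀ i, s i ∈ S) →
      b m (s.trans (a g).toOrderEmbedding) = a' g (b m s)) {m : ℕ} {c : Chains R α m}
    (hc : c ∈ supported R S m) :
    chainRep R a' m g (carry R b m c) = carry R b m (chainRep R a m g c) := by
  induction m with
  | zero =>
    refine eq_of_supported (f := chainRep R a' 0 g ∘ₗ carry R b 0)
      (g := carry R b 0 ∘ₗ chainRep R a 0 g) (fun s hs => ?_) hc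
    let t : Simplex β 0 := OrderEmbedding.ofStrictMono (fun i => i.elim0) (fun i => i.elim0)
    rw [LinearMap.comp_apply, LinearMap.comp_apply, carry_zero_single _ _ t, chainRep_single,
      chainRep_single, carry_zero_single _ _ t]
    congr 1
    exact RelEmbedding.ext fun i => i.elim0
  | succ m ih =>
    refine eq_of_supported (f := chainRep R a' (m + 1) g ∘ₗ carry R b (m + 1))
      (g := carry R b (m + 1) ∘ₗ chainRep R a (m + 1) g) (fun s hs => ?_) hc
    rw [LinearMap.comp_apply, LinearMap.comp_apply, carry_succ_single, chainRep_cone,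
      ih (boundary_mem_supported (single_mem_supported hs)), chainRep_single, carry_succ_single,
      hb m s hs, ← chainRep_single, boundary_chainRep]

theorem chainRep_push {f : α → β} {g : G} {S : Set α} (hf : ∀ x ∈ S, f (a g x) = a' g (f x))
    {m : ℕ} {c : Chains R α m} (hc : c ∈ supported R S m) :
    chainRep R a' m g (push R f m c) = push R f m (chainRep R a m g c) :=
  chainRep_carry a a' (S := S) (fun _ _ hs => hf _ (hs 0)) hc

theorem chainRep_prism {f f' : α → β} {g : G} {S : Set α} (hf : ∀ x ∈ S, f (a g x) = a' g (f x))
    (hf' : ∀ x ∈ S, f' (a g x) = a' g (f' x)) {m : ℕ} {c : Chains R α m}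
    (hc : c ∈ supported R S m) :
    chainRep R a' (m + 1) g (prism R f f' m c) = prism R f f' m (chainRep R a m g c) := by
  induction m with
  | zero => simp [prism, htpy]
  | succ m ih =>
    refine eq_of_supported (f := chainRep R a' (m + 2) g ∘ₗ prism R f f' (m + 1))
      (g := prism R f f' (m + 1) ∘ₗ chainRep R a (m + 1) g) (fun s hs => ?_) hc
    have h1 := single_mem_supported (R := R) hs
    have ih' := ih (boundary_mem_supported h1)
    rw [LinearMap.comp_apply, LinearMap.comp_apply, chainRep_single]
    unfold prism at ih' ⊢
    rw [htpy_succ_single, chainRep_cone, htpy_succ_single, map_sub, map_sub (chainRep R a' (m + 1) g), ih',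
      ← chainRep_single, boundary_chainRep, chainRep_push a a' hf h1, chainRep_push a a' hf' h1]
    exact congrArg (fun x => cone x _ _) (hf _ (hs 0)).symm

end Equivariance

end OrderComplex

/-! ### Cycles modulo a group and modulo boundaries -/

namespace OrderComplex

section CyclesOn

variable {R α G : Type*} [CommRing R] [PartialOrder α] [Group G] (a : G →* (α ≃o α))

/-- The cycles of dimension `m` supported on `S`. -/
noncomputable def cyclesOn (R : Type*) [CommRing R] (S : Set α) (m : ℕ) :
    Submodule R (Chains R α (m + 1)) :=
  supported R S (m + 1) ⊓ LinearMap.ker (boundary R α m)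

theorem mem_cyclesOn {S : Set α} {m : ℕ} {c : Chains R α (m + 1)} :
    c ∈ cyclesOn R S m ↔ c ∈ supported R S (m + 1) ∧ boundary R α m c = 0 := Iff.rfl

/-- The chains of dimension `m` spanned by the differences `g w - w`, with `g ∈ Γ` and `w` a cycle
on `S`, and by the boundaries of chains on `S`. If `Γ` is a group that acts on `S`, the cycles on
`S` modulo this submodule are the coinvariants of the homology of `S`. -/
noncomputable def coinvariantsKer (R : Type*) [CommRing R] (S : Set α) (Γ : Set G) (m : ℕ) :
    Submodule R (Chains R α (m + 1)) :=
  Submodule.span R {c | ∃ g ∈ Γ, ∃ w ∈ cyclesOn R S m, chainRep R a (m + 1) g w - w = c} ⊔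
    (supported R S (m + 2)).map (boundary R α (m + 1))

theorem sub_mem_coinvariantsKer {S : Set α} {Γ : Set G} {m : ℕ} {g : G} (hg : g ∈ Γ)
    {w : Chains R α (m + 1)} (hw : w ∈ cyclesOn R S m) :
    chainRep R a (m + 1) g w - w ∈ coinvariantsKer a R S Γ m :=
  Submodule.mem_sup_left (Submodule.subset_span ⟨g, hg, w, hw, rfl⟩)

theorem boundary_mem_coinvariantsKer {S : Set α} {Γ : Set G} {m : ℕ}
    {c : Chains R α (m + 2)} (hc : c ∈ supported R S (m + 2)) :
    boundary R α (m + 1) c ∈ coinvariantsKer a R S Γ m :=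
  Submodule.mem_sup_right ⟨c, hc, rfl⟩

theorem coinvariantsKer_le {S : Set α} {Γ : Set G} {m : ℕ} {N : Submodule R (Chains R α (m + 1))}
    (h1 : ∀ g ∈ Γ, ∀ w ∈ cyclesOn R S m, chainRep R a (m + 1) g w - w ∈ N)
    (h2 : ∀ c ∈ supported R S (m + 2), boundary R α (m + 1) c ∈ N) :
    coinvariantsKer a R S Γ m ≤ N := by
  refine sup_le (Submodule.span_le.2 ?_) ?_
  · rintro _ ⟨g, hg, w, hw, rfl⟩
    exact h1 g hg w hw
  · rintro _ ⟨c, hc, rfl⟩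
    exact h2 c hc

theorem coinvariantsKer_le_ker (S : Set α) (Γ : Set G) (m : ℕ) :
    coinvariantsKer a R S Γ m ≤ LinearMap.ker (boundary R α m) := by
  refine coinvariantsKer_le a (fun g _ w hw => ?_) fun c _ => ?_
  · have hw' : boundary R α m w = 0 := hw.2
    rw [LinearMap.mem_ker, map_sub, boundary_chainRep, hw', map_zero, sub_zero]
  · exact boundary_boundary R α m c

theorem coinvariantsKer_mono {S : Set α} {Γ Γ' : Set G} (h : Γ ⊆ Γ') (m : ℕ) :
    coinvariantsKer a R S Γ m ≤ coinvariantsKer a R S Γ' m :=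
  coinvariantsKer_le a (fun _ hg _ hw => sub_mem_coinvariantsKer a (h hg) hw)
    fun _ hc => boundary_mem_coinvariantsKer a hc

theorem chainRep_point (g : G) (x : α) :
    chainRep R a 1 g (ofSeq R ![x]) = ofSeq R ![a g x] := by
  rw [chainRep_ofSeq]
  congr 1
  funext i
  fin_cases i
  rfl

theorem chainRep_edge (g : G) (x y : α) :
    chainRep R a 2 g (ofSeq R ![x, y]) = ofSeq R ![a g x, a g y] := by
  rw [chainRep_ofSeq]
  congr 1
  funext i
  fin_cases i <;> rfl

theorem boundary_point_eq (x y : α) :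
    boundary R α 0 (ofSeq R ![x]) = boundary R α 0 (ofSeq R ![y]) := by
  have h : ∀ z : α, StrictMono ![z] := fun z i j hij => (hij.ne (Subsingleton.elim i j)).elim
  rw [ofSeq_of_strictMono (h x), ofSeq_of_strictMono (h y), boundary_single, boundary_single]
  refine Finset.sum_congr rfl fun i _ => ?_
  congr 2
  exact RelEmbedding.ext fun i => i.elim0

/-- Reduced cycles of dimension `0` are generated by differences of points. -/
theorem cyclesOn_zero_le {S : Set α} {N : Submodule R (Chains R α 1)}
    (h : ∀ x ∈ S, ∀ y ∈ S, ofSeq R ![x] - ofSeq R ![y] ∈ N) : cyclesOn R S 0 ≤ N := by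
  rintro c ⟨hc, hc'⟩
  have hc' : boundary R α 0 c = 0 := hc'
  obtain rfl | ⟨y, hy⟩ := S.eq_empty_or_nonempty
  · exact supported_le (fun s hs => (hs 0).elim) hc
  · have key := map_mem_of_supported (N := N)
      (LinearMap.id - push R (fun _ : α => y) 1) (fun s hs => ?_) hc
    · rwa [LinearMap.sub_apply, push_const_of_cycle y hc', sub_zero] at key
    · have hs' : StrictMono fun _ : Fin 1 => y := fun i j hij =>
        (hij.ne (Subsingleton.elim i j)).elim
      rw [LinearMap.sub_apply, push_single_of_strictMono hs', LinearMap.id_apply, ← ofSeq_coe,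
        ← ofSeq_coe]
      convert h (s 0) (hs 0) y hy using 3 <;>
      · funext i
        fin_cases i
        rfl

/-! ### Links of minimal vertices -/

open Classical in
/-- The part of a chain that starts at the vertex `o`, with this vertex deleted. -/
noncomputable def link (R : Type*) [CommRing R] (o : α) (m : ℕ) :
    Chains R α (m + 1) →ₗ[R] Chains R α m :=
  lift fun s => if s 0 = o then single (face s 0) 1 else 0

theorem link_single_of_eq {o : α} {m : ℕ} {s : Simplex α (m + 1)} (h : s 0 = o) :
    link R o m (single s 1) = single (face s 0) 1 := by
  simp [link, h]

theorem link_single_of_ne {o : α} {m : ℕ} {s : Simplex α (m + 1)} (h : s 0 ≠ o) :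
    link R o m (single s 1) = 0 := by
  simp [link, h]

theorem apply_zero_lt_face_zero {m : ℕ} (s : Simplex α (m + 1)) (i : Fin m) :
    s 0 < face s 0 i :=
  s.strictMono (by simp [Fin.succAboveOrderEmb])

theorem link_mem_supported {S : Set α} {o : α} {m : ℕ} {c : Chains R α (m + 1)}
    (hc : c ∈ supported R S (m + 1)) : link R o m c ∈ supported R {x ∈ S | o < x} m := by
  refine map_mem_of_supported _ (fun s hs => ?_) hc
  by_cases h : s 0 = o
  · rw [link_single_of_eq h]
    exact single_mem_supported fun i => ⟨hs _, h ▸ apply_zero_lt_face_zero s i⟩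
  · rw [link_single_of_ne h]
    exact Submodule.zero_mem _

theorem boundary_link {S : Set α} {o : α} (ho : ∀ x ∈ S, ¬ x < o) {m : ℕ} {c : Chains R α (m + 2)}
    (hc : c ∈ supported R S (m + 2)) :
    boundary R α m (link R o (m + 1) c) = - link R o m (boundary R α (m + 1) c) := by
  refine eq_of_supported (f := boundary R α m ∘ₗ link R o (m + 1))
    (g := - (link R o m ∘ₗ boundary R α (m + 1))) (fun s hs => ?_) hc
  have hne : ∀ i, 0 < i → s i ≠ o := fun i hi h => ho _ (hs 0) (h ▸ s.strictMono hi)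
  have h0 : face s 0 0 ≠ o := hne _ (by simp [Fin.succAboveOrderEmb])
  rw [LinearMap.comp_apply, LinearMap.neg_apply, LinearMap.comp_apply, boundary_single s, map_sum]
  by_cases h : s 0 = o
  · rw [link_single_of_eq h, Fin.sum_univ_succ, map_smul, link_single_of_ne h0,
      smul_zero, zero_add, boundary_single, ← Finset.sum_neg_distrib]
    refine Finset.sum_congr rfl fun i _ => ?_
    rw [map_smul, link_single_of_eq (by rw [face_apply_zero, h]), Fin.val_succ, pow_succ,
      mul_neg_one, neg_smul, neg_neg]
    congr 2
    refine RelEmbedding.ext fun j => ?_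
    simp [face, Fin.succAboveOrderEmb]
  · rw [link_single_of_ne h, map_zero, Finset.sum_eq_zero, neg_zero]
    intro i _
    rw [map_smul, link_single_of_ne, smul_zero]
    induction i using Fin.cases with
    | zero => exact h0
    | succ i => rwa [face_apply_zero]

end CyclesOn

/-! ### Removing the vertices opposite to a fixed element of a modular lattice -/

section Opposite

variable {R α G : Type*} [CommRing R] [Lattice α] [Group G] (a : G →* (α ≃o α))

/-- The contraction `x ≤ x ⊔ o ≥ o`, as a chain homotopy. A cycle `y` bounds
`coneHtpy R o _ y`. -/
noncomputable def coneHtpy (R : Type*) [CommRing R] (o : α) (m : ℕ) :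
    Chains R α m →ₗ[R] Chains R α (m + 1) :=
  cone o m ∘ₗ push R (fun x => x ⊔ o) m - prism R id (fun x => x ⊔ o) m

theorem monotone_sup (o : α) : Monotone fun x => x ⊔ o := fun _ _ h => sup_le_sup_right h o

theorem monotone_inf (o : α) : Monotone fun x => x ⊓ o := fun _ _ h => inf_le_inf_right o h

theorem boundary_coneHtpy (o : α) {m : ℕ} (y : Chains R α (m + 1)) :
    boundary R α (m + 1) (coneHtpy R o (m + 1) y) = y - coneHtpy R o m (boundary R α m y) := by
  have hy := mem_supported_univ y
  have h1 : push R (fun x => x ⊔ o) (m + 1) y ∈ supported R (Set.Ici o) (m + 1) :=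
    push_mem_supported ((monotone_sup o).monotoneOn _) (fun _ _ => le_sup_right) hy
  have h2 := boundary_prism (monotone_id.monotoneOn _) ((monotone_sup o).monotoneOn _)
    (fun _ _ => le_sup_left) hy
  simp only [coneHtpy, LinearMap.sub_apply, LinearMap.comp_apply, map_sub]
  rw [boundary_cone h1, h2, boundary_push ((monotone_sup o).monotoneOn _) hy, push_id]
  abel

theorem prism_id_mem_supported {o : α} {S T : Set α} (hST : S ⊆ T) (hS : ∀ x ∈ S, x ⊔ o ∈ T)
    {m : ℕ} {y : Chains R α (m + 1)} (hy : y ∈ supported R S (m + 1)) :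
    prism R id (fun x => x ⊔ o) (m + 1) y ∈ supported R T (m + 2) :=
  prism_mem_supported (monotone_id.monotoneOn _) ((monotone_sup o).monotoneOn _)
    (fun _ _ => le_sup_left) hST hS hy

theorem coneHtpy_mem_supported {o : α} {S T : Set α} (ho : o ∈ T) (hST : S ⊆ T)
    (hS : ∀ x ∈ S, x ⊔ o ∈ T) {m : ℕ} {y : Chains R α (m + 1)} (hy : y ∈ supported R S (m + 1)) :
    coneHtpy R o (m + 1) y ∈ supported R T (m + 2) :=
  Submodule.sub_mem _ (cone_mem_supported ho
    (push_mem_supported ((monotone_sup o).monotoneOn _) hS hy)) (prism_id_mem_supported hST hS hy)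

theorem chainRep_coneHtpy {o : α} {g : G} (ho : a g o = o) {m : ℕ} (y : Chains R α m) :
    chainRep R a (m + 1) g (coneHtpy R o m y) = coneHtpy R o m (chainRep R a m g y) := by
  have h : ∀ x ∈ Set.univ, a g x ⊔ o = a g (x ⊔ o) := fun x _ => by
    rw [OrderIso.map_sup, ho]
  have hy := mem_supported_univ y
  simp only [coneHtpy, LinearMap.sub_apply, LinearMap.comp_apply, map_sub]
  rw [chainRep_cone, ho, chainRep_push a a h hy, chainRep_prism a a (f := id) (fun _ _ => rfl) h hy]

variable [OrderBot α]

/-- A set `S` of elements of a lattice, an element `c`, and for each `o ∈ S` opposite to `c`, that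
is, with `o ⊓ c = ⊥`, a set `So o` such that `x ↦ x ⊓ c` and `x ↦ x ⊔ o` go back and
forth between the part of `S` above `o` and `So o`. -/
structure IsOppositeSystem (S : Set α) (c : α) (So : α → Set α) : Prop where
  bot_notMem : ⊥ ∉ S
  le_sup : ∀ o ∈ S, o ⊓ c = ⊥ → ∀ x ∈ S, x ≤ o ⊔ c
  inf_mem : ∀ o ∈ S, o ⊓ c = ⊥ → ∀ x ∈ S, o < x → x ⊓ c ∈ So o
  subset : ∀ o ∈ S, o ⊓ c = ⊥ → So o ⊆ S
  le : ∀ o ∈ S, o ⊓ c = ⊥ → ∀ x ∈ So o, x ≤ c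
  sup_mem : ∀ o ∈ S, o ⊓ c = ⊥ → ∀ x ∈ So o, x ⊔ o ∈ S

namespace IsOppositeSystem

variable {S : Set α} {c : α} {So : α → Set α} (h : IsOppositeSystem S c So)
include h

theorem inf_ne_bot {o : α} (ho : o ∈ S) (hoc : o ⊓ c = ⊥) {x : α} (hx : x ∈ So o) :
    x ⊓ c ≠ ⊥ := by
  rw [inf_eq_left.2 (h.le o ho hoc x hx)]
  exact fun hb => h.bot_notMem (hb ▸ h.subset o ho hoc hx)

theorem subset_nonopposite {o : α} (ho : o ∈ S) (hoc : o ⊓ c = ⊥) :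
    So o ⊆ {x ∈ S | x ⊓ c ≠ ⊥} := fun _ hx => ⟨h.subset o ho hoc hx, h.inf_ne_bot ho hoc hx⟩

theorem sup_mem_nonopposite {o : α} (ho : o ∈ S) (hoc : o ⊓ c = ⊥) {x : α} (hx : x ∈ So o) :
    x ⊔ o ∈ {x ∈ S | x ⊓ c ≠ ⊥} :=
  ⟨h.sup_mem o ho hoc x hx, fun hb => h.inf_ne_bot ho hoc hx
    (eq_bot_iff.2 ((inf_le_inf_right c le_sup_left).trans hb.le))⟩

/-- Group elements that fix `o` and `c` are compatible with `coneHtpy R o`, so coinvariants of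
`So o` can be used in `cyclesOn_le`. -/
theorem coinvariantsKer_le_comap {Γ Γ' : Set G} {m : ℕ} (hY : Acyclic R {x ∈ S | x ⊓ c ≠ ⊥})
    {o : α} (ho : o ∈ S) (hoc : o ⊓ c = ⊥) (hΓ : Γ' ⊆ Γ) (hgo : ∀ g ∈ Γ', a g o = o)
    (hgc : ∀ g ∈ Γ', a g c = c) (hgS : ∀ g ∈ Γ', ∀ x ∈ S, a g x ∈ S) :
    coinvariantsKer a R (So o) Γ' m ≤
      (coinvariantsKer a R S Γ (m + 1) ⊔ supported R {x ∈ S | x ⊓ c ≠ ⊥} (m + 2)).comap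
        (coneHtpy R o (m + 1)) := by
  have hYS : {x ∈ S | x ⊓ c ≠ ⊥} ⊆ S := fun x hx => hx.1
  have hsub := h.subset_nonopposite ho hoc
  have hcS : ∀ {m : ℕ} {y : Chains R α (m + 1)}, y ∈ supported R (So o) (m + 1) →
      coneHtpy R o (m + 1) y ∈ supported R S (m + 2) := fun hy =>
    coneHtpy_mem_supported ho (h.subset o ho hoc) (h.sup_mem o ho hoc) hy
  refine coinvariantsKer_le a (fun g hg y hy => ?_) fun d hd => ?_
  · obtain ⟨hy1, hy2 : boundary R α m y = 0⟩ := hy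
    obtain ⟨d, hd, hdy⟩ := hY m y (supported_mono hsub _ hy1) hy2
    have hw : coneHtpy R o (m + 1) y - d ∈ cyclesOn R S (m + 1) := by
      refine mem_cyclesOn.2 ⟨Submodule.sub_mem _ (hcS hy1) (supported_mono hYS _ hd), ?_⟩
      rw [map_sub, boundary_coneHtpy, hdy, hy2, map_zero, sub_zero, sub_self]
    have hgd : chainRep R a (m + 2) g d ∈ supported R {x ∈ S | x ⊓ c ≠ ⊥} (m + 2) := by
      refine chainRep_mem_supported a (S := {x ∈ S | x ⊓ c ≠ ⊥}) (T := {x ∈ S | x ⊓ c ≠ ⊥})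
        (fun x hx => ⟨hgS g hg x hx.1, fun hb => hx.2 ?_⟩) hd
      rw [← hgc g hg, ← OrderIso.map_inf] at hb
      exact (map_eq_bot_iff (a g)).1 hb
    have e : coneHtpy R o (m + 1) (chainRep R a (m + 1) g y - y) =
        (chainRep R a (m + 2) g (coneHtpy R o (m + 1) y - d) - (coneHtpy R o (m + 1) y - d)) +
          (chainRep R a (m + 2) g d - d) := by
      rw [map_sub, map_sub, chainRep_coneHtpy a (hgo g hg)]
      abel
    rw [Submodule.mem_comap, e]
    exact Submodule.add_mem_sup (sub_mem_coinvariantsKer a (hΓ hg) hw) (Submodule.sub_mem _ hgd hd)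
  · have e : coneHtpy R o (m + 1) (boundary R α (m + 1) d) =
        boundary R α (m + 2) (- coneHtpy R o (m + 2) d) + d := by
      rw [map_neg, boundary_coneHtpy]
      abel
    rw [Submodule.mem_comap, e]
    exact Submodule.add_mem_sup (boundary_mem_coinvariantsKer a (Submodule.neg_mem _ (hcS hd)))
      (supported_mono hsub _ hd)

variable [IsModularLattice α]

theorem not_lt {o : α} (ho : o ∈ S) (hoc : o ⊓ c = ⊥) {x : α} (hx : x ∈ S) : ¬ x < o := by
  intro hlt
  have hxc : x ⊓ c = ⊥ := eq_bot_iff.2 ((inf_le_inf_right c hlt.le).trans hoc.le)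
  have h1 : (x ⊔ c) ⊓ o = x ⊔ c ⊓ o := (sup_inf_assoc_of_le c hlt.le)
  rw [inf_comm c, hoc, sup_bot_eq, inf_eq_right.2 (h.le_sup x hx hxc o ho)] at h1
  exact hlt.ne h1.symm

theorem inf_sup_eq {o : α} (ho : o ∈ S) (hoc : o ⊓ c = ⊥) {x : α} (hx : x ∈ S) (hox : o ≤ x) :
    x ⊓ c ⊔ o = x := by
  rw [sup_comm, inf_comm, ← sup_inf_assoc_of_le c hox, inf_eq_right.2 (h.le_sup o ho hoc x hx)]

theorem push_sup_push_inf {o : α} (ho : o ∈ S) (hoc : o ⊓ c = ⊥) {m : ℕ} {y : Chains R α m}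
    (hy : y ∈ supported R {x ∈ S | o < x} m) :
    push R (fun x => x ⊔ o) m (push R (fun x => x ⊓ c) m y) = y := by
  refine eq_of_supported (f := push R (fun x => x ⊔ o) m ∘ₗ push R (fun x => x ⊓ c) m)
    (g := LinearMap.id) (fun s hs => ?_) hy
  have hs' : ∀ i, s i ⊓ c ⊔ o = s i := fun i => h.inf_sup_eq ho hoc (hs i).1 (hs i).2.le
  have h1 : StrictMono fun i => s i ⊓ c := fun i j hij =>
    lt_of_le_of_ne (inf_le_inf_right c (s.monotone hij.le)) fun e =>
      (s.strictMono hij).ne (by rw [← hs' i, ← hs' j]; exact congrArg (· ⊔ o) e)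
  have h2 : StrictMono fun i => OrderEmbedding.ofStrictMono _ h1 i ⊔ o := fun i j hij => by
    simpa [hs'] using s.strictMono hij
  rw [LinearMap.comp_apply, push_single_of_strictMono h1, push_single_of_strictMono h2,
    LinearMap.id_apply]
  congr 1
  exact RelEmbedding.ext hs'

/-- If the homology of the part of `S` not opposite to `c` vanishes, the cycles on `S` are generated
by the cycles `coneHtpy y - d`, with `y` a cycle on some `So o` and `d` a chain on the
part not opposite to `c`. This is the inductive step of the Solomon-Tits theorem. -/
theorem cyclesOn_le {Γ : Set G} {m : ℕ} (hY : Acyclic R {x ∈ S | x ⊓ c ≠ ⊥})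
    (hSo : ∀ o ∈ S, o ⊓ c = ⊥ → cyclesOn R (So o) m ≤
      (coinvariantsKer a R S Γ (m + 1) ⊔ supported R {x ∈ S | x ⊓ c ≠ ⊥} (m + 2)).comap
        (coneHtpy R o (m + 1))) :
    cyclesOn R S (m + 1) ≤ coinvariantsKer a R S Γ (m + 1) := by
  classical
  set Y : Set α := {x ∈ S | x ⊓ c ≠ ⊥} with hYdef
  have hYS : Y ⊆ S := fun x hx => hx.1
  suffices key : ∀ (F : Finset α), (∀ o ∈ F, o ∈ S ∧ o ⊓ c = ⊥) → ∀ z : Chains R α (m + 2),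
      z ∈ supported R (Y ∪ F) (m + 2) → boundary R α (m + 1) z = 0 →
        z ∈ coinvariantsKer a R S Γ (m + 1) by
    rintro z ⟨hz, hz'⟩
    obtain ⟨F, hF, hzF⟩ := exists_finset_supported hz
    refine key (F.filter fun x => x ⊓ c = ⊥) (fun o ho => ?_) z (supported_mono ?_ _ hzF) hz'
    · rw [Finset.mem_filter] at ho
      exact ⟨hF ho.1, ho.2⟩
    · intro x hx
      by_cases hxc : x ⊓ c = ⊥
      · exact Or.inr (by simpa using ⟨hx, hxc⟩)
      · exact Or.inl ⟨hF hx, hxc⟩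
  intro F
  induction F using Finset.induction_on with
  | empty =>
    intro _ z hz hz'
    obtain ⟨d, hd, rfl⟩ := hY _ z (by simpa using hz) hz'
    exact boundary_mem_coinvariantsKer a (supported_mono hYS _ hd)
  | insert o F hoF ih =>
    intro hF z hz hz'
    obtain ⟨ho, hoc⟩ := hF o (Finset.mem_insert_self o F)
    have hsub : Y ∪ ↑(insert o F) ⊆ S := by
      rintro x (hx | hx)
      · exact hx.1
      · exact (hF x hx).1
    have hzS := supported_mono hsub _ hz
    have hmin : ∀ x ∈ S, ¬ x < o := fun x hx => h.not_lt ho hoc hx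
    have hl := link_mem_supported (o := o) hzS
    have hinf : MonotoneOn (fun x => x ⊓ c) {x ∈ S | o < x} := (monotone_inf c).monotoneOn _
    -- `y` is the link of `o` in `z`, transported to `So o`.
    let y := push R (fun x => x ⊓ c) (m + 1) (link R o (m + 1) z)
    have hy : y ∈ cyclesOn R (So o) m := by
      refine mem_cyclesOn.2 ⟨push_mem_supported hinf (fun x hx => h.inf_mem o ho hoc x hx.1 hx.2) hl, ?_⟩
      rw [boundary_push hinf hl, boundary_link hmin hzS, hz', map_zero, neg_zero,
        map_zero]
    obtain ⟨n, hn, t, ht, hnt⟩ := Submodule.mem_sup.1 (hSo o ho hoc hy)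
    have hcone : coneHtpy R o (m + 1) y = cone o (m + 1) (link R o (m + 1) z) -
        prism R id (fun x => x ⊔ o) (m + 1) y := by
      simp only [coneHtpy, LinearMap.sub_apply, LinearMap.comp_apply, y]
      rw [h.push_sup_push_inf ho hoc hl]
    -- Subtracting the cone on its link removes the vertex `o` from `z`.
    have hrest : z - cone o (m + 1) (link R o (m + 1) z) ∈ supported R (Y ∪ F) (m + 2) := by
      refine map_mem_of_supported (LinearMap.id - cone o (m + 1) ∘ₗ link R o (m + 1))
        (fun s hs => ?_) hz
      rw [LinearMap.sub_apply, LinearMap.id_apply, LinearMap.comp_apply]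
      by_cases hs0 : s 0 = o
      · rw [link_single_of_eq hs0, ← hs0, cone_face_zero, sub_self]
        exact Submodule.zero_mem _
      · rw [link_single_of_ne hs0, map_zero, sub_zero]
        refine single_mem_supported fun i => (hs i).imp_right fun hi => ?_
        refine (Finset.mem_insert.1 hi).resolve_left fun hio => ?_
        refine hmin (s 0) (hsub (hs 0)) (hio ▸ s.strictMono (Fin.pos_of_ne_zero ?_))
        rintro rfl
        exact hs0 hio
    have hp : prism R id (fun x => x ⊔ o) (m + 1) y ∈ supported R Y (m + 2) :=
      prism_id_mem_supported (h.subset_nonopposite ho hoc)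
        (fun x hx => h.sup_mem_nonopposite ho hoc hx) hy.1
    have hn' : boundary R α (m + 1) n = 0 := coinvariantsKer_le_ker a S Γ (m + 1) hn
    have hzn : z - n ∈ coinvariantsKer a R S Γ (m + 1) := by
      refine ih (fun x hx => hF x (Finset.mem_insert_of_mem hx)) _ ?_ ?_
      · have e : z - n = (z - cone o (m + 1) (link R o (m + 1) z)) +
            (prism R id (fun x => x ⊔ o) (m + 1) y + t) := by
          rw [eq_sub_of_add_eq hnt, hcone]
          abel
        rw [e]
        exact Submodule.add_mem _ hrest
          (supported_mono Set.subset_union_left _ (Submodule.add_mem _ hp ht))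
      · rw [map_sub, hz', hn', sub_zero]
    simpa using Submodule.add_mem _ hzn hn

end IsOppositeSystem

end Opposite

end OrderComplex

/-! ### From parabolic subgroups to isotropic subspaces -/

namespace IsotropicGeometry

open OrderComplex

variable {k G V : Type*} [Field k] [Group G] [AddCommGroup V] [Module k V]
  (X : IsotropicGeometry k G V)

/-- The action of `G` on the lattice of subspaces of `V`. -/
def act : G →* (Submodule k V ≃o Submodule k V) where
  toFun g :=
    { toFun := fun W => W.map (X.ρ g)
      invFun := fun W => W.map (X.ρ g⁻¹)
      left_inv := fun W => by
        change (W.map (X.ρ g)).map (X.ρ g⁻¹) = W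
        rw [← Submodule.map_comp, ← Module.End.mul_eq_comp, ← map_mul, inv_mul_cancel, map_one]
        exact Submodule.map_id W
      right_inv := fun W => by
        change (W.map (X.ρ g⁻¹)).map (X.ρ g) = W
        rw [← Submodule.map_comp, ← Module.End.mul_eq_comp, ← map_mul, mul_inv_cancel, map_one]
        exact Submodule.map_id W
      map_rel_iff' := fun {W W'} => by
        refine ⟨fun h => ?_, fun h => Submodule.map_mono h⟩
        have h' := Submodule.map_mono (f := X.ρ g⁻¹) h
        simp only [Equiv.coe_fn_mk, ← Submodule.map_comp, ← Module.End.mul_eq_comp, ← map_mul,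
          inv_mul_cancel, map_one] at h'
        simpa only [Module.End.one_eq_id, Submodule.map_id] using h' }
  map_one' := RelIso.ext fun W => by
    change W.map (X.ρ 1) = W
    rw [map_one]
    exact Submodule.map_id W
  map_mul' g h := RelIso.ext fun W => by
    change W.map (X.ρ (g * h)) = (W.map (X.ρ h)).map (X.ρ g)
    rw [map_mul]
    exact Submodule.map_comp _ _ _

theorem act_apply (g : G) (W : Submodule k V) : X.act g W = W.map (X.ρ g) := rfl

/-- A subspace is fixed by `g` as soon as `g` maps it into itself and `g⁻¹` does. -/
theorem act_eq_of_le {g : G} {W : Submodule k V} (h : ∀ x ∈ W, X.ρ g x ∈ W)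
    (h' : ∀ x ∈ W, X.ρ g⁻¹ x ∈ W) : X.act g W = W := by
  refine le_antisymm (Submodule.map_le_iff_le_comap.2 h) ?_
  have h2 : X.act g⁻¹ W ≤ W := Submodule.map_le_iff_le_comap.2 h'
  have h3 := (X.act g).monotone h2
  rwa [← RelIso.mul_apply, ← map_mul, mul_inv_cancel, map_one] at h3

theorem rho_inv_apply {g : G} {x y : V} (h : X.ρ g y = x) : X.ρ g⁻¹ x = y := by
  rw [← h, ← Module.End.mul_apply, ← map_mul, inv_mul_cancel, map_one, Module.End.one_apply]

/-- If `g` acts as `1 + N` with `N² = 0`, it fixes the subspaces stable under `N`. -/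
theorem act_eq_of_add {g : G} {N : V →ₗ[k] V} (hN : ∀ x, N (N x) = 0)
    (hg : ∀ x, X.ρ g x = x + N x) {W : Submodule k V} (hW : ∀ x ∈ W, N x ∈ W) : X.act g W = W := by
  refine X.act_eq_of_le (fun x hx => ?_) fun x hx => ?_
  · rw [hg]
    exact W.add_mem hx (hW x hx)
  · have h : X.ρ g (x - N x) = x := by rw [hg, map_sub, hN, sub_zero, sub_add_cancel]
    rw [X.rho_inv_apply h]
    exact W.sub_mem hx (hW x hx)

theorem rho_mem_of_act_eq {g : G} {W : Submodule k V} (h : X.act g W = W) {x : V} (hx : x ∈ W) :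
    X.ρ g x ∈ W :=
  h.le (Submodule.mem_map_of_mem hx)

theorem act_span_singleton (g : G) (x : V) :
    X.act g (Submodule.span k {x}) = Submodule.span k {X.ρ g x} := by
  rw [act_apply, Submodule.map_span, Set.image_singleton]

/-- The isotropic subspaces that are not fixed by all of `G`: those that can occur in flags without
being redundant for the stabilizer. -/
def moved : Set (Submodule k V) := {W | X.isotropic W ∧ ∃ g, X.act g W ≠ W}

theorem bot_notMem_moved : ⊥ ∉ X.moved := fun ⟨_, _, hg⟩ => hg (Submodule.map_bot _)

theorem act_mem_moved (g : G) {W : Submodule k V} (hW : W ∈ X.moved) : X.act g W ∈ X.moved := by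
  obtain ⟨h1, x, hx⟩ := hW
  refine ⟨X.isotropic_map g W h1, g * x * g⁻¹, fun h => hx ?_⟩
  have h2 : X.act g (X.act x W) = X.act g W := by
    rw [← h]
    simp only [← RelIso.mul_apply, ← map_mul]
    group
  exact (X.act g).injective h2

/-- The pointwise stabilizer of a set of subspaces. -/
def stab (F : Set (Submodule k V)) : Subgroup G where
  carrier := {g | ∀ W ∈ F, X.act g W = W}
  one_mem' W _ := by rw [map_one]; rfl
  mul_mem' {g h} hg hh W hW := by rw [map_mul, RelIso.mul_apply, hh W hW, hg W hW]
  inv_mem' {g} hg W hW := by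
    refine (X.act g).injective ?_
    rw [← RelIso.mul_apply, ← map_mul, mul_inv_cancel, map_one, hg W hW]
    rfl

theorem mem_stab {F : Set (Submodule k V)} {g : G} : g ∈ X.stab F ↔ ∀ W ∈ F, X.act g W = W :=
  Iff.rfl

theorem isParabolic_stab {F : Set (Submodule k V)} (hF : IsChain (· ≤ ·) F)
    (hF' : F ⊆ X.moved) : X.IsParabolic (X.stab F) :=
  ⟨F, hF, fun _ hW => (hF' hW).1, fun _ => Iff.rfl⟩

theorem stab_ne_top {F : Set (Submodule k V)} {W : Submodule k V} (hW : W ∈ F)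
    (hW' : W ∈ X.moved) : X.stab F ≠ ⊤ := fun h => by
  obtain ⟨_, g, hg⟩ := hW'
  exact hg ((h ▸ Subgroup.mem_top g : g ∈ X.stab F) W hW)

theorem isChain_range {m : ℕ} (s : Simplex (Submodule k V) m) :
    IsChain (· ≤ ·) (Set.range s) := by
  rintro _ ⟨i, rfl⟩ _ ⟨j, rfl⟩ _
  exact (le_total i j).imp (fun h => s.monotone h) fun h => s.monotone h

open Classical in
/-- The stabilizer of a flag of isotropic subspaces, as a proper parabolic subgroup; on other flags
the value is irrelevant. -/
noncomputable def flagStab [Nonempty X.ProperParabolic] (m : ℕ)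
    (s : Simplex (Submodule k V) (m + 1)) : X.ProperParabolic :=
  if h : ∀ i, s i ∈ X.moved then
    ⟨X.stab (Set.range s), X.isParabolic_stab (isChain_range s) (by rintro _ ⟨i, rfl⟩; exact h i),
      X.stab_ne_top ⟨0, rfl⟩ (h 0)⟩
  else Classical.arbitrary _

section FlagStab

variable [Nonempty X.ProperParabolic]

theorem coe_flagStab {m : ℕ} {s : Simplex (Submodule k V) (m + 1)} (hs : ∀ i, s i ∈ X.moved) :
    (X.flagStab m s : Subgroup G) = X.stab (Set.range s) := by
  rw [flagStab, dif_pos hs]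

theorem isCarrier_flagStab : IsCarrier X.moved X.flagStab := fun m s hs i => by
  rw [← Subtype.coe_le_coe, X.coe_flagStab hs, X.coe_flagStab (face_mem hs i)]
  rintro g hg _ ⟨j, rfl⟩
  exact hg _ ⟨_, rfl⟩

theorem flagStab_trans (g : G) {m : ℕ} {s : Simplex (Submodule k V) (m + 1)}
    (hs : ∀ i, s i ∈ X.moved) :
    X.flagStab m (s.trans (X.act g).toOrderEmbedding) = X.conjAction g (X.flagStab m s) := by
  refine Subtype.ext ?_
  change _ = ((X.flagStab m s : Subgroup G)).map (MulAut.conj g).toMonoidHom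
  rw [X.coe_flagStab (fun i => X.act_mem_moved g (hs i)), X.coe_flagStab hs]
  ext x
  rw [Subgroup.mem_map_equiv, MulAut.conj_symm_apply, mem_stab, mem_stab, Set.forall_mem_range,
    Set.forall_mem_range]
  refine forall_congr' fun i => ?_
  change X.act x (X.act g (s i)) = X.act g (s i) ↔ _
  rw [map_mul, map_mul, RelIso.mul_apply, RelIso.mul_apply, map_inv,
    ← (X.act g).injective.eq_iff (a := (X.act g)⁻¹ _), RelIso.apply_inv_self]

/-- The barycentric subdivision of a flag of isotropic subspaces, a chain of parabolic
subgroups. -/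
noncomputable def subdivision (R : Type*) [CommRing R] (m : ℕ) :
    Chains R (Submodule k V) m →ₗ[R] Chains R X.ProperParabolic m :=
  carry R X.flagStab m

end FlagStab

/-- The intersection of the isotropic subspaces that `P` fixes and `G` does not. -/
def leastFixed (P : X.ProperParabolic) : Submodule k V :=
  sInf {W ∈ X.moved | ∀ g ∈ P.1, X.act g W = W}

theorem monotone_leastFixed : Monotone X.leastFixed := fun _ _ h =>
  sInf_le_sInf fun _ hW => ⟨hW.1, fun g hg => hW.2 g (h hg)⟩

/-- The smallest term of a flag is contained in all isotropic subspaces fixed by the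
stabilizer of the flag. -/
def LeastTermFixed : Prop :=
  ∀ F ⊆ X.moved, IsChain (· ≤ ·) F → ∀ W₀ ∈ F, (∀ W ∈ F, W₀ ≤ W) → ∀ U ∈ X.moved,
    (∀ g ∈ X.stab F, X.act g U = U) → W₀ ≤ U

theorem leastFixed_mem [FiniteDimensional k V] (hX : X.LeastTermFixed) (P : X.ProperParabolic) :
    X.leastFixed P ∈ {W ∈ X.moved | ∀ g ∈ P.1, X.act g W = W} := by
  obtain ⟨P, ⟨F, hF, hiso, hP⟩, hne⟩ := P
  have hmem : ∀ g, g ∈ P ↔ g ∈ X.stab (F ∩ X.moved) := by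
    refine fun g => (hP g).trans ⟨fun h W hW => h W hW.1, fun h W hW => ?_⟩
    by_cases hW' : W ∈ X.moved
    · exact h W ⟨hW, hW'⟩
    · by_contra hg
      exact hW' ⟨hiso W hW, g, hg⟩
  have hnonempty : (F ∩ X.moved).Nonempty := by
    by_contra h
    refine hne ((Subgroup.eq_top_iff' P).2 fun g => (hmem g).2 ?_)
    rw [Set.not_nonempty_iff_eq_empty.1 h]
    exact fun W hW => hW.elim
  obtain ⟨W₀, hW₀, hmin⟩ := wellFounded_lt.has_min (F ∩ X.moved) hnonempty
  have hleast : ∀ W ∈ F ∩ X.moved, W₀ ≤ W := fun W hW =>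
    (hF.total hW₀.1 hW.1).elim id fun h => (eq_of_le_of_not_lt h (hmin W hW)).ge
  have hfix : W₀ ∈ {W ∈ X.moved | ∀ g ∈ P, X.act g W = W} :=
    ⟨hW₀.2, fun g hg => (hmem g).1 hg W₀ hW₀⟩
  have heq : sInf {W ∈ X.moved | ∀ g ∈ P, X.act g W = W} = W₀ :=
    le_antisymm (sInf_le hfix) (le_sInf fun U hU =>
      hX _ Set.inter_subset_right (hF.mono Set.inter_subset_left) W₀ hW₀ hleast U hU.1
        fun g hg => hU.2 g ((hmem g).2 hg))
  change sInf {W ∈ X.moved | ∀ g ∈ P, X.act g W = W} ∈ _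
  rw [heq]
  exact hfix

/-- Taking the least fixed subspace and then subdividing is homotopic to the identity: a cycle of
parabolic subgroups is homologous to the subdivision of its image. -/
theorem exists_boundary_eq_sub_subdivision (R : Type*) [CommRing R] [FiniteDimensional k V]
    [Nonempty X.ProperParabolic] (hX : X.LeastTermFixed) {m : ℕ}
    {z : Chains R X.ProperParabolic (m + 1)} (hz : boundary R X.ProperParabolic m z = 0) :
    ∃ d, boundary R X.ProperParabolic (m + 1) d =
      z - X.subdivision R (m + 1) (push R X.leastFixed (m + 1) z) := by
  let φ : ∀ m, Chains R X.ProperParabolic m →ₗ[R] Chains R X.ProperParabolic m :=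
    fun _ => LinearMap.id
  let ψ : ∀ m, Chains R X.ProperParabolic m →ₗ[R] Chains R X.ProperParabolic m :=
    fun m => X.subdivision R m ∘ₗ push R X.leastFixed m
  have hmono : MonotoneOn X.leastFixed Set.univ := X.monotone_leastFixed.monotoneOn _
  have hmaps : Set.MapsTo X.leastFixed Set.univ X.moved := fun P _ => (X.leastFixed_mem hX P).1
  have hb : IsCarrier Set.univ fun m (s : Simplex X.ProperParabolic (m + 1)) => s 0 :=
    isCarrier_of_monotoneOn (monotone_id.monotoneOn _)
  have hφ : CarriedBy Set.univ Set.univ (fun m (s : Simplex X.ProperParabolic (m + 1)) => s 0) φ :=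
    fun m s _ => single_mem_supported fun i => ⟨trivial, s.monotone (Fin.zero_le i)⟩
  have hψ : CarriedBy Set.univ Set.univ
      (fun m (s : Simplex X.ProperParabolic (m + 1)) => s 0) ψ := by
    intro m s _
    -- The vertices of the flag `leastFixed (s i)` are all fixed by `s 0`.
    have h1 : push R X.leastFixed (m + 1) (single s 1) ∈
        supported R {W ∈ X.moved | ∀ g ∈ (s 0).1, X.act g W = W} (m + 1) :=
      push_single_mem (X.monotone_leastFixed.monotoneOn _) fun i =>
        ⟨(X.leastFixed_mem hX _).1, fun g hg =>
          (X.leastFixed_mem hX (s i)).2 g (s.monotone (Fin.zero_le i) hg)⟩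
    refine carry_mem_supported (S := {W ∈ X.moved | ∀ g ∈ (s 0).1, X.act g W = W})
      (T := Set.univ ∩ Set.Ici (s 0))
      (fun m t ht => X.isCarrier_flagStab m t fun i => (ht i).1) (fun m t ht => ⟨trivial, ?_⟩) h1
    rw [Set.mem_Ici, ← Subtype.coe_le_coe, X.coe_flagStab fun i => (ht i).1]
    rintro g hg _ ⟨i, rfl⟩
    exact (ht i).2 g hg
  have h0 : φ 0 = ψ 0 := by
    refine hom_ext fun s => ?_
    let t : Simplex (Submodule k V) 0 :=
      OrderEmbedding.ofStrictMono (fun i => i.elim0) (fun i => i.elim0)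
    change single s 1 = X.subdivision R 0 (push R X.leastFixed 0 (single s 1))
    rw [push, carry_zero_single _ s t, subdivision, carry_zero_single _ t s]
  refine ⟨htpy (fun m s => s 0) φ ψ (m + 1) z, ?_⟩
  rw [boundary_htpy hb hφ hψ h0 (fun _ _ _ => rfl) ?_ (mem_supported_univ z), hz, map_zero,
    sub_zero]
  · rfl
  · intro m c hc
    have h1 := push_mem_supported hmono hmaps hc
    change boundary R _ m (carry R _ (m + 1) (push R X.leastFixed (m + 1) c)) = _
    rw [boundary_carry X.isCarrier_flagStab h1, boundary_push hmono hc]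
    rfl

/-- The Steinberg representation has no coinvariants if this holds for the homology of the poset
of isotropic subspaces. -/
theorem subsingleton_coinvariants_steinberg {R : Type*} [CommRing R] [FiniteDimensional k V]
    (hX : X.LeastTermFixed) {m : ℕ}
    (h : cyclesOn R X.moved m ≤ coinvariantsKer X.act R X.moved Set.univ m) :
    Subsingleton (X.steinberg R (m + 1)).Coinvariants := by
  have hmono : MonotoneOn X.leastFixed Set.univ := X.monotone_leastFixed.monotoneOn _
  have hmaps : Set.MapsTo X.leastFixed Set.univ X.moved := fun P _ => (X.leastFixed_mem hX P).1
  -- the chains whose classes die in the coinvariants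
  let N : Submodule R (Chains R X.ProperParabolic (m + 1)) :=
    ((Representation.Coinvariants.ker (X.steinberg R (m + 1))).comap
      (boundaries R X.ProperParabolic (m + 1)).mkQ).map
        (cycles R X.ProperParabolic (m + 1)).subtype
  have hbd : ∀ d, boundary R X.ProperParabolic (m + 1) d ∈ N := fun d => by
    refine ⟨⟨_, boundary_boundary R X.ProperParabolic m d⟩, ?_, rfl⟩
    have : (boundaries R X.ProperParabolic (m + 1)).mkQ
        ⟨_, boundary_boundary R X.ProperParabolic m d⟩ = 0 :=
      (Submodule.Quotient.mk_eq_zero _).2 ⟨d, rfl⟩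
    change _ ∈ Representation.Coinvariants.ker _
    rw [this]
    exact Submodule.zero_mem _
  have hsub : ∀ g (w : Chains R X.ProperParabolic (m + 1)),
      boundary R X.ProperParabolic m w = 0 → chainRep R X.conjAction (m + 1) g w - w ∈ N := by
    intro g w hw
    let w' : cycles R X.ProperParabolic (m + 1) := ⟨w, hw⟩
    exact ⟨cyclesRep R X.conjAction (m + 1) g w' - w',
      Representation.Coinvariants.sub_mem_ker (ρ := X.steinberg R (m + 1)) g
        ((boundaries R X.ProperParabolic (m + 1)).mkQ w'), rfl⟩
  have hall : ∀ z, boundary R X.ProperParabolic m z = 0 → z ∈ N := by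
    intro z hz
    by_cases hne : Nonempty X.ProperParabolic
    · obtain ⟨d, hd⟩ := X.exists_boundary_eq_sub_subdivision R hX hz
      have hz' : push R X.leastFixed (m + 1) z ∈ cyclesOn R X.moved m :=
        ⟨push_mem_supported hmono hmaps (mem_supported_univ z), by
          rw [SetLike.mem_coe, LinearMap.mem_ker, boundary_push hmono (mem_supported_univ z), hz,
            map_zero]⟩
      have hle : coinvariantsKer X.act R X.moved Set.univ m ≤ N.comap (X.subdivision R (m + 1)) := by
        refine coinvariantsKer_le _ (fun g _ w hw => ?_) fun c hc => ?_
        · rw [mem_cyclesOn] at hw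
          rw [Submodule.mem_comap, map_sub, subdivision, ← chainRep_carry X.act X.conjAction
            (fun m s hs => X.flagStab_trans g hs) hw.1]
          refine hsub g _ ?_
          rw [boundary_carry X.isCarrier_flagStab hw.1, hw.2, map_zero]
        · rw [Submodule.mem_comap, subdivision, ← boundary_carry X.isCarrier_flagStab hc]
          exact hbd _
      have := Submodule.add_mem _ (hbd d) (hle (h hz'))
      rwa [hd, sub_add_cancel] at this
    · rw [not_nonempty_iff] at hne
      have : z = 0 := LinearMap.congr_fun (f := LinearMap.id) (g := 0)
        (hom_ext fun s => isEmptyElim (s 0)) z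
      rw [this]
      exact Submodule.zero_mem _
  refine subsingleton_of_forall_eq 0 fun x => ?_
  obtain ⟨x, rfl⟩ := Representation.Coinvariants.mk_surjective _ x
  obtain ⟨⟨z, hz⟩, rfl⟩ := Submodule.mkQ_surjective _ x
  obtain ⟨⟨w, hw⟩, hw', rfl⟩ := hall z hz
  exact (Representation.Coinvariants.mk_eq_zero _).2 hw'

end IsotropicGeometry

/-! ### The general and special linear groups -/

namespace IsotropicGeometry

open OrderComplex

variable {k G V : Type*} [Field k] [Group G] [AddCommGroup V] [Module k V]

theorem exists_dual_eq_one {p : Submodule k V} {v : V} (hv : v ∉ p) :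
    ∃ φ : Module.Dual k V, φ v = 1 ∧ ∀ x ∈ p, φ x = 0 := by
  obtain ⟨f, hf, hp⟩ := Submodule.exists_le_ker_of_notMem hv
  exact ⟨(f v)⁻¹ • f, by simp [hf], fun x hx => by simp [LinearMap.mem_ker.1 (hp hx)]⟩

/-- Every subspace is isotropic, and `G` contains all transvections. -/
structure IsLinear (X : IsotropicGeometry k G V) : Prop where
  isotropic : ∀ W, X.isotropic W
  exists_transvection : ∀ (φ : Module.Dual k V) (w : V), φ w = 0 →
    ∃ g, ∀ x, X.ρ g x = x + φ x • w

variable {X : IsotropicGeometry k G V}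

theorem act_eq_of_transvection {g : G} {φ : Module.Dual k V} {w : V} (hφ : φ w = 0)
    (hg : ∀ x, X.ρ g x = x + φ x • w) {W : Submodule k V} (hW : ∀ x ∈ W, φ x • w ∈ W) :
    X.act g W = W :=
  X.act_eq_of_add (N := φ.smulRight w) (fun x => by simp [hφ]) hg hW

variable (X) in
/-- The nonzero proper subspaces of `H`. -/
def properIn (H : Submodule k V) : Set (Submodule k V) := {W | W ≠ ⊥ ∧ W < H}

variable (X) in
/-- The transvections along vectors of `H` that are trivial on `C`. -/
def transvectionsIn (H C : Submodule k V) : Set G :=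
  {g | ∃ (φ : Module.Dual k V) (w : V), φ w = 0 ∧ w ∈ H ∧ (∀ x ∈ C, φ x = 0) ∧
    ∀ x, X.ρ g x = x + φ x • w}

namespace IsLinear

variable (h : X.IsLinear)
include h

theorem leastTermFixed [FiniteDimensional k V] : X.LeastTermFixed := by
  intro F hF hchain W₀ hW₀ hleast U hU hfix w hw
  obtain ⟨u, hu, hu0⟩ := U.ne_bot_iff.1 fun e => X.bot_notMem_moved (e ▸ hU)
  by_cases hwu : w ∈ Submodule.span k {u}
  · exact (Submodule.span_singleton_le_iff_mem _ _).2 hu hwu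
  -- the largest term of the flag that does not contain `u`
  obtain ⟨A, hA, huA, hwA⟩ : ∃ A : Submodule k V, (∀ W ∈ F, u ∉ W → W ≤ A) ∧ u ∉ A ∧
      (A = ⊥ ∨ w ∈ A) := by
    by_cases hne : {W ∈ F | u ∉ W}.Nonempty
    · obtain ⟨A, hA, hmax⟩ := wellFounded_gt.has_min _ hne
      refine ⟨A, fun W hW hu' => ?_, hA.2, Or.inr (hleast A hA.1 hw)⟩
      exact (hchain.total hW hA.1).elim id fun hle => (eq_of_le_of_not_lt hle (hmax W ⟨hW, hu'⟩)).ge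
    · exact ⟨⊥, fun W hW hu' => (hne ⟨W, hW, hu'⟩).elim, by simpa using hu0, Or.inl rfl⟩
  have huAw : u ∉ A ⊔ Submodule.span k {w} := by
    obtain rfl | hwA := hwA
    · rw [bot_sup_eq, Submodule.mem_span_singleton]
      rintro ⟨c, rfl⟩
      refine hwu (Submodule.mem_span_singleton.2 ⟨c⁻¹, ?_⟩)
      rw [smul_smul, inv_mul_cancel₀ fun hc => hu0 (by rw [hc, zero_smul]), one_smul]
    · rwa [sup_eq_left.2 ((Submodule.span_singleton_le_iff_mem _ _).2 hwA)]
  obtain ⟨φ, hφu, hφ⟩ := exists_dual_eq_one huAw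
  have hφw : φ w = 0 :=
    hφ w (Submodule.mem_sup_right (Submodule.mem_span_singleton_self w))
  obtain ⟨g, hg⟩ := h.exists_transvection φ w hφw
  have hgF : g ∈ X.stab F := fun W hW => act_eq_of_transvection hφw hg fun x hx => by
    by_cases huW : u ∈ W
    · exact W.smul_mem _ (hleast W hW hw)
    · rw [hφ x (Submodule.mem_sup_left (hA W hW huW hx)), zero_smul]
      exact W.zero_mem
  have hmem := X.rho_mem_of_act_eq (hfix g hgF) hu
  rw [hg, hφu, one_smul] at hmem
  exact (U.add_mem_iff_right hu).1 hmem

theorem moved_eq : X.moved = properIn (⊤ : Submodule k V) := by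
  ext W
  constructor
  · intro hW
    refine ⟨fun e => X.bot_notMem_moved (e ▸ hW), lt_top_iff_ne_top.2 ?_⟩
    rintro rfl
    obtain ⟨_, g, hg⟩ := hW
    exact hg (map_top (X.act g))
  · rintro ⟨h1, h2⟩
    obtain ⟨u, hu, hu0⟩ := W.ne_bot_iff.1 h1
    obtain ⟨v, -, hv⟩ := SetLike.exists_of_lt h2
    have huv : u ∉ Submodule.span k {v} := fun huv => by
      obtain ⟨c, rfl⟩ := Submodule.mem_span_singleton.1 huv
      exact hv ((W.smul_mem_iff fun hc => hu0 (by rw [hc, zero_smul])).1 hu)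
    obtain ⟨φ, hφu, hφ⟩ := exists_dual_eq_one huv
    obtain ⟨g, hg⟩ := h.exists_transvection φ v (hφ v (Submodule.mem_span_singleton_self v))
    refine ⟨h.isotropic W, g, fun e => hv ?_⟩
    have hmem := X.rho_mem_of_act_eq e hu
    rw [hg, hφu, one_smul] at hmem
    exact (W.add_mem_iff_right hu).1 hmem

/-- The projective line: with a third point `c`, the cycle `[b] - [a]` is `g w - w` for
`w = [a] - [c]` and a transvection `g` that fixes `c` and moves `a` to `b`. -/
theorem cyclesOn_line_le (R : Type*) [CommRing R] [FiniteDimensional k V]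
    {H C : Submodule k V} (hH : Module.finrank k H = 2) (hHC : Disjoint H C) :
    cyclesOn R (properIn H) 0 ≤ coinvariantsKer X.act R (properIn H) (X.transvectionsIn H C) 0 := by
  refine cyclesOn_zero_le fun b hb a ha => ?_
  have hline : ∀ W ∈ properIn H, ∃ x : V, x ≠ 0 ∧ x ∈ H ∧ W = Submodule.span k {x} := by
    intro W hW
    obtain ⟨x, hx, hx0⟩ := W.ne_bot_iff.1 hW.1
    refine ⟨x, hx0, hW.2.le hx, (Submodule.eq_of_le_of_finrank_le
      ((Submodule.span_singleton_le_iff_mem _ _).2 hx) ?_).symm⟩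
    have := Submodule.finrank_lt_finrank_of_lt hW.2
    rw [finrank_span_singleton hx0]
    omega
  have hspan : ∀ x : V, x ≠ 0 → x ∈ H → Submodule.span k {x} ∈ properIn H := by
    intro x hx0 hx
    refine ⟨by simpa using hx0, lt_of_le_of_ne ((Submodule.span_singleton_le_iff_mem _ _).2 hx) ?_⟩
    intro e
    rw [← e, finrank_span_singleton hx0] at hH
    omega
  by_cases hab : b = a
  · rw [hab, sub_self]
    exact Submodule.zero_mem _
  obtain ⟨x, hx0, hx, rfl⟩ := hline a ha
  obtain ⟨y, hy0, hy, rfl⟩ := hline b hb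
  have hxy : ∀ t : k, t • (x + y) ≠ y := fun t e => by
    have e' : t • x = (1 - t) • y := by
      rw [sub_smul, one_smul, eq_sub_iff_add_eq, ← smul_add, e]
    by_cases ht : t = 0
    · rw [ht, zero_smul] at e
      exact hy0 e.symm
    · refine hab (Submodule.span_singleton_eq_span_singleton.2 ?_)
      have hne : (1 - t) * t⁻¹ ≠ 0 := fun h0 => by
        have : 1 - t = 0 := (mul_eq_zero.1 h0).resolve_right (inv_ne_zero ht)
        rw [this, zero_smul] at e'
        exact (smul_ne_zero ht hx0) e'
      refine ⟨Units.mk0 _ hne, ?_⟩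
      rw [Units.smul_def, Units.val_mk0, mul_comm, mul_smul, ← e', smul_smul, inv_mul_cancel₀ ht,
        one_smul]
  have hyC : y ∉ C ⊔ Submodule.span k {x + y} := by
    intro hmem
    obtain ⟨c, hc, d, hd, e⟩ := Submodule.mem_sup.1 hmem
    obtain ⟨t, rfl⟩ := Submodule.mem_span_singleton.1 hd
    have hcH : c ∈ H := by
      rw [eq_sub_of_add_eq e]
      exact H.sub_mem hy (H.smul_mem _ (H.add_mem hx hy))
    rw [Submodule.disjoint_def.1 hHC c hcH hc, zero_add] at e
    exact hxy t e
  obtain ⟨φ, hφy, hφ⟩ := exists_dual_eq_one hyC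
  have hφxy : φ (x + y) = 0 :=
    hφ _ (Submodule.mem_sup_right (Submodule.mem_span_singleton_self _))
  have hφx : φ x = -1 := by
    rw [map_add, hφy] at hφxy
    exact eq_neg_of_add_eq_zero_left hφxy
  obtain ⟨g, hg⟩ := h.exists_transvection φ (x + y) hφxy
  have hgx : X.act g (Submodule.span k {x}) = Submodule.span k {y} := by
    rw [act_span_singleton, hg, hφx, neg_one_smul, show x + -(x + y) = -y by abel]
    exact Submodule.span_singleton_eq_span_singleton.2 ⟨-1, by simp [Units.smul_def]⟩
  have hgc : X.act g (Submodule.span k {x + y}) = Submodule.span k {x + y} := by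
    rw [act_span_singleton, hg, hφxy, zero_smul, add_zero]
  have hxy0 : x + y ≠ 0 := fun e => hab (Submodule.span_singleton_eq_span_singleton.2
    ⟨-1, by rw [eq_neg_of_add_eq_zero_left e]; simp [Units.smul_def]⟩)
  have hw : ofSeq R ![Submodule.span k {x}] - ofSeq R ![Submodule.span k {x + y}] ∈
      cyclesOn R (properIn H) 0 := by
    refine mem_cyclesOn.2 ⟨Submodule.sub_mem _ (ofSeq_mem_supported fun i => ?_)
      (ofSeq_mem_supported fun i => ?_), ?_⟩
    · fin_cases i
      exact ha
    · fin_cases i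
      exact hspan _ hxy0 (H.add_mem hx hy)
    · rw [map_sub, boundary_point_eq _ (Submodule.span k {x + y}), sub_self]
  have key := sub_mem_coinvariantsKer X.act (Γ := X.transvectionsIn H C)
    ⟨φ, x + y, hφxy, H.add_mem hx hy, fun z hz => hφ z (Submodule.mem_sup_left hz), hg⟩ hw
  rw [map_sub, chainRep_point, chainRep_point, hgx, hgc] at key
  convert key using 1
  abel

theorem cyclesOn_le_coinvariantsKer (R : Type*) [CommRing R] [FiniteDimensional k V] (m : ℕ)
    (H C : Submodule k V) (hH : Module.finrank k H = m + 2) (hHC : Disjoint H C) :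
    cyclesOn R (properIn H) m ≤ coinvariantsKer X.act R (properIn H) (X.transvectionsIn H C) m := by
  induction m generalizing H C with
  | zero => exact h.cyclesOn_line_le R hH hHC
  | succ m ih =>
    obtain ⟨H₀, hle, hH₀⟩ : ∃ H₀ ≤ H, Module.finrank k H₀ = m + 2 := by
      have : Nontrivial H := Module.nontrivial_of_finrank_pos (R := k) (by omega)
      obtain ⟨ψ, hψ⟩ := exists_ne (0 : Module.Dual k H)
      refine ⟨(LinearMap.ker ψ).map H.subtype, Submodule.map_subtype_le _ _, ?_⟩
      have := Module.Dual.finrank_ker_add_one_of_ne_zero hψ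
      rw [Submodule.finrank_map_subtype_eq]
      omega
    have hne : H₀ ≠ H := by
      rintro rfl
      omega
    have hsup : ∀ o ∈ properIn H, o ⊓ H₀ = ⊥ → o ⊔ H₀ = H := by
      intro o ho hoc
      refine Submodule.eq_of_le_of_finrank_le (sup_le ho.2.le hle) ?_
      have hlt : H₀ < o ⊔ H₀ := right_lt_sup.2 fun hle' => ho.1 (by rwa [inf_eq_left.2 hle'] at hoc)
      have := Submodule.finrank_lt_finrank_of_lt hlt
      omega
    have hsys : IsOppositeSystem (properIn H) H₀ fun _ => properIn H₀ := by
      refine ⟨fun hb => hb.1 rfl, fun o ho hoc W hW => hsup o ho hoc ▸ hW.2.le,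
        fun o ho hoc W hW hoW => ⟨fun hb => ?_, lt_of_le_of_ne inf_le_right fun e => ?_⟩,
        fun o ho hoc W hW => ⟨hW.1, hW.2.trans_le hle⟩, fun o ho hoc W hW => hW.2.le,
        fun o ho hoc W hW => ⟨fun hb => hW.1 (eq_bot_iff.2 (le_sup_left.trans hb.le)),
          lt_of_le_of_ne (sup_le (hW.2.le.trans hle) ho.2.le) fun e => ?_⟩⟩
      · have e := sup_inf_assoc_of_le H₀ hoW.le
        rw [hsup o ho hoc, inf_eq_right.2 hW.2.le, inf_comm H₀, hb, sup_bot_eq] at e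
        exact hoW.ne' e
      · exact (hW.2.trans_le (hsup o ho hoc ▸ sup_le hoW.le (inf_eq_right.1 e))).false
      · have e' := sup_inf_assoc_of_le o hW.2.le
        rw [e, inf_eq_right.2 hle, hoc, sup_bot_eq] at e'
        exact hW.2.ne' e'
    have hH₀Y : H₀ ∈ {W ∈ properIn H | W ⊓ H₀ ≠ ⊥} := by
      have h0 : H₀ ≠ ⊥ := by
        rintro rfl
        rw [finrank_bot] at hH₀
        omega
      exact ⟨⟨h0, lt_of_le_of_ne hle hne⟩, by rwa [inf_idem]⟩
    have hY : Acyclic R {W ∈ properIn H | W ⊓ H₀ ≠ ⊥} :=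
      acyclic_of_zigzag (f := fun W => W ⊓ H₀) (g := fun _ => H₀) (monotone_inf H₀) monotone_const
        (fun W hW => ⟨⟨hW.2, inf_le_left.trans_lt hW.1.2⟩, by rw [inf_assoc, inf_idem]; exact hW.2⟩)
        (fun _ _ => hH₀Y) hH₀Y (fun _ _ => inf_le_left) (fun _ _ => inf_le_right)
        fun _ _ => le_rfl
    refine hsys.cyclesOn_le X.act hY fun o ho hoc => ?_
    have hdisj : Disjoint H₀ (C ⊔ o) := by
      rw [sup_comm]
      refine Disjoint.disjoint_sup_right_of_disjoint_sup_left
        (disjoint_iff.2 (by rwa [inf_comm])) ?_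
      rwa [sup_comm, hsup o ho hoc]
    refine (ih H₀ (C ⊔ o) hH₀ hdisj).trans (hsys.coinvariantsKer_le_comap X.act hY ho hoc ?_ ?_ ?_ ?_)
    · rintro g ⟨φ, w, h1, h2, h3, h4⟩
      exact ⟨φ, w, h1, hle h2, fun x hx => h3 x (Submodule.mem_sup_left hx), h4⟩
    · rintro g ⟨φ, w, h1, h2, h3, h4⟩
      refine act_eq_of_transvection h1 h4 fun x hx => ?_
      rw [h3 x (Submodule.mem_sup_right hx), zero_smul]
      exact o.zero_mem
    · rintro g ⟨φ, w, h1, h2, h3, h4⟩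
      exact act_eq_of_transvection h1 h4 fun x hx => H₀.smul_mem _ h2
    · rintro g ⟨φ, w, h1, h2, h3, h4⟩ W hW
      have hgH : X.act g H = H := act_eq_of_transvection h1 h4 fun x hx => H.smul_mem _ (hle h2)
      refine ⟨fun e => hW.1 ((map_eq_bot_iff (X.act g)).1 e), ?_⟩
      rw [← hgH]
      exact (X.act g).strictMono hW.2

theorem subsingleton_coinvariants (R : Type*) [CommRing R] [FiniteDimensional k V] {r : ℕ}
    (hr : 1 ≤ r) (hV : Module.finrank k V = r + 1) :
    Subsingleton (X.steinberg R r).Coinvariants := by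
  obtain ⟨m, rfl⟩ := Nat.exists_eq_add_of_le' hr
  refine X.subsingleton_coinvariants_steinberg h.leastTermFixed ?_
  rw [h.moved_eq]
  exact (h.cyclesOn_le_coinvariantsKer R m ⊤ ⊥ (by rw [finrank_top, hV]) disjoint_bot_right).trans
    (coinvariantsKer_mono _ (Set.subset_univ _) m)

end IsLinear

end IsotropicGeometry

/-! ### Symplectic and orthogonal groups -/

namespace OrderComplex

variable {R α G : Type*} [CommRing R] [Lattice α] [Group G] (a : G →* (α ≃o α))

theorem boundary_edge {x z : α} (h : x ≤ z) :
    boundary R α 1 (ofSeq R ![x, z]) = ofSeq R ![z] - ofSeq R ![x] := by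
  have hst : ∀ y : α, StrictMono ![y] := fun y i j hij => (hij.ne (Subsingleton.elim i j)).elim
  have hcone : ∀ y, ofSeq R ![x, y] = cone x 1 (ofSeq R ![y]) := fun y => by
    rw [ofSeq_of_strictMono (hst y), cone_single]
    rfl
  have hpt : ∀ y, ofSeq R ![y] = cone y 0 (boundary R α 0 (ofSeq R ![y])) := fun y => by
    rw [ofSeq_of_strictMono (hst y)]
    exact (cone_boundary_single (OrderEmbedding.ofStrictMono _ (hst y))).symm
  rw [hcone, boundary_cone, boundary_point_eq z x, ← hpt x]
  exact ofSeq_mem_supported fun i => by fin_cases i; exact h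

/-- The path from `x` to `y` through `x ⊔ y`. -/
noncomputable def hook (R : Type*) [CommRing R] (x y : α) : Chains R α 2 :=
  ofSeq R ![x, x ⊔ y] - ofSeq R ![y, x ⊔ y]

theorem hook_swap (x y : α) : hook R y x = - hook R x y := by
  rw [hook, hook, sup_comm, neg_sub]

theorem hook_add_hook {x y z : α} (h1 : x ⊔ y = x ⊔ z) (h2 : y ⊔ z = x ⊔ z) :
    hook R x y + hook R y z = hook R x z := by
  rw [hook, hook, hook, h1, h2]
  abel

theorem boundary_hook (x y : α) :
    boundary R α 1 (hook R x y) = ofSeq R ![y] - ofSeq R ![x] := by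
  rw [hook, map_sub, boundary_edge le_sup_left, boundary_edge le_sup_right]
  abel

theorem chainRep_hook (g : G) (x y : α) :
    chainRep R a 2 g (hook R x y) = hook R (a g x) (a g y) := by
  rw [hook, hook, map_sub, chainRep_edge, chainRep_edge, OrderIso.map_sup]

theorem hook_mem_supported {S : Set α} {x y : α} (hx : x ∈ S) (hy : y ∈ S) (hxy : x ⊔ y ∈ S) :
    hook R x y ∈ supported R S 2 :=
  Submodule.sub_mem _ (ofSeq_mem_supported fun i => by fin_cases i <;> assumption)
    (ofSeq_mem_supported fun i => by fin_cases i <;> assumption)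

theorem coneHtpy_point (o x : α) : coneHtpy R o 1 (ofSeq R ![x]) = hook R o x := by
  have hst : ∀ y : α, StrictMono ![y] := fun y i j hij => (hij.ne (Subsingleton.elim i j)).elim
  have hcone : ∀ x y, cone x 1 (ofSeq R ![y]) = ofSeq R ![x, y] := fun x y => by
    rw [ofSeq_of_strictMono (hst y), cone_single]
    rfl
  have hpush : push R (fun y => y ⊔ o) 1 (ofSeq R ![x]) = ofSeq R ![x ⊔ o] := by
    have h' : StrictMono fun i : Fin 1 => ![x] i ⊔ o := fun i j hij =>
      (hij.ne (Subsingleton.elim i j)).elim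
    rw [ofSeq_of_strictMono (hst x), push_single_of_strictMono h', ← ofSeq_coe]
    congr 1
    funext i
    fin_cases i
    rfl
  have hprism : prism R id (fun y => y ⊔ o) 1 (ofSeq R ![x]) = ofSeq R ![x, x ⊔ o] := by
    have hself : cone x 1 (ofSeq R ![x]) = 0 := by
      rw [ofSeq_of_strictMono (hst x)]
      exact cone_eq_zero rfl
    have e : prism R id (fun y => y ⊔ o) 1 (ofSeq R ![x]) = cone x 1
        (push R (fun y => y ⊔ o) 1 (ofSeq R ![x]) - push R id 1 (ofSeq R ![x])) := by
      rw [ofSeq_of_strictMono (hst x), prism, htpy_succ_single, htpy, LinearMap.zero_apply, sub_zero]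
      rfl
    rw [e, hpush, push_id, map_sub, hself, hcone, sub_zero]
  rw [coneHtpy, LinearMap.sub_apply, LinearMap.comp_apply, hpush, hprism, hcone, hook, sup_comm]

/-- The closed path through `x, y, z, t`. -/
noncomputable def quadrangle (R : Type*) [CommRing R] (x y z t : α) : Chains R α 2 :=
  hook R x y + hook R y z + hook R z t + hook R t x

theorem boundary_quadrangle (x y z t : α) : boundary R α 1 (quadrangle R x y z t) = 0 := by
  simp only [quadrangle, map_add, boundary_hook]
  abel

theorem chainRep_quadrangle (g : G) (x y z t : α) :
    chainRep R a 2 g (quadrangle R x y z t) = quadrangle R (a g x) (a g y) (a g z) (a g t) := by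
  simp only [quadrangle, map_add, chainRep_hook]

end OrderComplex

namespace IsotropicGeometry

open OrderComplex

variable {k G V : Type*} [Field k] [Group G] [AddCommGroup V] [Module k V]

/-- The isotropic subspaces of `X` are those on which a function `q` and an `ε`-symmetric bilinear
form `B` vanish, and `G` contains the Siegel transvections. This covers quadratic forms `q` with
their polar forms `B`, and alternating forms `B` with `q = 0`. Singular vectors, that is, zeros
of `q`, are not in the radical of `B`, and some isotropic subspace has dimension at least `2`. -/
structure IsPolar (X : IsotropicGeometry k G V) (B : LinearMap.BilinForm k V) (q : V → k)
    (ε : k) : Prop where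
  isotropic_iff : ∀ W, X.isotropic W ↔ ∀ x ∈ W, q x = 0 ∧ ∀ y ∈ W, B x y = 0
  symm : ∀ x y, B x y = ε * B y x
  q_smul : ∀ (c : k) x, q x = 0 → q (c • x) = 0
  q_add : ∀ x y, q x = 0 → q y = 0 → B x y = 0 → q (x + y) = 0
  self : ∀ x, q x = 0 → B x x = 0
  q_sub : ∀ x y, q x = 0 → B x y = 1 → q (y - q y • x) = 0
  exists_ne : ∀ x, q x = 0 → x ≠ 0 → ∃ y, B x y ≠ 0
  exists_siegel : ∀ a b, q a = 0 → q b = 0 → B a b = 0 →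
    ∃ g, ∀ x, X.ρ g x = x + (B x b • a - B a x • b)
  exists_plane : ∃ e₁ e₂, q e₁ = 0 ∧ q e₂ = 0 ∧ B e₁ e₂ = 0 ∧
    ∀ s t : k, s • e₁ + t • e₂ = 0 → s = 0 ∧ t = 0

variable {X : IsotropicGeometry k G V} {B : LinearMap.BilinForm k V} {q : V → k} {ε : k}

variable (X) in
/-- The nonzero isotropic subspaces of `U`. -/
def isotropicIn (U : Submodule k V) : Set (Submodule k V) := {W | W ≠ ⊥ ∧ W ≤ U ∧ X.isotropic W}

variable (X) in
/-- The Siegel transvections along vectors of `U`. -/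
def siegelIn (B : LinearMap.BilinForm k V) (q : V → k) (U : Submodule k V) : Set G :=
  {g | ∃ a ∈ U, ∃ b ∈ U, q a = 0 ∧ q b = 0 ∧ B a b = 0 ∧
    ∀ x, X.ρ g x = x + (B x b • a - B a x • b)}

namespace IsPolar

variable (h : X.IsPolar B q ε)
include h

theorem symm_zero {x y : V} (hxy : B x y = 0) : B y x = 0 := by
  rw [h.symm, hxy, mul_zero]

theorem act_eq_of_siegel {g : G} {a b : V} (ha : q a = 0) (hb : q b = 0) (hab : B a b = 0)
    (hg : ∀ x, X.ρ g x = x + (B x b • a - B a x • b)) {W : Submodule k V}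
    (hW : ∀ x ∈ W, B x b • a - B a x • b ∈ W) : X.act g W = W := by
  refine X.act_eq_of_add (N := (B.flip b).smulRight a - (B a).smulRight b) (fun x => ?_) hg hW
  simp [h.self a ha, h.self b hb, hab]

theorem isotropic_mono {W W' : Submodule k V} (hle : W' ≤ W) (hW : X.isotropic W) :
    X.isotropic W' := by
  rw [h.isotropic_iff] at hW ⊢
  exact fun x hx => ⟨(hW x (hle hx)).1, fun y hy => (hW x (hle hx)).2 y (hle hy)⟩

theorem isotropic_sup {W W' : Submodule k V} (hW : X.isotropic W) (hW' : X.isotropic W')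
    (horth : ∀ x ∈ W, ∀ y ∈ W', B x y = 0) : X.isotropic (W ⊔ W') := by
  rw [h.isotropic_iff] at hW hW' ⊢
  intro x hx
  obtain ⟨w, hw, w', hw', rfl⟩ := Submodule.mem_sup.1 hx
  refine ⟨h.q_add _ _ (hW w hw).1 (hW' w' hw').1 (horth w hw w' hw'), fun y hy => ?_⟩
  obtain ⟨v, hv, v', hv', rfl⟩ := Submodule.mem_sup.1 hy
  simp [(hW w hw).2 v hv, (hW' w' hw').2 v' hv', horth w hw v' hv', h.symm_zero (horth v hv w' hw')]

theorem isotropic_span {x : V} (hx : q x = 0) : X.isotropic (Submodule.span k {x}) := by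
  rw [h.isotropic_iff]
  intro y hy
  obtain ⟨s, rfl⟩ := Submodule.mem_span_singleton.1 hy
  refine ⟨h.q_smul _ _ hx, fun z hz => ?_⟩
  obtain ⟨t, rfl⟩ := Submodule.mem_span_singleton.1 hz
  simp [h.self x hx]

theorem q_add_smul {x y : V} (hx : q x = 0) (hy : q y = 0) (hxy : B x y = 0) (s t : k) :
    q (s • x + t • y) = 0 :=
  h.q_add _ _ (h.q_smul _ _ hx) (h.q_smul _ _ hy) (by simp [hxy])

theorem exists_partner {x : V} (hx : q x = 0) (hx0 : x ≠ 0) : ∃ f, q f = 0 ∧ B x f = 1 := by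
  obtain ⟨y, hy⟩ := h.exists_ne x hx hx0
  have hy' : B x ((B x y)⁻¹ • y) = 1 := by simp [hy]
  exact ⟨_, h.q_sub x _ hx hy', by rw [map_sub, hy', map_smul, h.self x hx]; simp⟩

theorem exists_partner_orthogonal {u w : V} (hu : q u = 0) (hw : q w = 0) (hwu : B w u = 0)
    (hu0 : u ≠ 0) (hindep : w ∉ Submodule.span k {u}) : ∃ b, q b = 0 ∧ B u b = 1 ∧ B w b = 0 := by
  have hw0 : w ≠ 0 := fun e => hindep (e ▸ Submodule.zero_mem _)
  obtain ⟨y₀, -, hy₀⟩ := h.exists_partner hw hw0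
  have hx : q (u - B u y₀ • w) = 0 := by
    have := h.q_add_smul hu hw (h.symm_zero hwu) 1 (-B u y₀)
    rwa [one_smul, neg_smul, ← sub_eq_add_neg] at this
  have hx0 : u - B u y₀ • w ≠ 0 := fun e => by
    have e' := sub_eq_zero.1 e
    refine hindep (Submodule.mem_span_singleton.2 ⟨(B u y₀)⁻¹, ?_⟩)
    have hne : B u y₀ ≠ 0 := fun h0 => hu0 (by rw [e', h0, zero_smul])
    rw [inv_smul_eq_iff₀ hne]
    exact e'
  obtain ⟨y₁, hy₁⟩ := h.exists_ne _ hx hx0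
  have hy₁' : B u y₁ - B u y₀ * B w y₁ ≠ 0 := by simpa using hy₁
  let y := (B u y₁ - B u y₀ * B w y₁)⁻¹ • (y₁ - B w y₁ • y₀)
  have huy : B u y = 1 := by
    simp only [y, map_smul, map_sub, smul_eq_mul]
    rw [mul_comm (B w y₁)]
    exact inv_mul_cancel₀ hy₁'
  have hwy : B w y = 0 := by
    simp [y, hy₀]
  exact ⟨y - q y • u, h.q_sub u y hu huy, by simp [huy, h.self u hu], by simp [hwy, hwu]⟩

theorem exists_orthogonal_of_pair {w u : V} (hw : q w = 0) (hwu : B u w ≠ 0) :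
    ∃ b, b ≠ 0 ∧ q b = 0 ∧ B w b = 0 ∧ B u b = 0 := by
  obtain ⟨b, hb, hwb, hbw⟩ : ∃ b, q b = 0 ∧ B w b = 0 ∧ b ∉ Submodule.span k {w} := by
    obtain ⟨e₁, e₂, h₁, h₂, h₁₂, hind⟩ := h.exists_plane
    by_cases hzero : B w e₁ = 0 ∧ B w e₂ = 0
    · by_cases hm₁ : e₁ ∈ Submodule.span k {w}
      · by_cases hm₂ : e₂ ∈ Submodule.span k {w}
        · exfalso
          obtain ⟨s, rfl⟩ := Submodule.mem_span_singleton.1 hm₁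
          obtain ⟨t, rfl⟩ := Submodule.mem_span_singleton.1 hm₂
          have h1 := hind t (-s) (by rw [smul_smul, smul_smul, neg_mul, neg_smul, mul_comm,
            add_neg_cancel])
          have h2 := hind 1 0 (by simp [neg_eq_zero.1 h1.2])
          exact one_ne_zero h2.1
        · exact ⟨e₂, h₂, hzero.2, hm₂⟩
      · exact ⟨e₁, h₁, hzero.1, hm₁⟩
    · refine ⟨B w e₂ • e₁ + (- B w e₁) • e₂, h.q_add_smul h₁ h₂ h₁₂ _ _, ?_, fun hmem => ?_⟩
      · simp only [map_add, map_smul, smul_eq_mul]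
        ring
      · obtain ⟨c, hc⟩ := Submodule.mem_span_singleton.1 hmem
        have h11 := h.self e₁ h₁
        have h22 := h.self e₂ h₂
        have h21 := h.symm_zero h₁₂
        have hc0 : c ≠ 0 := by
          rintro rfl
          rw [zero_smul] at hc
          have := hind _ _ hc.symm
          exact hzero ⟨neg_eq_zero.1 this.2, this.1⟩
        have k1 : B (c • w) e₁ = 0 := by
          rw [hc]
          simp [h11, h21]
        have k2 : B (c • w) e₂ = 0 := by
          rw [hc]
          simp [h₁₂, h22]
        simp only [map_smul, LinearMap.smul_apply, smul_eq_mul, mul_eq_zero, hc0, false_or] at k1 k2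
        exact hzero ⟨k1, k2⟩
  refine ⟨(1 : k) • b + (-(B u b / B u w)) • w, fun e => hbw ?_,
    h.q_add_smul hb hw (h.symm_zero hwb) _ _, by simp [hwb, h.self w hw], ?_⟩
  · rw [one_smul, neg_smul, ← sub_eq_add_neg, sub_eq_zero] at e
    exact Submodule.mem_span_singleton.2 ⟨_, e.symm⟩
  · simp [hwu]

/-- The smallest term of a flag lies in every isotropic subspace `U` stable under the stabilizer of
the flag: the Siegel transvections along a vector `w` of this term and any singular vector
orthogonal to `w` stabilize the flag, and they move vectors of `U` by multiples of `w`. -/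
theorem least_le {F : Set (Submodule k V)} (hF : ∀ W ∈ F, X.isotropic W) {W₀ U : Submodule k V}
    (hW₀ : W₀ ∈ F) (hleast : ∀ W ∈ F, W₀ ≤ W) (hU : X.isotropic U) (hU0 : U ≠ ⊥)
    (hfix : ∀ g ∈ X.stab F, X.act g U = U) : W₀ ≤ U := by
  intro w hw
  have hqw : q w = 0 := ((h.isotropic_iff _).1 (hF _ hW₀) w hw).1
  have hmove : ∀ b, q b = 0 → B w b = 0 → ∀ u ∈ U, B u b • w - B w u • b ∈ U := by
    intro b hb hwb u hu
    obtain ⟨g, hg⟩ := h.exists_siegel w b hqw hb hwb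
    have hgF : g ∈ X.stab F := fun W hW => h.act_eq_of_siegel hqw hb hwb hg fun x hx => by
      rw [((h.isotropic_iff _).1 (hF W hW) w (hleast W hW hw)).2 x hx, zero_smul, sub_zero]
      exact W.smul_mem _ (hleast W hW hw)
    have hmem := X.rho_mem_of_act_eq (hfix g hgF) hu
    rw [hg] at hmem
    exact (U.add_mem_iff_right hu).1 hmem
  have horth : ∀ u ∈ U, u ≠ 0 → B w u = 0 → w ∈ U := by
    intro u hu hu0 hwu
    by_cases hwspan : w ∈ Submodule.span k {u}
    · exact (Submodule.span_singleton_le_iff_mem _ _).2 hu hwspan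
    · obtain ⟨b, hb, hub, hwb⟩ := h.exists_partner_orthogonal
        ((h.isotropic_iff _).1 hU u hu).1 hqw hwu hu0 hwspan
      simpa [hub, hwu] using hmove b hb hwb u hu
  obtain ⟨u, hu, hu0⟩ := U.ne_bot_iff.1 hU0
  by_cases hwu : B w u = 0
  · exact horth u hu hu0 hwu
  · obtain ⟨b, hb0, hb, hwb, hub⟩ := h.exists_orthogonal_of_pair hqw
      fun e => hwu (h.symm_zero e)
    have hmem := hmove b hb hwb u hu
    rw [hub, zero_smul, zero_sub, neg_mem_iff, Submodule.smul_mem_iff _ hwu] at hmem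
    exact horth b hmem hb0 hwb

theorem leastTermFixed : X.LeastTermFixed := fun _ hF _ _ hW₀ hleast _ hU hfix =>
  h.least_le (fun _ hW => (hF hW).1) hW₀ hleast hU.1 (fun e => X.bot_notMem_moved (e ▸ hU)) hfix

theorem moved_eq : X.moved = X.isotropicIn ⊤ := by
  ext W
  refine ⟨fun hW => ⟨fun e => X.bot_notMem_moved (e ▸ hW), le_top, hW.1⟩, fun hW => ⟨hW.2.2, ?_⟩⟩
  by_contra! hall
  obtain ⟨w, hw, hw0⟩ := W.ne_bot_iff.1 hW.1
  have hiso := (h.isotropic_iff W).1 hW.2.2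
  obtain ⟨f, hf, hwf⟩ := h.exists_partner (hiso w hw).1 hw0
  have hle : Submodule.span k {f} ≤ W := h.least_le (F := {Submodule.span k {f}})
    (by rintro _ rfl; exact h.isotropic_span hf) rfl (by rintro _ rfl; exact le_rfl) hW.2.2 hW.1
    fun g _ => hall g
  rw [(hiso w hw).2 f (hle (Submodule.mem_span_singleton_self f))] at hwf
  exact zero_ne_one hwf

theorem span_mem_isotropicIn {U : Submodule k V} {x : V} (hx : x ∈ U) (hq : q x = 0)
    (hx0 : x ≠ 0) : Submodule.span k {x} ∈ X.isotropicIn U :=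
  ⟨by simpa using hx0, (Submodule.span_singleton_le_iff_mem _ _).2 hx, h.isotropic_span hq⟩

theorem hook_mem_supported_isotropicIn {R : Type*} [CommRing R] {U : Submodule k V} {x y : V}
    (hx : x ∈ U) (hy : y ∈ U) (hqx : q x = 0) (hqy : q y = 0) (hx0 : x ≠ 0) (hy0 : y ≠ 0)
    (hxy : B x y = 0) :
    hook R (Submodule.span k {x}) (Submodule.span k {y}) ∈ supported R (X.isotropicIn U) 2 := by
  have h1 := h.span_mem_isotropicIn hx hqx hx0
  have h2 := h.span_mem_isotropicIn hy hqy hy0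
  refine hook_mem_supported h1 h2 ⟨fun e => h1.1 (eq_bot_iff.2 (le_sup_left.trans e.le)),
    sup_le h1.2.1 h2.2.1, h.isotropic_sup h1.2.2 h2.2.2 ?_⟩
  intro z hz t ht
  obtain ⟨c, rfl⟩ := Submodule.mem_span_singleton.1 hz
  obtain ⟨d, rfl⟩ := Submodule.mem_span_singleton.1 ht
  simp [hxy]

/-- The apartment of a hyperbolic basis `a, b, c, d` vanishes in the coinvariants: with
`w` the apartment of `a - b, b, c, c + d` and `g` the Siegel transvection that fixes `a - b` and
`c + d`, moves `b` to `a` and `c` to `-d`, it is `w - g w`. -/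
theorem quadrangle_mem_coinvariantsKer (R : Type*) [CommRing R] {U : Submodule k V} {a b c d : V}
    (ha : a ∈ U) (hb : b ∈ U) (hc : c ∈ U) (hd : d ∈ U) (hqa : q a = 0) (hqb : q b = 0)
    (hqc : q c = 0) (hqd : q d = 0) (hac : B a c = 1) (hbd : B b d = 1) (hab : B a b = 0)
    (had : B a d = 0) (hbc : B b c = 0) (hcd : B c d = 0) :
    quadrangle R (Submodule.span k {a}) (Submodule.span k {b}) (Submodule.span k {c})
      (Submodule.span k {d}) ∈ coinvariantsKer X.act R (X.isotropicIn U) (X.siegelIn B q U) 1 := by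
  have haa := h.self a hqa
  have hbb := h.self b hqb
  have hcc := h.self c hqc
  have hdd := h.self d hqd
  have hba := h.symm_zero hab
  have hcb := h.symm_zero hbc
  have hq₁ : q (a - b) = 0 := by
    have := h.q_add_smul hqa hqb hab 1 (-1)
    rwa [one_smul, neg_one_smul, ← sub_eq_add_neg] at this
  have hq₂ : q (c + d) = 0 := h.q_add c d hqc hqd hcd
  have horth : B (a - b) (c + d) = 0 := by simp [hac, hbd, had, hbc]
  obtain ⟨g, hg⟩ := h.exists_siegel (a - b) (c + d) hq₁ hq₂ horth
  have hg₁ : X.act g (Submodule.span k {a - b}) = Submodule.span k {a - b} := by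
    rw [act_span_singleton, hg, horth, h.self _ hq₁]
    simp
  have hg₂ : X.act g (Submodule.span k {b}) = Submodule.span k {a} := by
    rw [act_span_singleton, hg]
    simp [hbc, hbd, hab, hbb]
  have hg₃ : X.act g (Submodule.span k {c}) = Submodule.span k {d} := by
    rw [act_span_singleton, hg]
    have e : c + (B c (c + d) • (a - b) - B (a - b) c • (c + d)) = -d := by
      simp [hcc, hcd, hac, hbc]
    rw [e]
    exact Submodule.span_singleton_eq_span_singleton.2 ⟨-1, by simp [Units.smul_def]⟩
  have hg₄ : X.act g (Submodule.span k {c + d}) = Submodule.span k {c + d} := by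
    rw [act_span_singleton, hg, horth, h.self _ hq₂]
    simp
  -- The planes spanned by `a, b` and by `c, d`.
  have hsup : ∀ {x y x' y' : V}, x ∈ Submodule.span k {x'} ⊔ Submodule.span k {y'} →
      y ∈ Submodule.span k {x'} ⊔ Submodule.span k {y'} →
      x' ∈ Submodule.span k {x} ⊔ Submodule.span k {y} →
      y' ∈ Submodule.span k {x} ⊔ Submodule.span k {y} →
      Submodule.span k {x} ⊔ Submodule.span k {y} =
        Submodule.span k {x'} ⊔ Submodule.span k {y'} := by
    intro x y x' y' h1 h2 h3 h4
    simp only [← Submodule.span_singleton_le_iff_mem] at h1 h2 h3 h4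
    exact le_antisymm (sup_le h1 h2) (sup_le h3 h4)
  have hl : ∀ x y : V, x ∈ Submodule.span k {x} ⊔ Submodule.span k {y} := fun x y =>
    Submodule.mem_sup_left (Submodule.mem_span_singleton_self x)
  have hr : ∀ x y : V, y ∈ Submodule.span k {x} ⊔ Submodule.span k {y} := fun x y =>
    Submodule.mem_sup_right (Submodule.mem_span_singleton_self y)
  have p₁ : Submodule.span k {a - b} ⊔ Submodule.span k {b} =
      Submodule.span k {a} ⊔ Submodule.span k {b} :=
    hsup (Submodule.sub_mem _ (hl a b) (hr a b)) (hr a b)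
      (by simpa using Submodule.add_mem _ (hl (a - b) b) (hr (a - b) b)) (hr _ _)
  have p₂ : Submodule.span k {a} ⊔ Submodule.span k {a - b} =
      Submodule.span k {a} ⊔ Submodule.span k {b} :=
    hsup (hl _ _) (Submodule.sub_mem _ (hl a b) (hr a b)) (hl _ _)
      (by simpa using Submodule.sub_mem _ (hl a (a - b)) (hr a (a - b)))
  have p₃ : Submodule.span k {c} ⊔ Submodule.span k {c + d} =
      Submodule.span k {c} ⊔ Submodule.span k {d} :=
    hsup (hl _ _) (Submodule.add_mem _ (hl c d) (hr c d)) (hl _ _)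
      (by simpa using Submodule.sub_mem _ (hr c (c + d)) (hl c (c + d)))
  have p₄ : Submodule.span k {c + d} ⊔ Submodule.span k {d} =
      Submodule.span k {c} ⊔ Submodule.span k {d} :=
    hsup (Submodule.add_mem _ (hl c d) (hr c d)) (hr _ _)
      (by simpa using Submodule.sub_mem _ (hl (c + d) d) (hr (c + d) d)) (hr _ _)
  have s₁ : hook R (Submodule.span k {a}) (Submodule.span k {a - b}) +
      hook R (Submodule.span k {a - b}) (Submodule.span k {b}) =
        hook R (Submodule.span k {a}) (Submodule.span k {b}) := hook_add_hook p₂ p₁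
  have s₂ : hook R (Submodule.span k {c}) (Submodule.span k {c + d}) +
      hook R (Submodule.span k {c + d}) (Submodule.span k {d}) =
        hook R (Submodule.span k {c}) (Submodule.span k {d}) := hook_add_hook p₃ p₄
  have a0 : a ≠ 0 := by rintro rfl; simp at hac
  have b0 : b ≠ 0 := by rintro rfl; simp at hbd
  have c0 : c ≠ 0 := by rintro rfl; simp at hac
  have ab0 : a - b ≠ 0 := fun e => by
    have : B (a - b) c = 0 := by rw [e]; simp
    simp [hac, hbc] at this
  have cd0 : c + d ≠ 0 := fun e => by
    have : B a (c + d) = 0 := by rw [e]; simp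
    simp [hac, had] at this
  have hw : quadrangle R (Submodule.span k {a - b}) (Submodule.span k {b}) (Submodule.span k {c})
      (Submodule.span k {c + d}) ∈ cyclesOn R (X.isotropicIn U) 1 := by
    have m₁ := U.sub_mem ha hb
    have m₂ := U.add_mem hc hd
    refine mem_cyclesOn.2 ⟨Submodule.add_mem _ (Submodule.add_mem _ (Submodule.add_mem _ ?_ ?_) ?_)
      ?_, boundary_quadrangle _ _ _ _⟩
    · exact h.hook_mem_supported_isotropicIn m₁ hb hq₁ hqb ab0 b0 (by simp [hab, hbb])
    · exact h.hook_mem_supported_isotropicIn hb hc hqb hqc b0 c0 hbc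
    · exact h.hook_mem_supported_isotropicIn hc m₂ hqc hq₂ c0 cd0 (by simp [hcc, hcd])
    · exact h.hook_mem_supported_isotropicIn m₂ m₁ hq₂ hq₁ cd0 ab0 (h.symm_zero horth)
  have key := Submodule.neg_mem _ (sub_mem_coinvariantsKer X.act (Γ := X.siegelIn B q U)
    ⟨a - b, U.sub_mem ha hb, c + d, U.add_mem hc hd, hq₁, hq₂, horth, hg⟩ hw)
  rw [chainRep_quadrangle, hg₁, hg₂, hg₃, hg₄] at key
  convert key using 1
  rw [quadrangle, ← s₁, ← s₂, quadrangle, quadrangle, hook_swap (Submodule.span k {a})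
    (Submodule.span k {a - b}), hook_swap (Submodule.span k {a}) (Submodule.span k {d}),
    hook_swap (Submodule.span k {c + d}) (Submodule.span k {d})]
  abel

end IsPolar

end IsotropicGeometry

/-! ### Residues of polar spaces and induction on the Witt index -/

namespace IsotropicGeometry

open OrderComplex

variable {k G V : Type*} [Field k] [Group G] [AddCommGroup V] [Module k V]

/-- The vectors orthogonal to `W`. -/
def perp (B : LinearMap.BilinForm k V) (W : Submodule k V) : Submodule k V where
  carrier := {y | ∀ x ∈ W, B x y = 0}
  zero_mem' x _ := map_zero _
  add_mem' hy hz x hx := by rw [map_add, hy x hx, hz x hx, add_zero]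
  smul_mem' c y hy x hx := by rw [map_smul, hy x hx, smul_zero]

/-- The part of `U` orthogonal to `p` and to `W`. If `p` and `W` span a hyperbolic plane in `U`, this
is its orthogonal complement in `U`. -/
def residue (B : LinearMap.BilinForm k V) (U : Submodule k V) (p : V) (W : Submodule k V) :
    Submodule k V := U ⊓ LinearMap.ker (B p) ⊓ perp B W

variable {X : IsotropicGeometry k G V} {B : LinearMap.BilinForm k V} {q : V → k} {ε : k}

namespace IsPolar

variable (h : X.IsPolar B q ε)
include h

section Opposite

variable {U : Submodule k V} {p : V} (hpU : p ∈ U) (hp : q p = 0) (hp0 : p ≠ 0)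

omit h in
theorem sup_ker_eq_top {o : Submodule k V} (ho : o ∈ X.isotropicIn U)
    (hoc : o ⊓ LinearMap.ker (B p) = ⊥) : o ⊔ LinearMap.ker (B p) = ⊤ := by
  obtain ⟨f, hf, hf0⟩ := o.ne_bot_iff.1 ho.1
  have hpf : B p f ≠ 0 := fun e =>
    hf0 ((Submodule.mem_bot k).1 (hoc ▸ ⟨hf, LinearMap.mem_ker.2 e⟩))
  refine eq_top_iff.2 fun x _ => Submodule.mem_sup.2
    ⟨(B p x / B p f) • f, o.smul_mem _ hf, x - (B p x / B p f) • f, ?_, by abel⟩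
  simp [hpf]

theorem exists_opposite {o : Submodule k V} (ho : o ∈ X.isotropicIn U)
    (hoc : o ⊓ LinearMap.ker (B p) = ⊥) :
    ∃ f ∈ U, q f = 0 ∧ B p f = 1 ∧ o = Submodule.span k {f} := by
  obtain ⟨f, hf, hf0⟩ := o.ne_bot_iff.1 ho.1
  have hpf : B p f ≠ 0 := fun e =>
    hf0 ((Submodule.mem_bot k).1 (hoc ▸ ⟨hf, LinearMap.mem_ker.2 e⟩))
  have hf' : (B p f)⁻¹ • f ∈ o := o.smul_mem _ hf
  have hpf' : B p ((B p f)⁻¹ • f) = 1 := by simp [hpf]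
  refine ⟨_, ho.2.1 hf', (((h.isotropic_iff o).1 ho.2.2) _ hf').1, hpf', le_antisymm ?_
    ((Submodule.span_singleton_le_iff_mem _ _).2 hf')⟩
  intro x hx
  have hx' : x - B p x • (B p f)⁻¹ • f ∈ o ⊓ LinearMap.ker (B p) := by
    refine ⟨o.sub_mem hx (o.smul_mem _ hf'), ?_⟩
    rw [SetLike.mem_coe, LinearMap.mem_ker, map_sub, map_smul, hpf', smul_eq_mul, mul_one, sub_self]
  rw [hoc, Submodule.mem_bot, sub_eq_zero] at hx'
  exact Submodule.mem_span_singleton.2 ⟨_, hx'.symm⟩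

theorem isOppositeSystem : IsOppositeSystem (X.isotropicIn U) (LinearMap.ker (B p))
    fun o => X.isotropicIn (residue B U p o) where
  bot_notMem hb := hb.1 rfl
  le_sup o ho hoc W _ := by rw [sup_ker_eq_top ho hoc]; exact le_top
  inf_mem o ho hoc W hW hoW := by
    refine ⟨fun hb => ?_, ?_, h.isotropic_mono inf_le_left hW.2.2⟩
    · have e := sup_inf_assoc_of_le (LinearMap.ker (B p)) hoW.le
      rw [sup_ker_eq_top ho hoc, top_inf_eq, inf_comm, hb, sup_bot_eq] at e
      exact hoW.ne' e
    · exact le_inf (inf_le_inf_right _ hW.2.1) fun y hy x hx =>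
        ((h.isotropic_iff W).1 hW.2.2 x (hoW.le hx)).2 y hy.1
  subset o _ _ W hW := ⟨hW.1, hW.2.1.trans (inf_le_left.trans inf_le_left), hW.2.2⟩
  le o _ _ W hW := hW.2.1.trans (inf_le_left.trans inf_le_right)
  sup_mem o ho _ W hW := by
    refine ⟨fun hb => hW.1 (eq_bot_iff.2 (le_sup_left.trans hb.le)),
      sup_le (hW.2.1.trans (inf_le_left.trans inf_le_left)) ho.2.1, ?_⟩
    exact h.isotropic_sup hW.2.2 ho.2.2 fun x hx y hy => h.symm_zero ((hW.2.1 hx).2 y hy)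

include hpU hp hp0

/-- The isotropic subspaces that meet `p^⊥` are contracted by `W ≥ W ∩ p^⊥ ≤ (W ∩ p^⊥) + p ≥ p`. -/
theorem acyclic_nonopposite (R : Type*) [CommRing R] :
    Acyclic R {W ∈ X.isotropicIn U | W ⊓ LinearMap.ker (B p) ≠ ⊥} := by
  have hpS := h.span_mem_isotropicIn hpU hp hp0
  have hpker : Submodule.span k {p} ≤ LinearMap.ker (B p) :=
    (Submodule.span_singleton_le_iff_mem _ _).2 (h.self p hp)
  refine acyclic_of_zigzag (f := fun W => W ⊓ LinearMap.ker (B p))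
    (g := fun W => W ⊓ LinearMap.ker (B p) ⊔ Submodule.span k {p})
    (y₀ := Submodule.span k {p}) (monotone_inf _) ((monotone_sup _).comp (monotone_inf _))
    (fun W hW => ⟨⟨hW.2, inf_le_left.trans hW.1.2.1, h.isotropic_mono inf_le_left hW.1.2.2⟩, ?_⟩)
    (fun W hW => ⟨⟨?_, sup_le (inf_le_left.trans hW.1.2.1) hpS.2.1, ?_⟩, ?_⟩)
    ⟨hpS, by rw [inf_eq_left.2 hpker]; exact hpS.1⟩ (fun _ _ => inf_le_left) (fun _ _ => le_sup_left)
    fun _ _ => le_sup_right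
  · rw [inf_assoc, inf_idem]
    exact hW.2
  · exact fun hb => hpS.1 (eq_bot_iff.2 (le_sup_right.trans hb.le))
  · refine h.isotropic_sup (h.isotropic_mono inf_le_left hW.1.2.2) hpS.2.2 fun x hx y hy => ?_
    obtain ⟨c, rfl⟩ := Submodule.mem_span_singleton.1 hy
    rw [map_smul, h.symm_zero (LinearMap.mem_ker.1 hx.2), smul_zero]
  · rw [inf_eq_left.2 (sup_le inf_le_right hpker)]
    exact fun hb => hpS.1 (eq_bot_iff.2 (le_sup_right.trans hb.le))

variable {o : Submodule k V} (ho : o ∈ X.isotropicIn U) (hoc : o ⊓ LinearMap.ker (B p) = ⊥)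
include ho hoc

omit hp0 in
/-- Orthogonal projection to the complement of a hyperbolic plane. -/
theorem exists_ne_residue (hU : ∀ x ∈ U, q x = 0 → x ≠ 0 → ∃ y ∈ U, B x y ≠ 0) :
    ∀ x ∈ residue B U p o, q x = 0 → x ≠ 0 → ∃ y ∈ residue B U p o, B x y ≠ 0 := by
  intro x hx hqx hx0
  obtain ⟨f, hfU, hf, hpf, rfl⟩ := h.exists_opposite ho hoc
  obtain ⟨y, hy, hxy⟩ := hU x hx.1.1 hqx hx0
  have hpp := h.self p hp
  have hff := h.self f hf
  have hfx : B f x = 0 := hx.2 f (Submodule.mem_span_singleton_self f)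
  have hfp : B f p ≠ 0 := fun e => one_ne_zero (hpf.symm.trans (h.symm_zero e))
  refine ⟨y - (B f y / B f p) • p - B p y • f, ⟨⟨?_, ?_⟩, ?_⟩, ?_⟩
  · exact U.sub_mem (U.sub_mem hy (U.smul_mem _ hpU)) (U.smul_mem _ hfU)
  · rw [SetLike.mem_coe, LinearMap.mem_ker]
    simp [hpp, hpf]
  · intro z hz
    obtain ⟨c, rfl⟩ := Submodule.mem_span_singleton.1 hz
    simp [hff, hfp]
  · simpa [h.symm_zero (LinearMap.mem_ker.1 hx.1.2), h.symm_zero hfx] using hxy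

theorem finrank_residue_lt [FiniteDimensional k V] {W : Submodule k V}
    (hW : W ∈ X.isotropicIn (residue B U p o)) :
    ∃ W' ∈ X.isotropicIn U, Module.finrank k W < Module.finrank k W' := by
  obtain ⟨f, hfU, hf, hpf, rfl⟩ := h.exists_opposite ho hoc
  have hpS := h.span_mem_isotropicIn hpU hp hp0
  refine ⟨W ⊔ Submodule.span k {p}, ⟨fun hb => hW.1 (eq_bot_iff.2 (le_sup_left.trans hb.le)),
    sup_le (hW.2.1.trans (inf_le_left.trans inf_le_left)) hpS.2.1, ?_⟩,
    Submodule.finrank_lt_finrank_of_lt (left_lt_sup.2 fun hle => ?_)⟩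
  · refine h.isotropic_sup hW.2.2 hpS.2.2 fun x hx y hy => ?_
    obtain ⟨c, rfl⟩ := Submodule.mem_span_singleton.1 hy
    rw [map_smul, h.symm_zero (LinearMap.mem_ker.1 (hW.2.1 hx).1.2), smul_zero]
  · have hfp := (hW.2.1 (hle (Submodule.mem_span_singleton_self p))).2 f
      (Submodule.mem_span_singleton_self f)
    exact one_ne_zero (hpf.symm.trans (h.symm_zero hfp))

omit hpU hp hp0 in
theorem coinvariantsKer_residue_le (R : Type*) [CommRing R] (m : ℕ)
    (hY : Acyclic R {W ∈ X.isotropicIn U | W ⊓ LinearMap.ker (B p) ≠ ⊥}) :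
    coinvariantsKer X.act R (X.isotropicIn (residue B U p o)) (X.siegelIn B q (residue B U p o)) m ≤
      (coinvariantsKer X.act R (X.isotropicIn U) (X.siegelIn B q U) (m + 1) ⊔
        supported R {W ∈ X.isotropicIn U | W ⊓ LinearMap.ker (B p) ≠ ⊥} (m + 2)).comap
        (coneHtpy R o (m + 1)) := by
  have hle : residue B U p o ≤ U := inf_le_left.trans inf_le_left
  refine h.isOppositeSystem.coinvariantsKer_le_comap X.act hY ho hoc ?_ ?_ ?_ ?_
  · rintro g ⟨a, ha, b, hb, hg⟩
    exact ⟨a, hle ha, b, hle hb, hg⟩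
  · rintro g ⟨a, ha, b, hb, hqa, hqb, hab, hg⟩
    refine h.act_eq_of_siegel hqa hqb hab hg fun x hx => ?_
    rw [hb.2 x hx, h.symm_zero (ha.2 x hx), zero_smul, zero_smul, sub_zero]
    exact o.zero_mem
  · rintro g ⟨a, ha, b, hb, hqa, hqb, hab, hg⟩
    exact h.act_eq_of_siegel hqa hqb hab hg fun x _ => Submodule.sub_mem _
      (Submodule.smul_mem _ _ ha.1.2) (Submodule.smul_mem _ _ hb.1.2)
  · rintro g ⟨a, ha, b, hb, hqa, hqb, hab, hg⟩ W hW
    refine ⟨fun e => hW.1 ((map_eq_bot_iff (X.act g)).1 e), ?_, X.isotropic_map g W hW.2.2⟩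
    have hgU : X.act g U = U := h.act_eq_of_siegel hqa hqb hab hg fun x _ =>
      U.sub_mem (U.smul_mem _ (hle ha)) (U.smul_mem _ (hle hb))
    exact ((X.act g).monotone hW.2.1).trans hgU.le

/-- In Witt index `2`, two isotropic lines orthogonal to a hyperbolic plane span another one, and
the two planes give an apartment. -/
theorem cyclesOn_residue_le (R : Type*) [CommRing R] [FiniteDimensional k V]
    (hrank : ∀ W ∈ X.isotropicIn U, Module.finrank k W ≤ 2) :
    cyclesOn R (X.isotropicIn (residue B U p o)) 0 ≤
      (coinvariantsKer X.act R (X.isotropicIn U) (X.siegelIn B q U) 1 ⊔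
        supported R {W ∈ X.isotropicIn U | W ⊓ LinearMap.ker (B p) ≠ ⊥} 2).comap
        (coneHtpy R o 1) := by
  refine cyclesOn_zero_le fun W₁ hW₁ W₂ hW₂ => ?_
  by_cases hne : W₁ = W₂
  · rw [hne, sub_self]
    exact Submodule.zero_mem _
  have hrank1 : ∀ W ∈ X.isotropicIn (residue B U p o), Module.finrank k W ≤ 1 := fun W hW => by
    obtain ⟨W', hW', hlt⟩ := h.finrank_residue_lt hpU hp hp0 ho hoc hW
    have := hrank W' hW'
    omega
  have hline : ∀ W ∈ X.isotropicIn (residue B U p o), ∃ x : V, x ≠ 0 ∧ q x = 0 ∧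
      x ∈ residue B U p o ∧ W = Submodule.span k {x} := by
    intro W hW
    obtain ⟨x, hx, hx0⟩ := W.ne_bot_iff.1 hW.1
    refine ⟨x, hx0, ((h.isotropic_iff W).1 hW.2.2 x hx).1, hW.2.1 hx,
      (Submodule.eq_of_le_of_finrank_le ((Submodule.span_singleton_le_iff_mem _ _).2 hx) ?_).symm⟩
    rw [finrank_span_singleton hx0]
    exact hrank1 W hW
  obtain ⟨x, hx0, hqx, hx, rfl⟩ := hline W₁ hW₁
  obtain ⟨y, hy0, hqy, hy, rfl⟩ := hline W₂ hW₂
  have hxy : B x y ≠ 0 := by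
    intro hxy
    have hiso : X.isotropic (Submodule.span k {x} ⊔ Submodule.span k {y}) :=
      h.isotropic_sup hW₁.2.2 hW₂.2.2 fun z hz t ht => by
        obtain ⟨c, rfl⟩ := Submodule.mem_span_singleton.1 hz
        obtain ⟨d, rfl⟩ := Submodule.mem_span_singleton.1 ht
        simp [hxy]
    have hle := hrank1 _ ⟨fun e => hW₁.1 (eq_bot_iff.2 (le_sup_left.trans e.le)),
      sup_le hW₁.2.1 hW₂.2.1, hiso⟩
    have e₁ := Submodule.eq_of_le_of_finrank_le
      (le_sup_left : Submodule.span k {x} ≤ Submodule.span k {x} ⊔ Submodule.span k {y})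
      (by rwa [finrank_span_singleton hx0])
    have e₂ := Submodule.eq_of_le_of_finrank_le
      (le_sup_right : Submodule.span k {y} ≤ Submodule.span k {x} ⊔ Submodule.span k {y})
      (by rwa [finrank_span_singleton hy0])
    exact hne (e₁.trans e₂.symm)
  obtain ⟨f, hfU, hf, hpf, rfl⟩ := h.exists_opposite ho hoc
  -- rescale `y` so that `x, y` is a hyperbolic pair
  obtain ⟨d, hd, hqd, hxd, hd0, hspan⟩ : ∃ d ∈ residue B U p (Submodule.span k {f}), q d = 0 ∧
      B x d = 1 ∧ d ≠ 0 ∧ Submodule.span k {y} = Submodule.span k {d} := by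
    refine ⟨(B x y)⁻¹ • y, Submodule.smul_mem _ _ hy, h.q_smul _ _ hqy, by simp [hxy],
      smul_ne_zero (inv_ne_zero hxy) hy0, ?_⟩
    exact (Submodule.span_singleton_smul_eq (IsUnit.mk0 _ (inv_ne_zero hxy)) y).symm
  have hpx : B p x = 0 := LinearMap.mem_ker.1 hx.1.2
  have hpd : B p d = 0 := LinearMap.mem_ker.1 hd.1.2
  have hfx : B f x = 0 := hx.2 f (Submodule.mem_span_singleton_self f)
  have hfd : B f d = 0 := hd.2 f (Submodule.mem_span_singleton_self f)
  have key := h.quadrangle_mem_coinvariantsKer R hpU hx.1.1 hfU hd.1.1 hp hqx hf hqd hpf hxd hpx hpd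
    (h.symm_zero hfx) hfd
  have hY : ∀ z ∈ residue B U p (Submodule.span k {f}), q z = 0 → z ≠ 0 →
      hook R (Submodule.span k {p}) (Submodule.span k {z}) ∈
        supported R {W ∈ X.isotropicIn U | W ⊓ LinearMap.ker (B p) ≠ ⊥} 2 := by
    intro z hz hqz hz0
    have h1 := h.hook_mem_supported_isotropicIn (R := R) (U := U ⊓ LinearMap.ker (B p))
      ⟨hpU, h.self p hp⟩ hz.1 hp hqz hp0 hz0 (LinearMap.mem_ker.1 hz.1.2)
    refine supported_mono (S := X.isotropicIn (U ⊓ LinearMap.ker (B p)))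
      (T := {W ∈ X.isotropicIn U | W ⊓ LinearMap.ker (B p) ≠ ⊥}) (fun W hW => ⟨⟨hW.1, hW.2.1.trans inf_le_left, hW.2.2⟩, ?_⟩) 2 h1
    rw [inf_eq_left.2 (hW.2.1.trans inf_le_right)]
    exact hW.1
  rw [Submodule.mem_comap, map_sub, coneHtpy_point, coneHtpy_point, hspan]
  have e : hook R (Submodule.span k {f}) (Submodule.span k {x}) -
      hook R (Submodule.span k {f}) (Submodule.span k {d}) =
        -quadrangle R (Submodule.span k {p}) (Submodule.span k {x}) (Submodule.span k {f})
          (Submodule.span k {d}) + (hook R (Submodule.span k {p}) (Submodule.span k {x}) -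
            hook R (Submodule.span k {p}) (Submodule.span k {d})) := by
    rw [quadrangle, hook_swap (Submodule.span k {f}) (Submodule.span k {x}),
      hook_swap (Submodule.span k {p}) (Submodule.span k {d})]
    abel
  rw [e]
  exact Submodule.add_mem_sup (Submodule.neg_mem _ key)
    (Submodule.sub_mem _ (hY x hx hqx hx0) (hY d hd hqd hd0))

end Opposite

/-- The step is `coinvariantsKer_residue_le`, since the residue of an opposite line has smaller Witt
index. -/
theorem cyclesOn_le_coinvariantsKer (R : Type*) [CommRing R] [FiniteDimensional k V] (m : ℕ)
    (U : Submodule k V) (hU : ∀ x ∈ U, q x = 0 → x ≠ 0 → ∃ y ∈ U, B x y ≠ 0)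
    (hrank : ∀ W ∈ X.isotropicIn U, Module.finrank k W ≤ m + 2) :
    cyclesOn R (X.isotropicIn U) (m + 1) ≤
      coinvariantsKer X.act R (X.isotropicIn U) (X.siegelIn B q U) (m + 1) := by
  induction m generalizing U with
  | zero =>
    rintro z hz
    obtain he | ⟨W, hW⟩ := (X.isotropicIn U).eq_empty_or_nonempty
    · exact supported_le (fun s hs => (Set.eq_empty_iff_forall_notMem.1 he _ (hs 0)).elim) hz.1
    obtain ⟨p, hpW, hp0⟩ := W.ne_bot_iff.1 hW.1
    have hp := ((h.isotropic_iff W).1 hW.2.2 p hpW).1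
    have hpU := hW.2.1 hpW
    exact h.isOppositeSystem.cyclesOn_le X.act (h.acyclic_nonopposite hpU hp hp0 R)
      (fun o ho hoc => h.cyclesOn_residue_le hpU hp hp0 ho hoc R hrank) hz
  | succ m ih =>
    rintro z hz
    obtain he | ⟨W, hW⟩ := (X.isotropicIn U).eq_empty_or_nonempty
    · exact supported_le (fun s hs => (Set.eq_empty_iff_forall_notMem.1 he _ (hs 0)).elim) hz.1
    obtain ⟨p, hpW, hp0⟩ := W.ne_bot_iff.1 hW.1
    have hp := ((h.isotropic_iff W).1 hW.2.2 p hpW).1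
    have hpU := hW.2.1 hpW
    have hY := h.acyclic_nonopposite hpU hp hp0 R
    refine h.isOppositeSystem.cyclesOn_le X.act hY (fun o ho hoc => ?_) hz
    refine (ih _ (h.exists_ne_residue hpU hp ho hoc hU) fun W' hW' => ?_).trans
      (h.coinvariantsKer_residue_le ho hoc R (m + 1) hY)
    obtain ⟨W'', hW'', hlt⟩ := h.finrank_residue_lt hpU hp hp0 ho hoc hW'
    have := hrank W'' hW''
    omega

theorem subsingleton_coinvariants (R : Type*) [CommRing R] [FiniteDimensional k V] {n : ℕ}
    (hn : 2 ≤ n) (hrank : ∀ W, X.isotropic W → Module.finrank k W ≤ n) :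
    Subsingleton (X.steinberg R n).Coinvariants := by
  obtain ⟨m, rfl⟩ := Nat.exists_eq_add_of_le' hn
  refine X.subsingleton_coinvariants_steinberg h.leastTermFixed ?_
  rw [h.moved_eq]
  refine (h.cyclesOn_le_coinvariantsKer R m ⊤ (fun x _ hx hx0 => ?_) fun W hW =>
    hrank W hW.2.2).trans (coinvariantsKer_mono _ (Set.subset_univ _) _)
  obtain ⟨y, hy⟩ := h.exists_ne x hx hx0
  exact ⟨y, trivial, hy⟩

end IsPolar

end IsotropicGeometry

/-! ### The five families -/

namespace IsotropicGeometry

/-- A dimension count for subspaces `W` that are isotropic for a pairing of the kernel of `D` with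
its range. -/
theorem finrank_le_of_annihilator {k V D' : Type*} [Field k] [AddCommGroup V] [Module k V]
    [AddCommGroup D'] [Module k D'] [FiniteDimensional k V] [FiniteDimensional k D']
    (D : V →ₗ[k] D') (Φ : V →ₗ[k] Module.Dual k D') (W : Submodule k V)
    (h0 : ∀ x ∈ W, D x = 0 → Φ x = 0 → x = 0)
    (h1 : ∀ x ∈ W, D x = 0 → ∀ y ∈ W, Φ x (D y) = 0) :
    Module.finrank k W ≤ Module.finrank k D' := by
  let DW := D.domRestrict W
  let Ψ : LinearMap.ker DW →ₗ[k] (LinearMap.range DW).dualAnnihilator :=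
    LinearMap.codRestrict _ (Φ ∘ₗ W.subtype ∘ₗ (LinearMap.ker DW).subtype) (by
      rintro ⟨x, hx⟩
      rw [Submodule.mem_dualAnnihilator]
      rintro _ ⟨y, rfl⟩
      exact h1 x x.2 hx y y.2)
  have hΨ : Function.Injective Ψ := by
    refine (injective_iff_map_eq_zero Ψ).2 ?_
    rintro ⟨x, hx⟩ hx'
    exact Subtype.ext (Subtype.ext (h0 x x.2 hx (congrArg Subtype.val hx')))
  have e1 := LinearMap.finrank_le_finrank_of_injective hΨ
  have e2 := DW.finrank_range_add_finrank_ker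
  have e3 := Subspace.finrank_add_finrank_dualAnnihilator_eq (LinearMap.range DW)
  omega

variable {k V : Type*} [Field k] [AddCommGroup V] [Module k V]

/-- The Siegel transvection is a product of two transvections of `V`, so its determinant is `1`. -/
theorem exists_siegel_det_one [FiniteDimensional k V] {B : LinearMap.BilinForm k V} {a b : V}
    (hab : B a b = 0) (hbb : B b b = 0) :
    ∃ f : V →ₗ[k] V, LinearMap.det f = 1 ∧ ∀ x, f x = x + (B x b • a - B a x • b) := by
  refine ⟨LinearMap.transvection (B.flip b) a ∘ₗ LinearMap.transvection (-(B a)) b, ?_, fun x => ?_⟩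
  · rw [LinearMap.det_comp, LinearMap.transvection.det, LinearMap.transvection.det]
    simp [hab]
  · have hflip : ∀ y, B.flip b y = B y b := fun _ => rfl
    rw [LinearMap.comp_apply, LinearMap.transvection.apply, LinearMap.transvection.apply,
      LinearMap.neg_apply, hflip, map_add, map_smul, LinearMap.add_apply, LinearMap.smul_apply, hbb,
      smul_zero, add_zero, neg_smul]
    abel

end IsotropicGeometry

namespace Classical5

open IsotropicGeometry

variable {k : Type*} [Field k]

theorem exists_matrix {ι : Type*} [Fintype ι] [DecidableEq ι] {f : (ι → k) →ₗ[k] (ι → k)}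
    (hf : LinearMap.det f = 1) :
    ∃ A : Matrix.SpecialLinearGroup ι k, ∀ x, A.1.mulVec x = f x :=
  ⟨⟨LinearMap.toMatrix' f, by rw [LinearMap.det_toMatrix', hf]⟩, fun x =>
    LinearMap.toMatrix'_mulVec f x⟩

theorem isLinear_geometrySL (n : ℕ) : (geometrySL k n).IsLinear where
  isotropic _ := trivial
  exists_transvection φ w hφ := exists_matrix (f := LinearMap.transvection φ w) (by
    rw [LinearMap.transvection.det, hφ, add_zero])

theorem isLinear_geometryGL (n : ℕ) : (geometryGL k n).IsLinear where
  isotropic _ := trivial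
  exists_transvection φ w hφ := by
    obtain ⟨A, hA⟩ := (isLinear_geometrySL n).exists_transvection φ w hφ
    exact ⟨A.toGL, hA⟩

section Symplectic

variable (k) in
/-- The standard symplectic form as a bilinear form. -/
noncomputable def symplecticBilin (n : ℕ) : LinearMap.BilinForm k (Fin n ⊕ Fin n → k) :=
  LinearMap.mk₂ k (symplecticForm k)
    (fun x x' y => by
      simp only [symplecticForm, Pi.add_apply, ← Finset.sum_add_distrib]
      exact Finset.sum_congr rfl fun _ _ => by ring)
    (fun c x y => by
      simp only [symplecticForm, Pi.smul_apply, smul_eq_mul, Finset.mul_sum]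
      exact Finset.sum_congr rfl fun _ _ => by ring)
    (fun x y y' => by
      simp only [symplecticForm, Pi.add_apply, ← Finset.sum_add_distrib]
      exact Finset.sum_congr rfl fun _ _ => by ring)
    (fun c x y => by
      simp only [symplecticForm, Pi.smul_apply, smul_eq_mul, Finset.mul_sum]
      exact Finset.sum_congr rfl fun _ _ => by ring)

theorem symplecticBilin_apply {n : ℕ} (x y : Fin n ⊕ Fin n → k) :
    symplecticBilin k n x y = symplecticForm k x y := rfl

theorem symplecticForm_self {n : ℕ} (x : Fin n ⊕ Fin n → k) : symplecticForm k x x = 0 :=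
  Finset.sum_eq_zero fun _ _ => by ring

theorem symplecticForm_swap {n : ℕ} (x y : Fin n ⊕ Fin n → k) :
    symplecticForm k x y = - symplecticForm k y x := by
  rw [symplecticForm, symplecticForm, ← Finset.sum_neg_distrib]
  exact Finset.sum_congr rfl fun _ _ => by ring

theorem symplecticForm_single_inr {n : ℕ} (x : Fin n ⊕ Fin n → k) (j : Fin n) :
    symplecticForm k x (Pi.single (Sum.inr j) 1) = x (Sum.inl j) := by
  rw [symplecticForm, Finset.sum_eq_single j]
  · simp
  · intro i _ hi
    simp [hi]
  · simp

theorem symplecticForm_single_inl {n : ℕ} (x : Fin n ⊕ Fin n → k) (j : Fin n) :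
    symplecticForm k x (Pi.single (Sum.inl j) 1) = - x (Sum.inr j) := by
  rw [symplecticForm, Finset.sum_eq_single j]
  · simp
  · intro i _ hi
    simp [hi]
  · simp

theorem single_independent {ι : Type*} [DecidableEq ι] {i j : ι} (hij : i ≠ j) (s t : k)
    (h : s • (Pi.single i 1 : ι → k) + t • (Pi.single j 1 : ι → k) = 0) : s = 0 ∧ t = 0 := by
  have h1 := congrFun h i
  have h2 := congrFun h j
  simp [hij] at h1
  simp [hij.symm] at h2
  exact ⟨h1, h2⟩

theorem isPolar_geometrySp {n : ℕ} (hn : 2 ≤ n) :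
    (geometrySp k n).IsPolar (symplecticBilin k n) (fun _ => 0) (-1) where
  isotropic_iff W := by simp [geometrySp, symplecticBilin_apply]
  symm x y := by
    rw [symplecticBilin_apply, symplecticBilin_apply, symplecticForm_swap, neg_one_mul]
  q_smul _ _ _ := rfl
  q_add _ _ _ _ _ := rfl
  self x _ := symplecticForm_self x
  q_sub _ _ _ _ := rfl
  exists_ne x _ hx := by
    obtain ⟨i, hi⟩ := Function.ne_iff.1 hx
    obtain j | j := i
    · exact ⟨_, by rwa [symplecticBilin_apply, symplecticForm_single_inr]⟩
    · exact ⟨_, by rwa [symplecticBilin_apply, symplecticForm_single_inl, neg_ne_zero]⟩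
  exists_siegel a b _ _ hab := by
    obtain ⟨f, hf, hfx⟩ := exists_siegel_det_one hab (symplecticForm_self b)
    obtain ⟨A, hA⟩ := exists_matrix hf
    refine ⟨⟨A.toGL, fun x y => ?_⟩, fun x => (hA x).trans (hfx x)⟩
    change symplecticForm k (A.1.mulVec x) (A.1.mulVec y) = _
    rw [hA, hA, hfx, hfx, ← symplecticBilin_apply, ← symplecticBilin_apply]
    have haa : symplecticBilin k n a a = 0 := symplecticForm_self a
    have hbb : symplecticBilin k n b b = 0 := symplecticForm_self b
    have hba : symplecticBilin k n b a = 0 := (symplecticForm_swap b a).trans (by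
      rw [← symplecticBilin_apply, hab, neg_zero])
    have h1 : symplecticBilin k n x a = - symplecticBilin k n a x := symplecticForm_swap x a
    have h2 : symplecticBilin k n b y = - symplecticBilin k n y b := symplecticForm_swap b y
    simp only [map_add, map_sub, map_smul, LinearMap.add_apply, LinearMap.sub_apply,
      LinearMap.smul_apply, smul_eq_mul, haa, hbb, hab, hba, h1, h2]
    ring
  exists_plane := by
    refine ⟨Pi.single (Sum.inl ⟨0, by omega⟩) 1, Pi.single (Sum.inl ⟨1, by omega⟩) 1, rfl, rfl, ?_,
      single_independent (by simp)⟩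
    rw [symplecticBilin_apply, symplecticForm_single_inl]
    simp

theorem finrank_le_of_isotropic_geometrySp {n : ℕ} {W : Submodule k (Fin n ⊕ Fin n → k)}
    (hW : (geometrySp k n).isotropic W) : Module.finrank k W ≤ n := by
  have key := finrank_le_of_annihilator (LinearMap.funLeft k k Sum.inr)
    (dotProductBilin k k ∘ₗ LinearMap.funLeft k k Sum.inl) W (fun x _ h1 h2 => ?_)
    fun x hx h1 y hy => ?_
  · simpa using key
  · have h2' : LinearMap.funLeft k k Sum.inl x = 0 := dotProduct_eq_zero_iff.1 fun v =>
      LinearMap.congr_fun h2 v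
    funext i
    obtain j | j := i
    · exact congrFun h2' j
    · exact congrFun h1 j
  · have h3 := hW x hx y hy
    have h4 : ∀ j, x (Sum.inr j) = 0 := fun j => congrFun h1 j
    simp only [symplecticForm, h4, zero_mul, sub_zero] at h3
    exact h3

end Symplectic

section Orthogonal

/-- The stabilizer in `SL` of a quadratic form without singular vectors in the radical and with an
isotropic plane. -/
theorem isPolar_geometrySO {ι : Type*} [Fintype ι] [DecidableEq ι] {q : (ι → k) → k}
    (B : LinearMap.BilinForm k (ι → k)) (hadd : ∀ x y, q (x + y) = q x + q y + B x y)
    (hsmul : ∀ (c : k) x, q (c • x) = c * c * q x)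
    (hne : ∀ x, q x = 0 → x ≠ 0 → ∃ y, B x y ≠ 0)
    (hplane : ∃ e₁ e₂, q e₁ = 0 ∧ q e₂ = 0 ∧ B e₁ e₂ = 0 ∧
      ∀ s t : k, s • e₁ + t • e₂ = 0 → s = 0 ∧ t = 0) : (geometrySO q).IsPolar B q 1 := by
  have hB : ∀ x y, B x y = q (x + y) - q x - q y := fun x y => by
    rw [hadd]
    ring
  have hsymm : ∀ x y, B x y = B y x := fun x y => by
    rw [hB, hB, add_comm y x]
    ring
  have hself : ∀ x, q x = 0 → B x x = 0 := fun x hx => by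
    rw [hB, ← two_smul k x, hsmul, hx]
    ring
  refine ⟨fun W => ⟨fun h x hx => ⟨h x hx, fun y hy => ?_⟩, fun h x hx => (h x hx).1⟩,
    fun x y => by rw [hsymm, one_mul], fun c x hx => by rw [hsmul, hx, mul_zero],
    fun x y hx hy hxy => by rw [hadd, hx, hy, hxy]; simp, hself, fun x y hx hxy => ?_, hne,
    fun a b ha hb hab => ?_, hplane⟩
  · rw [hB, h x hx, h y hy, h _ (W.add_mem hx hy)]
    ring
  · rw [sub_eq_add_neg, ← neg_smul, hadd, hsmul, hx, map_smul, hsymm y x, hxy, smul_eq_mul]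
    ring
  · obtain ⟨f, hf, hfx⟩ := exists_siegel_det_one hab (hself b hb)
    obtain ⟨A, hA⟩ := exists_matrix hf
    refine ⟨⟨A, fun x => ?_⟩, fun x => (hA x).trans (hfx x)⟩
    have h1 : q (B x b • a - B a x • b) = 0 := by
      rw [sub_eq_add_neg, ← neg_smul, hadd, hsmul, hsmul, ha, hb, map_smul, map_smul,
        LinearMap.smul_apply, hab]
      simp
    rw [hA, hfx, hadd, h1, map_sub, map_smul, map_smul, hsymm a x, smul_eq_mul, smul_eq_mul]
    ring

variable (k) in
/-- The polar form of `qEven`. -/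
noncomputable def bilinEven (n : ℕ) : LinearMap.BilinForm k (Fin n ⊕ Fin n → k) :=
  (dotProductBilin k k).compl₁₂ (LinearMap.funLeft k k Sum.inl) (LinearMap.funLeft k k Sum.inr) +
    (dotProductBilin k k).compl₁₂ (LinearMap.funLeft k k Sum.inr) (LinearMap.funLeft k k Sum.inl)

theorem bilinEven_apply {n : ℕ} (x y : Fin n ⊕ Fin n → k) : bilinEven k n x y =
    ∑ j, x (Sum.inl j) * y (Sum.inr j) + ∑ j, x (Sum.inr j) * y (Sum.inl j) := rfl

variable (k) in
/-- The polar form of `qOdd`. -/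
noncomputable def bilinOdd (n : ℕ) : LinearMap.BilinForm k ((Fin n ⊕ Fin n) ⊕ Unit → k) :=
  (bilinEven k n).compl₁₂ (LinearMap.funLeft k k Sum.inl) (LinearMap.funLeft k k Sum.inl) +
    (2 : k) • (LinearMap.mul k k).compl₁₂ (LinearMap.proj (Sum.inr ())) (LinearMap.proj (Sum.inr ()))

theorem bilinOdd_apply {n : ℕ} (x y : (Fin n ⊕ Fin n) ⊕ Unit → k) : bilinOdd k n x y =
    ∑ j, x (Sum.inl (Sum.inl j)) * y (Sum.inl (Sum.inr j)) +
      ∑ j, x (Sum.inl (Sum.inr j)) * y (Sum.inl (Sum.inl j)) +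
        2 * (x (Sum.inr ()) * y (Sum.inr ())) := rfl

theorem bilinEven_single_inr {n : ℕ} (x : Fin n ⊕ Fin n → k) (j : Fin n) :
    bilinEven k n x (Pi.single (Sum.inr j) 1) = x (Sum.inl j) := by
  rw [bilinEven_apply, Finset.sum_eq_single j]
  · simp
  · intro i _ hi
    simp [hi]
  · simp

theorem bilinEven_single_inl {n : ℕ} (x : Fin n ⊕ Fin n → k) (j : Fin n) :
    bilinEven k n x (Pi.single (Sum.inl j) 1) = x (Sum.inr j) := by
  rw [bilinEven_apply, add_comm, Finset.sum_eq_single j]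
  · simp
  · intro i _ hi
    simp [hi]
  · simp

theorem exists_bilinEven_ne {n : ℕ} {x : Fin n ⊕ Fin n → k} (hx : x ≠ 0) :
    ∃ y, bilinEven k n x y ≠ 0 := by
  obtain ⟨i, hi⟩ := Function.ne_iff.1 hx
  obtain j | j := i
  · exact ⟨_, by rwa [bilinEven_single_inr]⟩
  · exact ⟨_, by rwa [bilinEven_single_inl]⟩

theorem isPolar_geometrySO_qEven {n : ℕ} (hn : 2 ≤ n) :
    (geometrySO (qEven k n)).IsPolar (bilinEven k n) (qEven k n) 1 := by
  refine isPolar_geometrySO _ (fun x y => ?_) (fun c x => ?_) (fun x _ hx => exists_bilinEven_ne hx)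
    ⟨Pi.single (Sum.inl ⟨0, by omega⟩) 1, Pi.single (Sum.inl ⟨1, by omega⟩) 1, ?_, ?_, ?_,
      single_independent (by simp)⟩
  · simp only [qEven, bilinEven_apply, Pi.add_apply, ← Finset.sum_add_distrib]
    exact Finset.sum_congr rfl fun _ _ => by ring
  · simp only [qEven, Pi.smul_apply, smul_eq_mul, Finset.mul_sum]
    exact Finset.sum_congr rfl fun _ _ => by ring
  · simp [qEven]
  · simp [qEven]
  · simp [bilinEven_single_inl]

theorem isPolar_geometrySO_qOdd {n : ℕ} (hn : 2 ≤ n) :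
    (geometrySO (qOdd k n)).IsPolar (bilinOdd k n) (qOdd k n) 1 := by
  refine isPolar_geometrySO _ (fun x y => ?_) (fun c x => ?_) (fun x hq hx => ?_)
    ⟨Pi.single (Sum.inl (Sum.inl ⟨0, by omega⟩)) 1, Pi.single (Sum.inl (Sum.inl ⟨1, by omega⟩)) 1,
      ?_, ?_, ?_, single_independent (by simp)⟩
  · have e : ∑ j, (x + y) (Sum.inl (Sum.inl j)) * (x + y) (Sum.inl (Sum.inr j)) =
        ∑ j, x (Sum.inl (Sum.inl j)) * x (Sum.inl (Sum.inr j)) +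
        ∑ j, y (Sum.inl (Sum.inl j)) * y (Sum.inl (Sum.inr j)) +
        (∑ j, x (Sum.inl (Sum.inl j)) * y (Sum.inl (Sum.inr j)) +
          ∑ j, x (Sum.inl (Sum.inr j)) * y (Sum.inl (Sum.inl j))) := by
      simp only [Pi.add_apply, ← Finset.sum_add_distrib]
      exact Finset.sum_congr rfl fun _ _ => by ring
    rw [qOdd, e, qOdd, qOdd, bilinOdd_apply, Pi.add_apply]
    ring
  · have e : ∑ j, (c • x) (Sum.inl (Sum.inl j)) * (c • x) (Sum.inl (Sum.inr j)) =
        c * c * ∑ j, x (Sum.inl (Sum.inl j)) * x (Sum.inl (Sum.inr j)) := by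
      simp only [Pi.smul_apply, smul_eq_mul, Finset.mul_sum]
      exact Finset.sum_congr rfl fun _ _ => by ring
    rw [qOdd, e, qOdd, Pi.smul_apply, smul_eq_mul]
    ring
  -- A singular vector with vanishing hyperbolic coordinates is zero, since `q = λ ^ 2` there.
  · have hx' : x ∘ Sum.inl ≠ 0 := by
      intro h0
      have hl : ∀ i, x (Sum.inl i) = 0 := fun i => congrFun h0 i
      refine hx (funext fun i => ?_)
      obtain i | ⟨⟩ := i
      · exact hl i
      · simpa [qOdd, hl] using hq
    obtain ⟨y, hy⟩ := exists_bilinEven_ne hx'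
    refine ⟨Sum.elim y 0, ?_⟩
    rw [bilinOdd_apply]
    simpa [bilinEven_apply] using hy
  · simp [qOdd]
  · simp [qOdd]
  · simp [bilinOdd_apply, Pi.single_apply]

theorem finrank_le_of_isotropic_qEven {n : ℕ} {W : Submodule k (Fin n ⊕ Fin n → k)} (hn : 2 ≤ n)
    (hW : (geometrySO (qEven k n)).isotropic W) : Module.finrank k W ≤ n := by
  have hB := ((isPolar_geometrySO_qEven hn).isotropic_iff W).1 hW
  have key := finrank_le_of_annihilator (LinearMap.funLeft k k Sum.inr)
    (dotProductBilin k k ∘ₗ LinearMap.funLeft k k Sum.inl) W (fun x _ h1 h2 => ?_)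
    fun x hx h1 y hy => ?_
  · simpa using key
  · have h2' : LinearMap.funLeft k k Sum.inl x = 0 := dotProduct_eq_zero_iff.1 fun v =>
      LinearMap.congr_fun h2 v
    funext i
    obtain j | j := i
    · exact congrFun h2' j
    · exact congrFun h1 j
  · have h3 := (hB x hx).2 y hy
    have h4 : ∀ j, x (Sum.inr j) = 0 := fun j => congrFun h1 j
    simp only [bilinEven_apply, h4, zero_mul, Finset.sum_const_zero, add_zero] at h3
    exact h3

theorem finrank_le_of_isotropic_qOdd {n : ℕ} {W : Submodule k ((Fin n ⊕ Fin n) ⊕ Unit → k)}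
    (hn : 2 ≤ n) (hW : (geometrySO (qOdd k n)).isotropic W) : Module.finrank k W ≤ n := by
  have hB := ((isPolar_geometrySO_qOdd hn).isotropic_iff W).1 hW
  have hlast : ∀ x ∈ W, LinearMap.funLeft k k (Sum.inl ∘ Sum.inr) x = 0 → x (Sum.inr ()) = 0 := by
    intro x hx h1
    have h3 := hW x hx
    have h4 : ∀ j, x (Sum.inl (Sum.inr j)) = 0 := fun j => congrFun h1 j
    simpa [qOdd, h4] using h3
  have key := finrank_le_of_annihilator (LinearMap.funLeft k k (Sum.inl ∘ Sum.inr))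
    (dotProductBilin k k ∘ₗ LinearMap.funLeft k k (Sum.inl ∘ Sum.inl)) W (fun x hx h1 h2 => ?_)
    fun x hx h1 y hy => ?_
  · simpa using key
  · have h2' : LinearMap.funLeft k k (Sum.inl ∘ Sum.inl) x = 0 := dotProduct_eq_zero_iff.1 fun v =>
      LinearMap.congr_fun h2 v
    funext i
    obtain (j | j) | ⟨⟩ := i
    · exact congrFun h2' j
    · exact congrFun h1 j
    · exact hlast x hx h1
  · have h3 := (hB x hx).2 y hy
    have h4 : ∀ j, x (Sum.inl (Sum.inr j)) = 0 := fun j => congrFun h1 j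
    simp only [bilinOdd_apply, h4, hlast x hx h1, zero_mul, Finset.sum_const_zero, add_zero,
      mul_zero] at h3
    exact h3

end Orthogonal

end Classical5

theorem lemma2p3 (k : Type*) [Field k] (R : Type*) [CommRing R] (n : ℕ) (hn : 2 ≤ n) :
    Subsingleton (Classical5.steinbergGL k n R).Coinvariants ∧
    Subsingleton (Classical5.steinbergSL k n R).Coinvariants ∧
    Subsingleton (Classical5.steinbergSp k n R).Coinvariants ∧
    Subsingleton (Classical5.steinbergSOEven k n R).Coinvariants ∧
    Subsingleton (Classical5.steinbergSOOdd k n R).Coinvariants := by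
  have hfin : Module.finrank k (Fin n → k) = n - 1 + 1 := by
    rw [Module.finrank_fin_fun]
    omega
  refine ⟨(Classical5.isLinear_geometryGL n).subsingleton_coinvariants R (by omega) hfin,
    (Classical5.isLinear_geometrySL n).subsingleton_coinvariants R (by omega) hfin,
    (Classical5.isPolar_geometrySp hn).subsingleton_coinvariants R hn fun W hW =>
      Classical5.finrank_le_of_isotropic_geometrySp hW, ?_,
    (Classical5.isPolar_geometrySO_qOdd hn).subsingleton_coinvariants R hn fun W hW =>
      Classical5.finrank_le_of_isotropic_qOdd hn hW⟩
  rw [Classical5.steinbergSOEven, if_neg (by omega : n ≠ 1)]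
  exact (Classical5.isPolar_geometrySO_qEven hn).subsingleton_coinvariants R hn fun W hW =>
    Classical5.finrank_le_of_isotropic_qEven hn hW
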